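/- Let $P$ be a monic polynomial over $\mathbb{C}$ of degree $d$ with only simple roots, let $Q$ be a polynomial of degree $d-1$ which is non-zero at every root of $P$, let $A>0$, and let $R(w)=\sum_{j\ge 0}R_jw^j$ be holomorphic for $|w|<1/A$. Put $$\mathcal{P}=P\big(\tfrac{\partial}{\partial z}\big)+\tfrac1z\,Q\big(\tfrac{\partial}{\partial z}\big)+\tfrac1{z^2}\,R(z^{-1}).$$ Let $-\alpha$ be a root of $P$ and assume that $\tau_\alpha:=Q(-\alpha)/P'(-\alpha)$ satisfies $\operatorname{Re}\tau_\alpha>0$. Let $\Omega_\alpha=\{\alpha+re^{i\theta}: r>0,\ |\theta-\theta_0|<\omega\}$, with $0<\omega\le\pi/2$, be an open sector whose closure contains no $\beta\ne\alpha$ with $P(-\beta)=0$. For $\Lambda\ge A$ let $\widehat\Omega^\Lambda_\alpha$ be the union of the half-planes $\operatorname{Re}(e^{i\theta}z)>\Lambda$ over all $\theta$ with $|\theta-\theta_0|<\omega$, and let $\widehat{\mathcal H}_{\sigma}(\widehat\Omega^\Lambda_\alpha)$ be the space of holomorphic functions on $\widehat\Omega^\Lambda_\alpha$ that are bounded by a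 constant multiple of $\Delta^{\sigma}$, where $\Delta$ is the distance to the boundary of $\widehat\Omega^\Lambda_\alpha$. Powers of $\zeta_\alpha:=\zeta-\alpha$ are taken with $|\arg\zeta_\alpha-\theta_0|<\pi$, and powers of $z$ with $|\arg z+\theta_0|<\pi$. Two functions, on $\widehat\Omega_\alpha^{\Lambda_1}$ and $\widehat\Omega_\alpha^{\Lambda_2}$, are identified when they agree on $\widehat\Omega_\alpha^{\max(\Lambda_1,\Lambda_2)}$. Then the equation $\mathcal{P}\Psi=0$ has, for large enough $\Lambda$, a solution $\Psi_\alpha$ in $$e^{-\alpha z}\left[z^{-\tau_\alpha}+\widehat{\mathcal H}_{-\operatorname{Re}\tau_\alpha-1}(\widehat\Omega^{\Lambda}_\alpha)\right],$$ and this solution is unique up to the identification above (over all levels $\Lambda\ge A$). Moreover $\Psi_\alpha$ is the Borel sum, at base point $\alpha$ and along every ray in $\Omega_\alpha$, of a formal trans-monomial solution $$\tilde\Psi_\alpha=e^{-\alpha z}z^{-\tau_\alpha}\sum_{n\ge0}a_nz^{-n}\in e^{-\alpha z}z^{-\tau_\alpha}\,\mathbb{C}[\![z^{-1}]\!]$$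 of $\mathcal{P}\tilde\Phi=0$. Explicitly: the power series $\sum_n\frac{a_n}{\Gamma(\tau_\alpha+n)}\zeta_\alpha^{n}$ has a positive radius of convergence; the function $\zeta_\alpha^{\tau_\alpha-1}\sum_n\frac{a_n}{\Gamma(\tau_\alpha+n)}\zeta_\alpha^{n}$ continues from a neighbourhood of the tip to a holomorphic function $\psi_\alpha$ on $\Omega_\alpha$ with $|\psi_\alpha|\le C|\zeta_\alpha|^{\operatorname{Re}\tau_\alpha-1}e^{\Lambda'|\zeta_\alpha|}$ for some constants $C,\Lambda'$; for every $\theta$ with $|\theta-\theta_0|<\omega$ and every $z$ with $\operatorname{Re}(e^{i\theta}z)>\Lambda'$, the integral below converges absolutely and $$\Psi_\alpha(z)=\int_{\alpha+e^{i\theta}(0,\infty)}e^{-z\zeta}\,\psi_\alpha(\zeta)\,d\zeta .$$ The function $\psi_\alpha$ solves the integral equation $$P(-\zeta)\psi_\alpha+\partial_{\zeta,\alpha}^{-1}\big[Q(-\zeta)\psi_\alpha\big]+\sum_{j\ge0}R_j\,\partial_{\zeta,\alpha}^{-(j+2)}\psi_\alpha=0$$ on $\Omega_\alpha$, where $\partial_{\zeta,\alpha}^{-(k+1)}\varphi(\zeta)=\frac1{k!}\int_\alpha^\zeta(\zeta-\zeta')^k\varphi(\zeta')\,d\zeta'$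 along the straight segment from $\alpha$ to $\zeta$. -/

import Mathlib

noncomputable section

namespace LevelOneODE

open Complex

/-! ### Sectors, dual domains, branches of powers -/

/-- The open sector with tip `α`, bisecting direction `θ₀` and opening angle `2 * ω`. -/
def sector (α : ℂ) (θ₀ ω : ℝ) : Set ℂ :=
  {ζ | ∃ r θ : ℝ, 0 < r ∧ |θ - θ₀| < ω ∧ ζ = α + r * exp (θ * I)}

/-- The union of the half-planes `Re (e^{iθ} z) > Λ` over all directions `θ` in the opening of
`sector α θ₀ ω`. -/
def dualDomain (θ₀ ω Λ : ℝ) : Set ℂ :=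
  {z | ∃ θ : ℝ, |θ - θ₀| < ω ∧ Λ < (exp (θ * I) * z).re}

/-- The branch of `w ^ s` on `{w ≠ 0, |arg w - θ| < π}`, with `arg w` near the extended
angle `θ : ℝ`; that is, `(r e^{iφ}) ^ s = exp (s (log r + i φ))` for `|φ - θ| < π`. -/
def branchPow (θ : ℝ) (s w : ℂ) : ℂ :=
  exp (s * (log (exp (-(θ * I)) * w) + θ * I))

/-- Membership in the space of holomorphic functions `E` on `U` that are bounded by a constant
multiple of `Δ ^ σ`, where `Δ` is the distance to the boundary of `U`. -/
def HasDecay (σ : ℝ) (U : Set ℂ) (E : ℂ → ℂ) : Prop :=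
  DifferentiableOn ℂ E U ∧ ∃ C : ℝ, ∀ z ∈ U, ‖E z‖ ≤ C * (Metric.infDist z (frontier U)) ^ σ

/-- Membership in the space of holomorphic functions `φ` on a set `Ω` with tip `α` that are
bounded by a constant multiple of `|ζ - α| ^ σ * e ^ (Λ |ζ - α|)`. -/
def HasExpType (α : ℂ) (σ Λ : ℝ) (Ω : Set ℂ) (φ : ℂ → ℂ) : Prop :=
  DifferentiableOn ℂ φ Ω ∧
    ∃ C : ℝ, ∀ ζ ∈ Ω, ‖φ ζ‖ ≤ C * ‖ζ - α‖ ^ σ * Real.exp (Λ * ‖ζ - α‖)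

/-! ### The differential operator, on functions -/

/-- `P (d/dz)` applied to `Φ`, at the point `z`. -/
def polyDiff (P : Polynomial ℂ) (Φ : ℂ → ℂ) (z : ℂ) : ℂ :=
  P.sum fun k c => c * iteratedDeriv k Φ z

/-- `[P (d/dz) + z⁻¹ Q (d/dz) + z⁻² R (z⁻¹)] Φ`, at the point `z`. -/
def levelOneOp (P Q : Polynomial ℂ) (R : ℂ → ℂ) (Φ : ℂ → ℂ) (z : ℂ) : ℂ :=
  polyDiff P Φ z + z⁻¹ * polyDiff Q Φ z + (z⁻¹) ^ 2 * R z⁻¹ * Φ z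

/-- `τ_α = Q (-α) / P' (-α)`. -/
def tauOf (P Q : Polynomial ℂ) (α : ℂ) : ℂ :=
  Q.eval (-α) / (Polynomial.derivative P).eval (-α)

/-- `Ψ` represents, on the dual domain of level `Λ`, a solution of the differential equation in
the affine subspace `e^{-α z} [z^{-τ} + {functions that are O(Δ ^ (-Re τ - 1))}]`. -/
structure IsSpecialSolution (P Q : Polynomial ℂ) (R : ℂ → ℂ) (α : ℂ) (θ₀ ω Λ : ℝ)
    (Ψ : ℂ → ℂ) : Prop where
  holo : DifferentiableOn ℂ Ψ (dualDomain θ₀ ω Λ)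
  solves : ∀ z ∈ dualDomain θ₀ ω Λ, levelOneOp P Q R Ψ z = 0
  mem_affine : ∃ E : ℂ → ℂ, HasDecay (-(tauOf P Q α).re - 1) (dualDomain θ₀ ω Λ) E ∧
    ∀ z ∈ dualDomain θ₀ ω Λ,
      Ψ z = exp (-α * z) * (branchPow (-θ₀) (-(tauOf P Q α)) z + E z)

/-! ### The differential operator, on formal trans-monomials

An element `e^{-α z} z^{-τ} (a₀ + a₁ z⁻¹ + a₂ z⁻² + ⋯)` of `e^{-α z} z^{-τ} ℂ⟦z⁻¹⟧` is given by
the power series `a₀ + a₁ X + a₂ X² + ⋯`, where `X` stands for `z⁻¹`. -/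

/-- The derivation `d/dz` on `e^{-α z} z^{-τ} ℂ⟦z⁻¹⟧`: the series `F` goes to
`-α F - τ X F - X² dF/dX`, because `d/dz = -X² d/dX` on `ℂ⟦z⁻¹⟧`. -/
def formalDeriv (α τ : ℂ) : Module.End ℂ (PowerSeries ℂ) :=
  -(α • LinearMap.id) - τ • LinearMap.mulLeft ℂ PowerSeries.X
    - (LinearMap.mulLeft ℂ (PowerSeries.X ^ 2)) ∘ₗ (PowerSeries.derivative ℂ).toLinearMap

/-- The Taylor coefficient of `w ^ j` in `R` at `w = 0`. -/
def taylorCoeff (R : ℂ → ℂ) (j : ℕ) : ℂ := iteratedDeriv j R 0 / (j.factorial : ℂ)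

/-- `[P (d/dz) + z⁻¹ Q (d/dz) + z⁻² R (z⁻¹)]` on `e^{-α z} z^{-τ} ℂ⟦z⁻¹⟧`. -/
def formalOp (P Q : Polynomial ℂ) (R : ℂ → ℂ) (α τ : ℂ) (F : PowerSeries ℂ) : PowerSeries ℂ :=
  Polynomial.aeval (formalDeriv α τ) P F
    + PowerSeries.X * Polynomial.aeval (formalDeriv α τ) Q F
    + PowerSeries.X ^ 2 * PowerSeries.mk (taylorCoeff R) * F

/-! ### Borel summation -/

/-- Coefficients of the Borel transform: `e^{-α z} z^{-τ} ∑ aₙ z^{-n}` is sent to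
`(ζ - α)^{τ - 1} ∑ (aₙ / Γ(τ + n)) (ζ - α)^n`. -/
def borelCoeff (τ : ℂ) (F : PowerSeries ℂ) (n : ℕ) : ℂ :=
  PowerSeries.coeff n F / Gamma (τ + n)

/-- The integrand of the Laplace integral `∫ e^{-z ζ} φ dζ` along the ray `ζ = α + t e^{iθ}`,
`t ∈ (0, ∞)`. -/
def laplaceIntegrand (α : ℂ) (θ : ℝ) (φ : ℂ → ℂ) (z : ℂ) (t : ℝ) : ℂ :=
  exp (-z * (α + t * exp (θ * I))) * φ (α + t * exp (θ * I)) * exp (θ * I)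

/-- The Laplace transform of `φ` along the ray from `α` in the direction `θ`. -/
def laplace (α : ℂ) (θ : ℝ) (φ : ℂ → ℂ) (z : ℂ) : ℂ :=
  ∫ t in Set.Ioi (0 : ℝ), laplaceIntegrand α θ φ z t

/-- `Ψ` is the Borel sum, at the base point `α` and along every ray in `sector α θ₀ ω`, of the
trans-monomial `e^{-α z} z^{-τ} F(z⁻¹)`, with position-domain function `ψ` of exponential
type `Λ`. -/
structure IsBorelSum (α τ : ℂ) (θ₀ ω Λ : ℝ) (F : PowerSeries ℂ) (ψ Ψ : ℂ → ℂ) : Prop where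
  /-- The power series in the Borel transform converges near `α`, and `ψ` is the sum there. -/
  sum_eq : ∃ ρ : ℝ, 0 < ρ ∧
    (∀ w : ℂ, ‖w‖ < ρ → Summable fun n : ℕ => borelCoeff τ F n * w ^ n) ∧
    ∀ ζ ∈ sector α θ₀ ω, ‖ζ - α‖ < ρ →
      ψ ζ = branchPow θ₀ (τ - 1) (ζ - α) * ∑' n : ℕ, borelCoeff τ F n * (ζ - α) ^ n
  /-- `ψ` is its analytic continuation to the whole sector, of exponential type there. -/
  expType : HasExpType α (τ.re - 1) Λ (sector α θ₀ ω) ψ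
  /-- The Laplace integral of `ψ` along each ray converges to `Ψ` on the half-plane
  `Re (e^{iθ} z) > Λ`. -/
  laplace_eq : ∀ θ : ℝ, |θ - θ₀| < ω → ∀ z : ℂ, Λ < (exp (θ * I) * z).re →
    MeasureTheory.IntegrableOn (laplaceIntegrand α θ ψ z) (Set.Ioi (0 : ℝ)) ∧
      Ψ z = laplace α θ ψ z

/-! ### The integral equation in the position domain -/

/-- The `(k + 1)`-fold repeated integral from `α` along straight segments:
`(1 / k!) ∫_α^ζ (ζ - ζ')^k φ(ζ') dζ'`, with `ζ' = α + s (ζ - α)`. -/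
def repeatedIntegral (α : ℂ) (k : ℕ) (φ : ℂ → ℂ) (ζ : ℂ) : ℂ :=
  (1 / (k.factorial : ℂ)) * ∫ s in (0 : ℝ)..1,
    (ζ - (α + s * (ζ - α))) ^ k * φ (α + s * (ζ - α)) * (ζ - α)

/-- `φ` solves `[P(-ζ) + ∂⁻¹ ∘ Q(-ζ) + ∂⁻² ∘ R(∂⁻¹)] φ = 0` on `Ω`, where `∂⁻¹` is integration
from `α` and `R(∂⁻¹)` is the power series of `R` in `∂⁻¹`. -/
def SolvesVolterra (P Q : Polynomial ℂ) (R : ℂ → ℂ) (α : ℂ) (Ω : Set ℂ) (φ : ℂ → ℂ) : Prop :=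
  ∀ ζ ∈ Ω, HasSum (fun j : ℕ => taylorCoeff R j * repeatedIntegral α (j + 1) φ ζ)
    (-(P.eval (-ζ) * φ ζ + repeatedIntegral α 0 (fun x => Q.eval (-x) * φ x) ζ))

end LevelOneODE

end

/-!
The special solution is built on the Borel side and compared with any other solution there.

*Borel side.* With `w = ζ - α` and `ψ = w ^ (τ - 1) g`, the integral equation is a Volterra equation
whose leading coefficient `P (-α - w)` has a simple zero at `w = 0`. The substitution
`g = w G' + τ G` makes `s ^ (τ - 1) g (s w)` the derivative of `s ^ τ G (s w)`. After an integration
by parts, the choice `τ = Q(-α) / P'(-α)` is exactly what lets a factor `w` be divided out, and what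
remains is a regular equation `G' = a G + ∫₀¹ κ(s, w) G(s w) ds` with bounded coefficients on the
union of the sector and a disc around the tip. That set is star-shaped, so a Neumann series in an
exponentially weighted norm solves the equation there (`exists_volterraOp_solution`,
`exists_tip_solution`, `exists_tip_function`). The result is a `g` that is holomorphic at the tip,
of exponential type on the sector, and of any prescribed value at the tip; the value `1 / Γ(τ)`
gives the leading term `z ^ (-τ)`.

*Existence.* The Laplace integrals of `ψ` along the rays of the sector glue to one function on the
dual domain (`laplace_eq_of_mem_halfPlane`). By the convolution theorem it solves the differential
equation (`levelOneOp_laplace`). The leading term of `ψ` has Laplace transform `e^{-αz} z ^ (-τ)`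
(`laplace_tipPow_const`), and the remainder is estimated along the direction whose half-plane is
almost as deep around `z` as the dual domain itself (`exists_infDist_le`). This is
`exists_isSpecialSolution`.

*Uniqueness.* The difference of two special solutions is `e^{-αz} E` with `E` of size
`|z| ^ (-Re τ - 1)` far out in the direction `θ₀`. The inverse Laplace transform of `E` along
vertical lines solves the homogeneous Volterra equation on the half-line and vanishes at `0` to an
order that the regular singular point excludes for non-zero solutions (`volterra_eq_zero`), so
`E = 0` by Fourier inversion (`exists_eq_zero_of_halfPlaneDecay`). Analytic continuation spreads
this over the dual domain (`IsSpecialSolution.eqOn`). In particular every special solution is the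
Borel sum constructed above.

*The formal solution.* Its coefficients are `Γ(τ + n)` times the Taylor coefficients of `g` at the
tip. The formal Borel transform intertwines the differential operator with the integral equation,
the products with `1/z` and `z⁻² R(1/z)` becoming convolutions through Beta integrals. All Borel
coefficients of the formal equation therefore vanish (`formalOp_eq_zero`).
-/

noncomputable section

namespace LevelOneODE

open Complex MeasureTheory Filter Topology Set

/-! ### Holomorphic dependence of integrals on a parameter -/

/-- An integral of holomorphic functions that are dominated, locally uniformly in the variable, by
an integrable function is holomorphic and may be differentiated under the integral sign: the
derivative of the integrand is dominated by Cauchy's estimate. -/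
theorem hasDerivAt_integral_of_holomorphic {X : Type*} [MeasurableSpace X] {μ : Measure X}
    {F : ℂ → X → ℂ} {w₀ : ℂ} {r : ℝ} (hr : 0 < r) {bound : X → ℝ} (hb : Integrable bound μ)
    (hmeas : ∀ w ∈ Metric.ball w₀ r, AEStronglyMeasurable (F w) μ)
    (hdiff : ∀ᵐ x ∂μ, DifferentiableOn ℂ (fun w => F w x) (Metric.ball w₀ r))
    (hbound : ∀ᵐ x ∂μ, ∀ w ∈ Metric.ball w₀ r, ‖F w x‖ ≤ bound x) :
    Integrable (fun x => deriv (fun w => F w x) w₀) μ ∧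
      HasDerivAt (fun w => ∫ x, F w x ∂μ) (∫ x, deriv (fun w => F w x) w₀ ∂μ) w₀ := by
  have hr2 : 0 < r / 2 := by positivity
  have hsub : ∀ w ∈ Metric.ball w₀ (r / 2), Metric.closedBall w (r / 4) ⊆ Metric.ball w₀ r := by
    intro w hw
    apply Metric.closedBall_subset_ball'
    have := Metric.mem_ball.1 hw
    linarith
  have hw0 : w₀ ∈ Metric.ball w₀ r := Metric.mem_ball_self hr
  refine hasDerivAt_integral_of_dominated_loc_of_deriv_le (μ := μ)
    (bound := fun x => bound x / (r / 4)) (s := Metric.ball w₀ (r / 2)) (F := F)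
    (F' := fun w x => deriv (fun w => F w x) w) (x₀ := w₀) (Metric.ball_mem_nhds _ hr2) ?_ ?_ ?_ ?_
    (hb.div_const _) ?_
  · filter_upwards [Metric.ball_mem_nhds w₀ hr] with w hw using hmeas w hw
  · exact hb.mono' (hmeas w₀ hw0) (hbound.mono fun x hx => hx w₀ hw0)
  · -- the derivative is a limit of difference quotients, hence measurable
    have hlim : Tendsto (fun n : ℕ => w₀ + ((r / (n + 2) : ℝ) : ℂ)) atTop (𝓝[≠] w₀) := by
      refine tendsto_nhdsWithin_iff.2 ⟨?_, Eventually.of_forall fun n => ?_⟩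
      · have h1 : Tendsto (fun n : ℕ => r / ((n : ℝ) + 2)) atTop (𝓝 0) :=
          Tendsto.div_atTop tendsto_const_nhds
            (tendsto_atTop_add_const_right _ _ tendsto_natCast_atTop_atTop)
        have h2 := (continuous_ofReal.tendsto 0).comp h1
        simpa using (tendsto_const_nhds (x := w₀)).add h2
      · have : (r / ((n : ℝ) + 2)) ≠ 0 := by positivity
        have h3 : ((r / ((n : ℝ) + 2) : ℝ) : ℂ) ≠ 0 := ofReal_ne_zero.2 this
        simpa only [mem_compl_iff, mem_singleton_iff, add_eq_left] using h3
    refine aestronglyMeasurable_of_tendsto_ae atTop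
      (f := fun (n : ℕ) x => slope (fun w => F w x) w₀ (w₀ + ((r / (n + 2) : ℝ) : ℂ))) ?_ ?_
    · intro n
      simp only [slope, vsub_eq_sub]
      refine AEStronglyMeasurable.fun_const_smul ((hmeas _ ?_).fun_sub (hmeas _ hw0)) _
      rw [Metric.mem_ball, dist_eq_norm, add_sub_cancel_left, norm_real, Real.norm_eq_abs,
        abs_of_pos (by positivity), div_lt_iff₀ (by positivity)]
      nlinarith [(Nat.cast_nonneg n : (0 : ℝ) ≤ n)]
    · filter_upwards [hdiff] with x hx
      have := (hx.differentiableAt (Metric.ball_mem_nhds _ hr)).hasDerivAt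
      exact (hasDerivAt_iff_tendsto_slope.1 this).comp hlim
  · filter_upwards [hdiff, hbound] with x hx hbx w hw
    refine norm_deriv_le_of_forall_mem_sphere_norm_le (by positivity) ?_ ?_
    · exact (hx.mono (hsub w hw)).diffContOnCl_ball subset_rfl
    · intro z hz
      exact hbx z (hsub w hw (Metric.sphere_subset_closedBall hz))
  · filter_upwards [hdiff] with x hx w hw
    have hw' : w ∈ Metric.ball w₀ r := Metric.ball_subset_ball (by linarith) hw
    exact (hx.differentiableAt (Metric.isOpen_ball.mem_nhds hw')).hasDerivAt

theorem differentiableOn_integral_of_holomorphic {X : Type*} [MeasurableSpace X] {μ : Measure X}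
    {F : ℂ → X → ℂ} {U : Set ℂ}
    (h : ∀ w₀ ∈ U, ∃ r > 0, ∃ bound : X → ℝ, Integrable bound μ ∧
      (∀ w ∈ Metric.ball w₀ r, AEStronglyMeasurable (F w) μ) ∧
      (∀ᵐ x ∂μ, DifferentiableOn ℂ (fun w => F w x) (Metric.ball w₀ r)) ∧
      ∀ᵐ x ∂μ, ∀ w ∈ Metric.ball w₀ r, ‖F w x‖ ≤ bound x) :
    DifferentiableOn ℂ (fun w => ∫ x, F w x ∂μ) U := by
  intro w₀ hw₀
  obtain ⟨r, hr, bound, hb, h1, h2, h3⟩ := h w₀ hw₀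
  exact (hasDerivAt_integral_of_holomorphic hr hb h1 h2 h3).2.differentiableAt.differentiableWithinAt

/-! ### Polynomials in `d/dz` -/

theorem polyDiff_eq_sum (P : Polynomial ℂ) (Φ : ℂ → ℂ) (z : ℂ) :
    polyDiff P Φ z = ∑ k ∈ P.support, P.coeff k * iteratedDeriv k Φ z := rfl

theorem polyDiff_add_left (P Q : Polynomial ℂ) (Φ : ℂ → ℂ) (z : ℂ) :
    polyDiff (P + Q) Φ z = polyDiff P Φ z + polyDiff Q Φ z := by
  unfold polyDiff
  exact Polynomial.sum_add_index P Q _ (by simp) (by intros; ring)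

theorem polyDiff_C_mul (c : ℂ) (P : Polynomial ℂ) (Φ : ℂ → ℂ) (z : ℂ) :
    polyDiff (Polynomial.C c * P) Φ z = c * polyDiff P Φ z := by
  rw [← Polynomial.smul_eq_C_mul]
  unfold polyDiff
  rw [Polynomial.sum_smul_index _ _ _ (by simp)]
  simp only [Polynomial.sum, Finset.mul_sum, mul_assoc]

@[simp] theorem polyDiff_C (c : ℂ) (Φ : ℂ → ℂ) (z : ℂ) :
    polyDiff (Polynomial.C c) Φ z = c * Φ z := by
  simp [polyDiff, Polynomial.sum_C_index]

theorem differentiableOn_iteratedDeriv {U : Set ℂ} (hU : IsOpen U) {Φ : ℂ → ℂ}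
    (hΦ : DifferentiableOn ℂ Φ U) (k : ℕ) : DifferentiableOn ℂ (iteratedDeriv k Φ) U := by
  induction k with
  | zero => simpa using hΦ
  | succ k ih => rw [iteratedDeriv_succ]; exact ih.deriv hU

theorem differentiableOn_polyDiff {U : Set ℂ} (hU : IsOpen U) {Φ : ℂ → ℂ}
    (hΦ : DifferentiableOn ℂ Φ U) (P : Polynomial ℂ) : DifferentiableOn ℂ (polyDiff P Φ) U := by
  have : polyDiff P Φ = fun z => ∑ k ∈ P.support, P.coeff k * iteratedDeriv k Φ z := rfl
  rw [this]
  exact DifferentiableOn.fun_sum fun k _ => (differentiableOn_iteratedDeriv hU hΦ k).const_mul _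

/-- Raising the order by one differentiates `polyDiff P Φ` once more; holomorphy of `Φ` is what
makes the derivative of the sum the sum of the derivatives. -/
theorem polyDiff_X_mul {U : Set ℂ} (hU : IsOpen U) {Φ : ℂ → ℂ}
    (hΦ : DifferentiableOn ℂ Φ U) (P : Polynomial ℂ) {z : ℂ} (hz : z ∈ U) :
    polyDiff (Polynomial.X * P) Φ z = deriv (polyDiff P Φ) z := by
  induction P using Polynomial.induction_on' with
  | add p q hp hq =>
    rw [mul_add, polyDiff_add_left, hp, hq]
    have : polyDiff (p + q) Φ = polyDiff p Φ + polyDiff q Φ := by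
      ext z; exact polyDiff_add_left ..
    rw [this, deriv_add]
    · exact (differentiableOn_polyDiff hU hΦ p).differentiableAt (hU.mem_nhds hz)
    · exact (differentiableOn_polyDiff hU hΦ q).differentiableAt (hU.mem_nhds hz)
  | monomial n a =>
    have h1 : ∀ n, polyDiff (Polynomial.monomial n a) Φ = fun z => a * iteratedDeriv n Φ z := by
      intro n; ext z; unfold polyDiff; exact Polynomial.sum_monomial_index _ _ (by simp)
    rw [Polynomial.X_mul_monomial, h1, h1, iteratedDeriv_succ, deriv_const_mul_field]

/-- To prove a property of `polyDiff P Φ`, it suffices to see how it behaves under differentiation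
and linear combinations. -/
theorem polynomial_induction_X_mul {M : Polynomial ℂ → Prop} (hC : ∀ c, M (Polynomial.C c))
    (hadd : ∀ p q, M p → M q → M (p + q)) (hX : ∀ p, M p → M (Polynomial.X * p))
    (p : Polynomial ℂ) : M p := by
  induction p using Polynomial.induction_on with
  | C a => exact hC a
  | add p q hp hq => exact hadd p q hp hq
  | monomial n a h =>
    have := hX _ h
    rwa [show Polynomial.X * (Polynomial.C a * Polynomial.X ^ n) =
      Polynomial.C a * Polynomial.X ^ (n + 1) by ring] at this

theorem polyDiff_congr {U : Set ℂ} (hU : IsOpen U) {Φ₁ Φ₂ : ℂ → ℂ} (h : EqOn Φ₁ Φ₂ U)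
    (P : Polynomial ℂ) {z : ℂ} (hz : z ∈ U) : polyDiff P Φ₁ z = polyDiff P Φ₂ z := by
  rw [polyDiff_eq_sum, polyDiff_eq_sum]
  refine Finset.sum_congr rfl fun k _ => ?_
  rw [Filter.EventuallyEq.iteratedDeriv_eq k (h.eventuallyEq_of_mem (hU.mem_nhds hz))]

theorem polyDiff_sub {U : Set ℂ} (hU : IsOpen U) {Φ₁ Φ₂ : ℂ → ℂ} (h₁ : DifferentiableOn ℂ Φ₁ U)
    (h₂ : DifferentiableOn ℂ Φ₂ U) (P : Polynomial ℂ) {z : ℂ} (hz : z ∈ U) :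
    polyDiff P (Φ₁ - Φ₂) z = polyDiff P Φ₁ z - polyDiff P Φ₂ z := by
  simp only [polyDiff_eq_sum, ← Finset.sum_sub_distrib, ← mul_sub]
  refine Finset.sum_congr rfl fun k _ => ?_
  rw [iteratedDeriv_sub]
  · exact ((h₁.analyticOnNhd hU) z hz).contDiffAt
  · exact ((h₂.analyticOnNhd hU) z hz).contDiffAt

/-- Conjugating `P (d/dz)` by the factor `e^{-αz}` and a linear change of variable. -/
theorem polyDiff_exp_mul_comp {V : Set ℂ} (hV : IsOpen V) {E : ℂ → ℂ}
    (hE : DifferentiableOn ℂ E V) (α l : ℂ) (P : Polynomial ℂ) :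
    ∀ z, l * z ∈ V → polyDiff P (fun z => exp (-α * z) * E (l * z)) z =
      exp (-α * z) * polyDiff (P.comp (Polynomial.C l * Polynomial.X - Polynomial.C α)) E (l * z) := by
  set U : Set ℂ := (fun z => l * z) ⁻¹' V
  have hU : IsOpen U := hV.preimage (by fun_prop)
  have hΦ : DifferentiableOn ℂ (fun z => exp (-α * z) * E (l * z)) U := by
    refine DifferentiableOn.mul (by fun_prop) ?_
    exact hE.comp (by fun_prop) fun z hz => hz
  induction P using polynomial_induction_X_mul with
  | hC c => intro z hz; simp; ring
  | hadd p q hp hq =>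
    intro z hz
    rw [polyDiff_add_left, hp z hz, hq z hz, Polynomial.add_comp, polyDiff_add_left]; ring
  | hX p hp =>
    intro z hz
    rw [polyDiff_X_mul hU hΦ p hz]
    have hev : polyDiff p (fun z => exp (-α * z) * E (l * z)) =ᶠ[𝓝 z] fun z => exp (-α * z) *
        polyDiff (p.comp (Polynomial.C l * Polynomial.X - Polynomial.C α)) E (l * z) := by
      filter_upwards [hU.mem_nhds hz] with y hy using hp y hy
    rw [hev.deriv_eq, Polynomial.mul_comp, Polynomial.X_comp]
    set p' := p.comp (Polynomial.C l * Polynomial.X - Polynomial.C α)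
    rw [show (Polynomial.C l * Polynomial.X - Polynomial.C α) * p' =
      Polynomial.C l * (Polynomial.X * p') + Polynomial.C (-α) * p' by
        rw [Polynomial.C_neg]; ring, polyDiff_add_left, polyDiff_C_mul, polyDiff_C_mul,
      polyDiff_X_mul hV hE _ hz]
    have hd := ((differentiableOn_polyDiff hV hE p').differentiableAt (hV.mem_nhds hz)).hasDerivAt
    have h1 : HasDerivAt (fun z => l * z) l z := by
      simpa using (hasDerivAt_id z).const_mul l
    have h2 := hd.comp z h1
    have h3 : HasDerivAt (fun z => exp (-α * z)) (exp (-α * z) * (-α)) z := by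
      have := ((hasDerivAt_id z).const_mul (-α)).cexp
      simpa using this
    have h4 := (h3.mul h2).deriv
    have h5 : ((fun z => exp (-α * z)) * (polyDiff p' E ∘ fun z => l * z)) =
      fun z => exp (-α * z) * polyDiff p' E (l * z) := rfl
    rw [h5] at h4
    rw [h4]
    simp only [Function.comp]
    ring

/-! ### A Volterra equation on the half-line -/

theorem norm_le_of_norm_deriv_le_pow {f f' : ℝ → ℂ} {T K : ℝ} {m : ℕ} (h0 : f 0 = 0)
    (hf : ∀ s ∈ Icc 0 T, HasDerivAt f (f' s) s) (hf' : ∀ s ∈ Icc 0 T, ‖f' s‖ ≤ K * s ^ m) :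
    ∀ s ∈ Icc 0 T, ‖f s‖ ≤ K * (s ^ (m + 1) / (m + 1)) := by
  intro s hs
  refine image_norm_le_of_norm_deriv_right_le_deriv_boundary (f := f) (f' := f')
    (B := fun s => K * (s ^ (m + 1) / (m + 1))) (B' := fun s => K * s ^ m)
    (fun x hx => (hf x hx).continuousAt.continuousWithinAt)
    (fun x hx => (hf x (Ico_subset_Icc_self hx)).hasDerivWithinAt) (by simp [h0]) ?_
    (fun x hx => hf' x (Ico_subset_Icc_self hx)) hs
  intro x
  have h1 := ((hasDerivAt_pow (m + 1) x).div_const ((m : ℝ) + 1)).const_mul K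
  refine h1.congr_deriv ?_
  have : (m : ℝ) + 1 ≠ 0 := by positivity
  simp only [Nat.cast_add, Nat.cast_one, Nat.add_sub_cancel]
  field_simp

theorem exists_norm_eval_neg_le (p : Polynomial ℂ) (T : ℝ) :
    ∃ M : ℝ, 0 ≤ M ∧ ∀ t ∈ Icc 0 T, ‖p.eval (-(t : ℂ))‖ ≤ M := by
  have hc : ContinuousOn (fun t : ℝ => p.eval (-(t : ℂ))) (Icc 0 T) :=
    (p.continuous.comp (by fun_prop)).continuousOn
  obtain ⟨M, hM⟩ := isCompact_Icc.exists_bound_of_continuousOn hc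
  exact ⟨max M 0, le_max_right _ _, fun t ht => (hM t ht).trans (le_max_left _ _)⟩

theorem exists_le_norm_eval_neg (p : Polynomial ℂ) (T : ℝ)
    (hp : ∀ t : ℝ, 0 ≤ t → p.eval (-(t : ℂ)) ≠ 0) :
    ∃ M : ℝ, 0 ≤ M ∧ ∀ t ∈ Icc 0 T, ‖(p.eval (-(t : ℂ)))⁻¹‖ ≤ M := by
  have hc : ContinuousOn (fun t : ℝ => (p.eval (-(t : ℂ)))⁻¹) (Icc 0 T) :=
    (p.continuous.comp (by fun_prop)).continuousOn.inv₀ fun t ht => hp t ht.1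
  obtain ⟨M, hM⟩ := isCompact_Icc.exists_bound_of_continuousOn hc
  exact ⟨max M 0, le_max_right _ _, fun t ht => (hM t ht).trans (le_max_left _ _)⟩

/-- One step of the iteration behind `volterra_eq_zero`: if `U` is `O(t ^ (σ + n))` and
`t U' - τ U` gains one power of `t`, then `U` gains the factor `M t / (n + 1)`. -/
theorem norm_le_of_euler_bound {τ : ℂ} (hτ : 0 < τ.re) {U U' : ℝ → ℂ} {T κ M : ℝ} {n : ℕ}
    (hn : 1 ≤ n) (hU : ∀ t ∈ Icc 0 T, HasDerivAt U (U' t) t)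
    (hκ : ∀ t ∈ Icc 0 T, ‖U t‖ ≤ κ * t ^ τ.re * t ^ n)
    (hM : ∀ t ∈ Icc 0 T, ‖t * U' t - τ * U t‖ ≤ M * κ * t ^ τ.re * t ^ (n + 1)) :
    ∀ t ∈ Icc 0 T, ‖U t‖ ≤ M * κ / (n + 1) * t ^ τ.re * t ^ (n + 1) := by
  intro t ht
  rcases ht.1.eq_or_lt with h0 | h0
  · have := hκ t ht
    rw [← h0] at this ⊢
    rw [Real.zero_rpow hτ.ne'] at this ⊢
    simpa using this
  -- the function `V = t ^ (-τ) U` has `|V'| ≤ M κ t ^ n`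
  set V : ℝ → ℂ := fun s => (s : ℂ) ^ (-τ) * U s with hV
  have hVn : ∀ s : ℝ, 0 < s → ‖V s‖ = s ^ (-τ.re) * ‖U s‖ := by
    intro s hs
    rw [hV]; simp only [norm_mul]
    rw [norm_cpow_eq_rpow_re_of_pos hs]; simp
  have hder : ∀ s ∈ Ioc 0 t, HasDerivAt V ((s : ℂ) ^ (-τ - 1) * (s * U' s - τ * U s)) s := by
    intro s hs
    have h1 : HasDerivAt (fun s : ℝ => (s : ℂ) ^ (-τ)) (-τ * (s : ℂ) ^ (-τ - 1)) s := by
      refine hasDerivAt_ofReal_cpow_const (x := s) hs.1.ne' (r := -τ) ?_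
      intro h
      have := congrArg re h
      simp at this
      linarith
    have h2 := h1.mul (hU s ⟨hs.1.le, hs.2.trans ht.2⟩)
    refine h2.congr_deriv ?_
    have : (s : ℂ) ^ (-τ) = (s : ℂ) ^ (-τ - 1) * s := by
      rw [cpow_sub _ _ (ofReal_ne_zero.2 hs.1.ne'), cpow_one]
      field_simp [ofReal_ne_zero.2 hs.1.ne']
    rw [this]; ring
  have hbd : ∀ s ∈ Ioc 0 t, ‖(s : ℂ) ^ (-τ - 1) * (s * U' s - τ * U s)‖ ≤ M * κ * s ^ n := by
    intro s hs
    rw [norm_mul, norm_cpow_eq_rpow_re_of_pos hs.1]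
    have h1 := hM s ⟨hs.1.le, hs.2.trans ht.2⟩
    calc _ ≤ s ^ (-τ - 1).re * (M * κ * s ^ τ.re * s ^ (n + 1)) :=
          mul_le_mul_of_nonneg_left h1 (Real.rpow_nonneg hs.1.le _)
      _ = M * κ * s ^ n * (s ^ (-τ - 1).re * s ^ τ.re * s) := by ring
      _ = M * κ * s ^ n := by
        rw [← Real.rpow_add hs.1]
        have : (-τ - 1).re + τ.re = -1 := by simp; ring
        rw [this, Real.rpow_neg_one, inv_mul_cancel₀ hs.1.ne', mul_one]
  have key : ∀ δ ∈ Ioo 0 t, ‖V t‖ ≤ ‖V δ‖ + M * κ * (t ^ (n + 1) / (n + 1) - δ ^ (n + 1) / (n + 1)) := by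
    intro δ hδ
    have hsub : ∀ x ∈ Icc δ t, x ∈ Ioc 0 t := fun x hx => ⟨hδ.1.trans_le hx.1, hx.2⟩
    refine image_norm_le_of_norm_deriv_right_le_deriv_boundary (f := V)
      (f' := fun s => (s : ℂ) ^ (-τ - 1) * (s * U' s - τ * U s)) (a := δ) (b := t)
      (B := fun s => ‖V δ‖ + M * κ * (s ^ (n + 1) / (n + 1) - δ ^ (n + 1) / (n + 1)))
      (B' := fun s => M * κ * s ^ n)
      (fun x hx => (hder x (hsub x hx)).continuousAt.continuousWithinAt)
      (fun x hx => (hder x (hsub x (Ico_subset_Icc_self hx))).hasDerivWithinAt) (by simp) ?_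
      (fun x hx => hbd x (hsub x (Ico_subset_Icc_self hx))) ⟨hδ.2.le, le_rfl⟩
    intro x
    have h1 := ((((hasDerivAt_pow (n + 1) x).div_const ((n : ℝ) + 1)).sub_const
      (δ ^ (n + 1) / ((n : ℝ) + 1))).const_mul (M * κ)).const_add ‖V δ‖
    refine h1.congr_deriv ?_
    have : (n : ℝ) + 1 ≠ 0 := by positivity
    simp only [Nat.cast_add, Nat.cast_one, Nat.add_sub_cancel]
    field_simp
  have hlim : ‖V t‖ ≤ M * κ * (t ^ (n + 1) / (n + 1)) := by
    have ht1 : Tendsto (fun δ : ℝ => κ * δ ^ n +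
        M * κ * (t ^ (n + 1) / (n + 1) - δ ^ (n + 1) / (n + 1))) (𝓝[>] 0)
        (𝓝 (κ * 0 ^ n + M * κ * (t ^ (n + 1) / (n + 1) - 0 ^ (n + 1) / (n + 1)))) :=
      ((by fun_prop : Continuous fun δ : ℝ => κ * δ ^ n +
        M * κ * (t ^ (n + 1) / (n + 1) - δ ^ (n + 1) / (n + 1))).tendsto 0).mono_left
          nhdsWithin_le_nhds
    have : κ * 0 ^ n + M * κ * (t ^ (n + 1) / (n + 1) - 0 ^ (n + 1) / (n + 1)) =
        M * κ * (t ^ (n + 1) / (n + 1)) := by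
      rw [zero_pow (by omega), zero_pow (by omega)]; ring
    rw [this] at ht1
    refine ge_of_tendsto ht1 ?_
    filter_upwards [Ioo_mem_nhdsGT h0] with δ hδ
    refine (key δ hδ).trans (add_le_add_left ?_ _)
    rw [hVn δ hδ.1]
    calc _ ≤ δ ^ (-τ.re) * (κ * δ ^ τ.re * δ ^ n) := by
          have := hκ δ ⟨hδ.1.le, hδ.2.le.trans ht.2⟩
          have h3 := Real.rpow_nonneg hδ.1.le (-τ.re)
          gcongr
      _ = κ * δ ^ n * (δ ^ (-τ.re) * δ ^ τ.re) := by ring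
      _ = _ := by rw [← Real.rpow_add hδ.1]; simp
  rw [hVn t h0, Real.rpow_neg h0.le] at hlim
  have h3 : 0 < t ^ τ.re := Real.rpow_pos_of_pos h0 _
  rw [inv_mul_le_iff₀ h3] at hlim
  calc _ ≤ _ := hlim
    _ = _ := by ring

/-- Uniqueness for the Volterra equation with a regular singular point at `0`. The equation is
`p (-t) U' + W + Z = 0`, where `W` is the primitive of `q (-t) U'` and `Z` is a smoothing term. -/
theorem volterra_eq_zero {τ : ℂ} (hτ : 0 < τ.re) {p q : Polynomial ℂ}
    (hp0 : p.eval 0 = 0) (hp : ∀ t : ℝ, 0 < t → p.eval (-(t : ℂ)) ≠ 0)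
    (hp1 : p.derivative.eval 0 ≠ 0) (hq : q.eval 0 = τ * p.derivative.eval 0)
    {U U' W Z : ℝ → ℂ} (hU0 : U 0 = 0) (hW0 : W 0 = 0)
    (hU : ∀ t : ℝ, HasDerivAt U (U' t) t) (hW : ∀ t : ℝ, HasDerivAt W (q.eval (-(t : ℂ)) * U' t) t)
    (heq : ∀ t : ℝ, p.eval (-(t : ℂ)) * U' t + W t + Z t = 0) {T C : ℝ}
    (hC : ∀ t ∈ Icc 0 T, ‖U t‖ ≤ C * t ^ τ.re * t)
    (hC0 : 0 ≤ C) (hZ : ∃ MZ : ℝ, 0 ≤ MZ ∧ ∀ (n : ℕ) (κ : ℝ), 0 ≤ κ → (∀ t ∈ Icc 0 T, ‖U t‖ ≤ κ * t ^ τ.re * t ^ n) →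
      ∀ t ∈ Icc 0 T, ‖Z t‖ ≤ MZ * κ * t ^ τ.re * t ^ (n + 1)) :
    ∀ t ∈ Icc 0 T, U t = 0 := by
  obtain ⟨MZ, hMZ0, hMZ⟩ := hZ
  have hpX : p = Polynomial.X * p.divX := by
    conv_lhs => rw [← Polynomial.X_mul_divX_add p]
    simp [Polynomial.coeff_zero_eq_eval_zero, hp0]
  have hd0 : p.divX.eval 0 = p.derivative.eval 0 := by
    conv_rhs => rw [hpX]
    simp
  -- With `p = X p₁` and `q - τ p₁ = X m`, the equation reads
  -- `p₁ (-t) (t U' - τ U) = -t m (-t) U + Y + Z`, with `Y` as below: every term on the right is one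
  -- power of `t` smaller.
  set m := (q - Polynomial.C τ * p.divX).divX with hm
  have hqm : q - Polynomial.C τ * p.divX = Polynomial.X * m := by
    rw [hm]
    conv_lhs => rw [← Polynomial.X_mul_divX_add (q - Polynomial.C τ * p.divX)]
    simp [Polynomial.coeff_zero_eq_eval_zero, hd0, hq]
  have hpe : ∀ t : ℝ, p.eval (-(t : ℂ)) = -t * p.divX.eval (-(t : ℂ)) := by
    intro t
    conv_lhs => rw [hpX]
    simp
  have hqe : ∀ t : ℝ, q.eval (-(t : ℂ)) = τ * p.divX.eval (-(t : ℂ)) - t * m.eval (-(t : ℂ)) := by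
    intro t
    have := congrArg (Polynomial.eval (-(t : ℂ))) hqm
    simp at this
    linear_combination this
  have hdne : ∀ t : ℝ, 0 ≤ t → p.divX.eval (-(t : ℂ)) ≠ 0 := by
    intro t ht
    rcases ht.eq_or_lt with h | h
    · rw [← h]; simpa [hd0] using hp1
    · intro h0
      exact hp t h (by rw [hpe, h0, mul_zero])
  obtain ⟨Mi, hMi0, hMi⟩ := exists_le_norm_eval_neg p.divX T hdne
  obtain ⟨Mm, hMm0, hMm⟩ := exists_norm_eval_neg_le m T
  obtain ⟨Mq, hMq0, hMq⟩ := exists_norm_eval_neg_le q.derivative T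
  -- `Y = W - q (-t) U` has derivative `q' (-t) U`
  set Y : ℝ → ℂ := fun t => W t - q.eval (-(t : ℂ)) * U t with hY
  have hY0 : Y 0 = 0 := by simp [hY, hU0, hW0]
  have hYd : ∀ t : ℝ, HasDerivAt Y (q.derivative.eval (-(t : ℂ)) * U t) t := by
    intro t
    have h1 : HasDerivAt (fun t : ℝ => q.eval (-(t : ℂ))) (q.derivative.eval (-(t : ℂ)) * (-1)) t := by
      have h2 := (q.hasDerivAt (-(t : ℂ))).comp t
        ((hasDerivAt_id (t : ℂ)).comp_ofReal.neg)
      exact h2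
    have h3 := (hW t).sub (h1.mul (hU t))
    refine h3.congr_deriv ?_
    ring
  have hstep : ∀ (n : ℕ) (κ : ℝ), 1 ≤ n → 0 ≤ κ → (∀ t ∈ Icc 0 T, ‖U t‖ ≤ κ * t ^ τ.re * t ^ n) →
      ∀ t ∈ Icc 0 T, ‖U t‖ ≤ (Mi * (Mm + Mq + MZ)) * κ / (n + 1) * t ^ τ.re * t ^ (n + 1) := by
    intro n κ hn hκ0 hκ
    refine norm_le_of_euler_bound hτ hn (fun t _ => hU t) hκ fun t ht => ?_
    have hY1 : ‖Y t‖ ≤ Mq * κ * t ^ τ.re * t ^ (n + 1) := by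
      have := norm_le_of_norm_deriv_le_pow (T := t) (K := Mq * κ * t ^ τ.re) (m := n) hY0
        (fun s _ => hYd s) (fun s hs => ?_) t ⟨ht.1, le_rfl⟩
      · refine this.trans ?_
        have : 0 ≤ Mq * κ * t ^ τ.re * t ^ (n + 1) := by
          have := ht.1
          positivity
        rw [mul_div_assoc']
        exact div_le_self this (by simp)
      · have hsT : s ∈ Icc 0 T := ⟨hs.1, hs.2.trans ht.2⟩
        rw [norm_mul]
        have hs0 := hs.1
        calc _ ≤ Mq * (κ * s ^ τ.re * s ^ n) := by
              gcongr
              · exact hMq s hsT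
              · exact hκ s hsT
          _ ≤ Mq * (κ * t ^ τ.re * s ^ n) := by
              gcongr
              exact hs.2
          _ = _ := by ring
    have hZ1 := hMZ n κ hκ0 hκ t ht
    have hU1 : ‖t * m.eval (-(t : ℂ)) * U t‖ ≤ Mm * κ * t ^ τ.re * t ^ (n + 1) := by
      rw [norm_mul, norm_mul, norm_real, Real.norm_eq_abs, abs_of_nonneg ht.1]
      calc _ ≤ t * Mm * (κ * t ^ τ.re * t ^ n) := by
            have h1 := hMm t ht
            have h2 := hκ t ht
            have h3 := ht.1
            gcongr
        _ = _ := by ring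
    have hne := hdne t ht.1
    have hid : t * U' t - τ * U t =
        (p.divX.eval (-(t : ℂ)))⁻¹ * (-(t * m.eval (-(t : ℂ)) * U t) + Y t + Z t) := by
      rw [eq_inv_mul_iff_mul_eq₀ hne]
      have h1 := heq t
      rw [hpe] at h1
      have h2 : W t = Y t + q.eval (-(t : ℂ)) * U t := by simp [hY]
      rw [h2, hqe] at h1
      linear_combination -h1
    rw [hid, norm_mul]
    calc _ ≤ Mi * (Mm * κ * t ^ τ.re * t ^ (n + 1) + Mq * κ * t ^ τ.re * t ^ (n + 1) +
          MZ * κ * t ^ τ.re * t ^ (n + 1)) := by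
          gcongr
          · exact hMi t ht
          · refine (norm_add₃_le).trans ?_
            rw [norm_neg]
            gcongr
      _ = _ := by ring
  have hM0 : 0 ≤ Mi * (Mm + Mq + MZ) := by positivity
  generalize Mi * (Mm + Mq + MZ) = M at hstep hM0
  have hall : ∀ n : ℕ, ∀ t ∈ Icc 0 T,
      ‖U t‖ ≤ (C * M ^ n / (n + 1).factorial) * t ^ τ.re * t ^ (n + 1) := by
    intro n
    induction n with
    | zero => simpa using hC
    | succ n ih =>
      intro t ht
      have := hstep (n + 1) _ (by omega) (by positivity) ih t ht
      refine this.trans_eq ?_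
      rw [Nat.factorial_succ (n + 1)]
      have : ((n + 1).factorial : ℝ) ≠ 0 := by positivity
      have h2 : (n : ℝ) + 1 + 1 ≠ 0 := by positivity
      push_cast
      field_simp
      ring
  intro t ht
  have hlim : Tendsto (fun n : ℕ => C * t ^ τ.re * t * ((M * t) ^ n / n.factorial)) atTop (𝓝 0) := by
    simpa using (FloorSemiring.tendsto_pow_div_factorial_atTop (M * t)).const_mul (C * t ^ τ.re * t)
  have hle : ‖U t‖ ≤ 0 := by
    have hlim' : Tendsto (fun n : ℕ => |C * t ^ τ.re * t * ((M * t) ^ n / n.factorial)|) atTop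
        (𝓝 0) := by simpa using hlim.abs
    refine ge_of_tendsto' hlim' fun n => (hall n t ht).trans ?_
    calc _ = (C * t ^ τ.re * t * ((M * t) ^ n / n.factorial)) / (n + 1) := by
          rw [Nat.factorial_succ, mul_pow]; push_cast
          have : (n.factorial : ℝ) ≠ 0 := by positivity
          have h2 : (n : ℝ) + 1 ≠ 0 := by positivity
          field_simp
          ring
      _ ≤ |C * t ^ τ.re * t * ((M * t) ^ n / n.factorial)| / (n + 1) := by
          gcongr; exact le_abs_self _
      _ ≤ _ := div_le_self (abs_nonneg _) (by simp)
  simpa using hle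

/-! ### Inverse Laplace transforms -/

/-- Holomorphic functions on the half-plane `Re x > L` that are `O(|x| ^ (-s))`. -/
def HalfPlaneDecay (s L : ℝ) (f : ℂ → ℂ) : Prop :=
  DifferentiableOn ℂ f {x : ℂ | L < x.re} ∧
    ∃ C : ℝ, 0 ≤ C ∧ ∀ x : ℂ, L < x.re → ‖f x‖ ≤ C * ‖x‖ ^ (-s)

/-- The integral of `e^{tx} f(x)` along the vertical line through `c`; up to a factor, the inverse
Laplace transform of `f`. -/
def lineIntegral (c : ℂ) (f : ℂ → ℂ) (t : ℝ) : ℂ :=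
  ∫ y : ℝ, exp (t * (c + y * I)) * f (c + y * I)

theorem isOpen_re_gt (L : ℝ) : IsOpen {x : ℂ | L < x.re} := isOpen_lt continuous_const continuous_re

theorem line_re (c : ℂ) (y : ℝ) : (c + y * I).re = c.re := by simp

theorem norm_line_rpow_le {s L K : ℝ} (hs : 0 < s) (hL : 0 < L) (hK : 0 ≤ K) {c : ℂ} (hc : L < c.re)
    (hcK : ‖c‖ ≤ K) (y : ℝ) :
    ‖c + y * I‖ ^ (-s) ≤ ((1 + K) / L + 1) ^ s * (1 + ‖y‖) ^ (-s) := by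
  have h1 : L ≤ ‖c + y * I‖ := by
    refine le_trans ?_ (re_le_norm _)
    rw [line_re]; exact hc.le
  have h2 : ‖y‖ ≤ ‖c + y * I‖ + K := by
    calc ‖y‖ = ‖(c + y * I) - c‖ := by simp
      _ ≤ ‖c + y * I‖ + ‖c‖ := norm_sub_le _ _
      _ ≤ _ := by gcongr
  have h3 : 1 + ‖y‖ ≤ ((1 + K) / L + 1) * ‖c + y * I‖ := by
    have : 1 + K ≤ (1 + K) / L * ‖c + y * I‖ := by
      rw [div_mul_eq_mul_div, le_div_iff₀ hL]
      gcongr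
    linarith
  have hpos : 0 < 1 + ‖y‖ := by positivity
  have hA : 0 < (1 + K) / L + 1 := by positivity
  have h4 : (1 + ‖y‖) / ((1 + K) / L + 1) ≤ ‖c + y * I‖ := by
    rw [div_le_iff₀ hA]; linarith
  calc _ ≤ ((1 + ‖y‖) / ((1 + K) / L + 1)) ^ (-s) :=
        Real.rpow_le_rpow_of_nonpos (by positivity) h4 (by linarith)
    _ = _ := by
      rw [Real.div_rpow hpos.le hA.le, Real.rpow_neg hA.le, div_inv_eq_mul, mul_comm]

theorem integrable_one_add_norm_rpow {s : ℝ} (hs : 1 < s) :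
    Integrable fun y : ℝ => (1 + ‖y‖) ^ (-s) :=
  integrable_one_add_norm (by simpa using hs)

theorem HalfPlaneDecay.exists_norm_integrand_le {s L : ℝ} (hs : 1 < s) (hL : 0 < L) {f : ℂ → ℂ}
    (hf : HalfPlaneDecay s L f) {K : ℝ} (hK : 0 ≤ K) (B : ℝ) :
    ∃ D : ℝ, ∀ c : ℂ, L < c.re → ‖c‖ ≤ K → ∀ t : ℝ, |t| ≤ B → ∀ y : ℝ,
      ‖exp (t * (c + y * I)) * f (c + y * I)‖ ≤ D * (1 + ‖y‖) ^ (-s) := by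
  obtain ⟨C, hC0, hC⟩ := hf.2
  refine ⟨Real.exp (B * K) * (C * ((1 + K) / L + 1) ^ s), fun c hc hcK t ht y => ?_⟩
  rw [norm_mul, norm_exp]
  have h1 : (↑t * (c + ↑y * I)).re ≤ B * K := by
    have : (↑t * (c + ↑y * I)).re = t * c.re := by simp
    rw [this]
    refine (le_abs_self _).trans ?_
    rw [abs_mul]
    have h1 := (abs_re_le_norm c).trans hcK
    exact mul_le_mul ht h1 (abs_nonneg _) ((abs_nonneg _).trans ht)
  have h2 := hC (c + y * I) (by rw [line_re]; exact hc)
  calc _ ≤ Real.exp (B * K) * (C * (((1 + K) / L + 1) ^ s * (1 + ‖y‖) ^ (-s))) := by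
        gcongr
        refine h2.trans ?_
        gcongr
        exact norm_line_rpow_le (by linarith) hL hK hc hcK y
    _ = _ := by ring

theorem HalfPlaneDecay.continuous_line {s L : ℝ} {f : ℂ → ℂ} (hf : HalfPlaneDecay s L f) {c : ℂ}
    (hc : L < c.re) : Continuous fun y : ℝ => f (c + y * I) :=
  hf.1.continuousOn.comp_continuous (by fun_prop) fun y => by simpa using hc

theorem HalfPlaneDecay.continuous_integrand {s L : ℝ} {f : ℂ → ℂ} (hf : HalfPlaneDecay s L f)
    {c : ℂ} (hc : L < c.re) (t : ℝ) :
    Continuous fun y : ℝ => exp (t * (c + y * I)) * f (c + y * I) :=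
  (by fun_prop : Continuous fun y : ℝ => exp (t * (c + y * I))).mul (hf.continuous_line hc)

theorem HalfPlaneDecay.integrable {s L : ℝ} (hs : 1 < s) (hL : 0 < L) {f : ℂ → ℂ}
    (hf : HalfPlaneDecay s L f) {c : ℂ} (hc : L < c.re) (t : ℝ) :
    Integrable fun y : ℝ => exp (t * (c + y * I)) * f (c + y * I) := by
  obtain ⟨D, hD⟩ := hf.exists_norm_integrand_le hs hL (norm_nonneg c) |t|
  exact ((integrable_one_add_norm_rpow hs).const_mul D).mono'
    (hf.continuous_integrand hc t).aestronglyMeasurable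
    (Eventually.of_forall fun y => hD c hc le_rfl t le_rfl y)

/-- The line integral is a holomorphic function of `c` that is invariant under imaginary
translations, hence constant. -/
theorem HalfPlaneDecay.lineIntegral_eq {s L : ℝ} (hs : 1 < s) (hL : 0 < L) {f : ℂ → ℂ}
    (hf : HalfPlaneDecay s L f) {c c' : ℂ} (hc : L < c.re) (hc' : L < c'.re) (t : ℝ) :
    lineIntegral c f t = lineIntegral c' f t := by
  have hopen := isOpen_re_gt L
  have hdiff : DifferentiableOn ℂ (fun c => lineIntegral c f t) {x : ℂ | L < x.re} := by
    refine differentiableOn_integral_of_holomorphic fun w₀ hw₀ => ?_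
    obtain ⟨r, hr, hball⟩ := Metric.isOpen_iff.1 hopen w₀ hw₀
    obtain ⟨D, hD⟩ := hf.exists_norm_integrand_le hs hL (K := ‖w₀‖ + r) (by positivity) |t|
    refine ⟨r, hr, _, (integrable_one_add_norm_rpow hs).const_mul D, fun w hw =>
      (hf.continuous_integrand (hball hw) t).aestronglyMeasurable,
      Eventually.of_forall fun y => ?_, Eventually.of_forall fun y w hw => ?_⟩
    · refine DifferentiableOn.mul (by fun_prop) (hf.1.comp (by fun_prop) fun w hw => ?_)
      simpa using hball hw
    · refine hD w (hball hw) ?_ t le_rfl y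
      have := mem_ball_iff_norm.1 hw
      calc ‖w‖ = ‖w₀ + (w - w₀)‖ := by ring_nf
        _ ≤ ‖w₀‖ + ‖w - w₀‖ := norm_add_le _ _
        _ ≤ _ := by gcongr
  have hinv : ∀ (c : ℂ) (u : ℝ), lineIntegral (c + u * I) f t = lineIntegral c f t := by
    intro c u
    unfold lineIntegral
    rw [← integral_add_right_eq_self (fun y : ℝ => exp (t * (c + y * I)) * f (c + y * I)) u]
    refine integral_congr_ae (Eventually.of_forall fun y => ?_)
    simp only [ofReal_add]
    rw [show c + u * I + y * I = c + (y + u) * I by ring]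
  have hderiv : ∀ w ∈ {x : ℂ | L < x.re}, deriv (fun c => lineIntegral c f t) w = 0 := by
    intro w hw
    have h1 := (hdiff.differentiableAt (hopen.mem_nhds hw)).hasDerivAt
    have h2 : HasDerivAt (fun u : ℝ => w + u * I) I 0 := by
      have := (((hasDerivAt_id (0 : ℂ)).mul_const I).const_add w).comp_ofReal (z := 0)
      simpa using this
    have h3 := HasDerivAt.comp (0 : ℝ) (h₂ := fun c => lineIntegral c f t)
      (h := fun u : ℝ => w + u * I) (by simpa only [ofReal_zero, zero_mul, add_zero] using h1) h2
    have h4 : ((fun c => lineIntegral c f t) ∘ fun u : ℝ => w + u * I) =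
        fun _ => lineIntegral w f t := by
      ext u; exact hinv w u
    rw [h4] at h3
    have h5 := h3.unique (hasDerivAt_const _ _)
    simpa [I_ne_zero] using h5
  exact hopen.is_const_of_deriv_eq_zero (convex_halfSpace_re_gt L).isPreconnected hdiff
    hderiv hc hc'

theorem HalfPlaneDecay.hasDerivAt_lineIntegral {s L : ℝ} (hs : 1 < s) (hL : 0 < L) {f g : ℂ → ℂ}
    (hf : HalfPlaneDecay s L f) (hg : HalfPlaneDecay s L g)
    (hfg : ∀ x : ℂ, L < x.re → g x = x * f x) {c : ℂ} (hc : L < c.re) (t : ℝ) :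
    HasDerivAt (lineIntegral c f) (lineIntegral c g t) t := by
  obtain ⟨D, hD⟩ := hg.exists_norm_integrand_le hs hL (norm_nonneg c) (|t| + 1)
  refine (hasDerivAt_integral_of_dominated_loc_of_deriv_le (s := Metric.ball t 1)
    (F := fun (t : ℝ) (y : ℝ) => exp (t * (c + y * I)) * f (c + y * I))
    (F' := fun (t : ℝ) (y : ℝ) => exp (t * (c + y * I)) * g (c + y * I))
    (Metric.ball_mem_nhds t one_pos)
    (Eventually.of_forall fun t => (hf.continuous_integrand hc t).aestronglyMeasurable)
    (hf.integrable hs hL hc t) (hg.continuous_integrand hc t).aestronglyMeasurable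
    (Eventually.of_forall fun y t' ht' =>
      hD c hc le_rfl t' ?_ y)
    ((integrable_one_add_norm_rpow hs).const_mul D)
    (Eventually.of_forall fun y t' _ => ?_)).2
  · have := Metric.mem_ball.1 ht'
    rw [Real.dist_eq] at this
    have h2 := abs_sub_abs_le_abs_sub t' t
    linarith
  · rw [hfg _ (by rw [line_re]; exact hc)]
    have h1 : HasDerivAt (fun t : ℝ => (t : ℂ) * (c + y * I)) (c + y * I) t' := by
      have := ((hasDerivAt_id (t' : ℂ)).mul_const (c + y * I)).comp_ofReal
      simpa using this
    refine (h1.cexp.mul_const _).congr_deriv ?_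
    ring

theorem HalfPlaneDecay.mono {s L L' : ℝ} (h : L ≤ L') {f : ℂ → ℂ} (hf : HalfPlaneDecay s L f) :
    HalfPlaneDecay s L' f :=
  ⟨hf.1.mono fun _ hx => lt_of_le_of_lt h hx, hf.2.imp fun _ hC =>
    ⟨hC.1, fun x hx => hC.2 x (lt_of_le_of_lt h hx)⟩⟩

theorem HalfPlaneDecay.bounded_mul {s L M : ℝ} {f h : ℂ → ℂ} (hf : HalfPlaneDecay s L f)
    (hh : DifferentiableOn ℂ h {x : ℂ | L < x.re}) (hM : ∀ x : ℂ, L < x.re → ‖h x‖ ≤ M) :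
    HalfPlaneDecay s L fun x => h x * f x := by
  obtain ⟨C, hC0, hC⟩ := hf.2
  refine ⟨hh.mul hf.1, |M| * C, by positivity, fun x hx => ?_⟩
  rw [norm_mul, mul_assoc]
  have h1 := (hM x hx).trans (le_abs_self M)
  have h2 := hC x hx
  gcongr

theorem HalfPlaneDecay.add {s L : ℝ} {f g : ℂ → ℂ} (hf : HalfPlaneDecay s L f)
    (hg : HalfPlaneDecay s L g) : HalfPlaneDecay s L fun x => f x + g x := by
  obtain ⟨C, hC0, hC⟩ := hf.2
  obtain ⟨D, hD0, hD⟩ := hg.2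
  refine ⟨hf.1.add hg.1, C + D, by positivity, fun x hx => ?_⟩
  rw [add_mul]
  exact (norm_add_le _ _).trans (add_le_add (hC x hx) (hD x hx))

theorem HalfPlaneDecay.inv_mul {s L : ℝ} (hL : 0 < L) {f : ℂ → ℂ} (hf : HalfPlaneDecay s L f) :
    HalfPlaneDecay s L fun x => x⁻¹ * f x := by
  refine hf.bounded_mul (M := L⁻¹) ?_ fun x hx => ?_
  · refine DifferentiableOn.inv differentiableOn_id fun x hx h => ?_
    have : L < x.re := hx
    change x = 0 at h
    rw [h] at this
    simp at this
    linarith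
  · rw [norm_inv]
    exact inv_anti₀ hL (hx.le.trans (re_le_norm x))

/-- By Cauchy's estimate on unit circles, which is why the half-plane shrinks by one. -/
theorem HalfPlaneDecay.deriv {s L : ℝ} (hs : 0 < s) (hL : 0 < L) {f : ℂ → ℂ}
    (hf : HalfPlaneDecay s L f) : HalfPlaneDecay s (L + 1) (deriv f) := by
  obtain ⟨C, hC0, hC⟩ := hf.2
  refine ⟨(hf.1.deriv (isOpen_re_gt L)).mono fun x hx => ?_, C * (L / (L + 1)) ^ (-s),
    by positivity, fun x hx => ?_⟩
  · have : L + 1 < x.re := hx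
    show L < x.re
    linarith
  · have hsub : Metric.closedBall x 1 ⊆ {x : ℂ | L < x.re} := by
      intro z hz
      have h1 := mem_closedBall_iff_norm.1 hz
      have h2 := (abs_le.1 (abs_re_le_norm (z - x))).1
      rw [sub_re] at h2
      show L < z.re
      linarith
    have := norm_deriv_le_of_forall_mem_sphere_norm_le one_pos
      (C := C * (L / (L + 1)) ^ (-s) * ‖x‖ ^ (-s))
      ((hf.1.mono hsub).diffContOnCl_ball subset_rfl) fun z hz => ?_
    · simpa using this
    · have hz' := Metric.sphere_subset_closedBall hz
      refine (hC z (hsub hz')).trans ?_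
      rw [mul_assoc, ← Real.mul_rpow (by positivity) (norm_nonneg _)]
      gcongr 1
      have hxn := re_le_norm x
      refine Real.rpow_le_rpow_of_nonpos ?_ ?_ (by linarith)
      · have : 0 < ‖x‖ := by linarith
        positivity
      · have h1 : ‖x‖ ≤ ‖z‖ + 1 := by
          have h1 := mem_closedBall_iff_norm.1 hz'
          calc ‖x‖ = ‖z - (z - x)‖ := by ring_nf
            _ ≤ ‖z‖ + ‖z - x‖ := norm_sub_le _ _
            _ ≤ _ := by gcongr
        rw [div_mul_eq_mul_div, div_le_iff₀ (by linarith)]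
        nlinarith

/-- Integration by parts along the line. -/
theorem lineIntegral_deriv {s L : ℝ} (hs : 1 < s) (hL : 0 < L) {f : ℂ → ℂ}
    (hf : HalfPlaneDecay s L f) {c : ℂ} (hc : L + 1 < c.re) (t : ℝ) :
    lineIntegral c (deriv f) t = -t * lineIntegral c f t := by
  have hc' : L < c.re := by linarith
  have h1 := (hf.deriv (by linarith) hL).integrable hs (by linarith) hc t
  have h2 := hf.integrable hs hL hc' t
  have hd : ∀ y : ℝ, HasDerivAt (fun y : ℝ => exp (t * (c + y * I)) * f (c + y * I))
      (I * (t * (exp (t * (c + y * I)) * f (c + y * I)) +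
        exp (t * (c + y * I)) * deriv f (c + y * I))) y := by
    intro y
    have h3 : HasDerivAt (fun y : ℝ => c + y * I) I y := by
      have := (((hasDerivAt_id (y : ℂ)).mul_const I).const_add c).comp_ofReal
      simpa using this
    have h4 := (h3.const_mul (t : ℂ)).cexp
    have h5 := ((hf.1.differentiableAt ((isOpen_re_gt L).mem_nhds
      (by simpa using hc' : (c + y * I) ∈ {x : ℂ | L < x.re}))).hasDerivAt).comp y h3
    refine (h4.mul h5).congr_deriv ?_
    simp only [Function.comp]
    ring
  have h0 := integral_eq_zero_of_hasDerivAt_of_integrable hd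
    (((h2.const_mul _).add h1).const_mul _) h2
  rw [integral_const_mul, integral_add (h2.const_mul _) h1, integral_const_mul] at h0
  have h6 := (mul_eq_zero.1 h0).resolve_left I_ne_zero
  unfold lineIntegral
  linear_combination h6

/-- The inverse Laplace transform turns `d/dx` into multiplication by `-t`. The half-plane shrinks
with each derivative, so its level depends on `p`. -/
theorem exists_lineIntegral_polyDiff {s L : ℝ} (hs : 1 < s) (hL : 0 < L) {f : ℂ → ℂ}
    (hf : HalfPlaneDecay s L f) (p : Polynomial ℂ) :
    ∃ L' : ℝ, L ≤ L' ∧ HalfPlaneDecay s L' (polyDiff p f) ∧ ∀ c : ℂ, L' < c.re → ∀ t : ℝ,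
      lineIntegral c (polyDiff p f) t = p.eval (-(t : ℂ)) * lineIntegral c f t := by
  induction p using polynomial_induction_X_mul with
  | hC a =>
    have h1 : polyDiff (Polynomial.C a) f = fun x => a * f x := by ext x; simp
    refine ⟨L, le_rfl, ?_, fun c hc t => ?_⟩
    · rw [h1]
      exact hf.bounded_mul (h := fun _ => a) (M := ‖a‖) (by fun_prop) fun _ _ => le_rfl
    · rw [h1]
      unfold lineIntegral
      rw [Polynomial.eval_C, ← integral_const_mul]
      congr 1; ext y; ring
  | hadd p q hp hq =>
    obtain ⟨L₁, hL₁, hd₁, he₁⟩ := hp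
    obtain ⟨L₂, hL₂, hd₂, he₂⟩ := hq
    have h1 : polyDiff (p + q) f = fun x => polyDiff p f x + polyDiff q f x := by
      ext x; exact polyDiff_add_left ..
    have hd₁' := hd₁.mono (le_max_left L₁ L₂)
    have hd₂' := hd₂.mono (le_max_right L₁ L₂)
    refine ⟨max L₁ L₂, hL₁.trans (le_max_left _ _), ?_, fun c hc t => ?_⟩
    · rw [h1]
      exact hd₁'.add hd₂'
    · have hL0 : 0 < max L₁ L₂ := (hL.trans_le hL₁).trans_le (le_max_left _ _)
      rw [h1, Polynomial.eval_add, add_mul, ← he₁ c ((le_max_left _ _).trans_lt hc),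
        ← he₂ c ((le_max_right _ _).trans_lt hc)]
      unfold lineIntegral
      rw [← integral_add (hd₁'.integrable hs hL0 hc t) (hd₂'.integrable hs hL0 hc t)]
      congr 1; ext y; ring
  | hX p hp =>
    obtain ⟨L₁, hL₁, hd₁, he₁⟩ := hp
    have hL0 : 0 < L₁ := hL.trans_le hL₁
    have h1 : EqOn (polyDiff (Polynomial.X * p) f) (deriv (polyDiff p f)) {x : ℂ | L₁ + 1 < x.re} := by
      intro x hx
      have : L₁ + 1 < x.re := hx
      exact polyDiff_X_mul (isOpen_re_gt L) hf.1 p (show L < x.re by linarith)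
    have hd := hd₁.deriv (by linarith) hL0
    refine ⟨L₁ + 1, by linarith, ⟨hd.1.congr h1, ?_⟩, fun c hc t => ?_⟩
    · obtain ⟨C, hC0, hC⟩ := hd.2
      exact ⟨C, hC0, fun x hx => by rw [h1 hx]; exact hC x hx⟩
    · have : lineIntegral c (polyDiff (Polynomial.X * p) f) t = lineIntegral c (deriv (polyDiff p f)) t := by
        unfold lineIntegral
        congr 1; ext y
        rw [h1 (by simpa using hc)]
      rw [this, lineIntegral_deriv hs hL0 hd₁ hc, he₁ c (by linarith)]
      simp; ring

/-- A bound that is uniform in the line: rescaling the line by its abscissa `c` produces the factor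
`c ^ (1 - s)`. -/
theorem HalfPlaneDecay.exists_norm_lineIntegral_le {s L : ℝ} (hs : 1 < s) (hL : 0 < L) {f : ℂ → ℂ}
    (hf : HalfPlaneDecay s L f) : ∃ C : ℝ, 0 ≤ C ∧ ∀ c : ℝ, L < c → ∀ t : ℝ,
      ‖lineIntegral c f t‖ ≤ C * Real.exp (t * c) * c ^ (1 - s) := by
  obtain ⟨C, hC0, hC⟩ := hf.2
  refine ⟨C * 2 ^ s * ∫ y : ℝ, (1 + ‖y‖) ^ (-s), by positivity, fun c hc t => ?_⟩
  have hc0 : 0 < c := hL.trans hc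
  have hbd : ∀ y : ℝ, ‖exp (t * (c + y * I)) * f (c + y * I)‖ ≤
      C * 2 ^ s * Real.exp (t * c) * c ^ (-s) * (1 + ‖y * c⁻¹‖) ^ (-s) := by
    intro y
    rw [norm_mul, norm_exp]
    have h1 : (↑t * ((c : ℂ) + ↑y * I)).re = t * c := by simp
    rw [h1]
    have h2 : ‖f (c + y * I)‖ ≤ C * (2 ^ s * (c ^ (-s) * (1 + ‖y * c⁻¹‖) ^ (-s))) := by
      refine (hC _ (by simpa using hc)).trans ?_
      gcongr
      have h3 : c * (1 + ‖y * c⁻¹‖) / 2 ≤ ‖(c : ℂ) + y * I‖ := by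
        have h4 := re_le_norm ((c : ℂ) + y * I)
        have h5 := abs_im_le_norm ((c : ℂ) + y * I)
        simp at h4 h5
        rw [norm_mul, norm_inv, Real.norm_eq_abs, Real.norm_eq_abs, abs_of_pos hc0]
        have : c * (1 + |y| * c⁻¹) = c + |y| := by field_simp
        rw [this]; linarith
      calc _ ≤ (c * (1 + ‖y * c⁻¹‖) / 2) ^ (-s) :=
            Real.rpow_le_rpow_of_nonpos (by positivity) h3 (by linarith)
        _ = _ := by
          rw [Real.div_rpow (by positivity) (by positivity), Real.mul_rpow hc0.le (by positivity),
            Real.rpow_neg (by norm_num : (0 : ℝ) ≤ 2), div_inv_eq_mul, mul_comm]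
    calc _ ≤ Real.exp (t * c) * (C * (2 ^ s * (c ^ (-s) * (1 + ‖y * c⁻¹‖) ^ (-s)))) := by gcongr
      _ = _ := by ring
  have hint : Integrable fun y : ℝ => (1 + ‖y * c⁻¹‖) ^ (-s) :=
    (integrable_one_add_norm_rpow hs).comp_mul_right' (inv_ne_zero hc0.ne')
  refine (norm_integral_le_of_norm_le (hint.const_mul _) (Eventually.of_forall hbd)).trans ?_
  rw [integral_const_mul, Measure.integral_comp_mul_right (fun y : ℝ => (1 + ‖y‖) ^ (-s)),
    inv_inv, abs_of_pos hc0, smul_eq_mul, show (1 : ℝ) - s = -s + 1 by ring,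
    Real.rpow_add hc0, Real.rpow_one]
  apply le_of_eq; ring

/-- For `t ≤ 0` the line may be moved to infinity on the right, where the integral tends to zero. -/
theorem HalfPlaneDecay.lineIntegral_eq_zero_of_nonpos {s L : ℝ} (hs : 1 < s) (hL : 0 < L) {f : ℂ → ℂ}
    (hf : HalfPlaneDecay s L f) {c : ℂ} (hc : L < c.re) {t : ℝ} (ht : t ≤ 0) :
    lineIntegral c f t = 0 := by
  obtain ⟨C, hC0, hC⟩ := hf.exists_norm_lineIntegral_le hs hL
  have hlim : Tendsto (fun x : ℝ => C * x ^ (-(s - 1))) atTop (𝓝 0) := by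
    simpa using (tendsto_rpow_neg_atTop (by linarith : 0 < s - 1)).const_mul C
  have : ‖lineIntegral c f t‖ ≤ 0 := by
    refine ge_of_tendsto hlim ?_
    filter_upwards [eventually_gt_atTop L] with x hx
    rw [hf.lineIntegral_eq hs hL hc (by simpa using hx : L < (x : ℂ).re) t]
    refine (hC x hx t).trans ?_
    rw [neg_sub]
    have : 0 < x := hL.trans hx
    have h1 : Real.exp (t * x) ≤ 1 := Real.exp_le_one_iff.2 (by nlinarith)
    calc _ ≤ C * 1 * x ^ (1 - s) := by gcongr
      _ = _ := by ring
  simpa using this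

/-- Decay at infinity becomes vanishing at `t = 0`: for small `t` the integral is taken along the
line through `L + 1/t`, where `e^{tx}` stays bounded. -/
theorem HalfPlaneDecay.exists_norm_lineIntegral_le_rpow {s L : ℝ} (hs : 1 < s) (hL : 0 < L)
    {f : ℂ → ℂ} (hf : HalfPlaneDecay s L f) {c : ℂ} (hc : L < c.re) (T : ℝ) :
    ∃ C : ℝ, 0 ≤ C ∧ ∀ t ∈ Ioc 0 T, ‖lineIntegral c f t‖ ≤ C * t ^ (s - 1) := by
  obtain ⟨C, hC0, hC⟩ := hf.exists_norm_lineIntegral_le hs hL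
  refine ⟨C * Real.exp (T * L + 1), by positivity, fun t ht => ?_⟩
  have htp := ht.1
  have hx : L < L + t⁻¹ := by have := inv_pos.2 htp; linarith
  rw [hf.lineIntegral_eq hs hL hc (by simpa using hx : L < ((L + t⁻¹ : ℝ) : ℂ).re) t]
  refine (hC _ hx t).trans ?_
  have h1 : t * (L + t⁻¹) ≤ T * L + 1 := by
    rw [mul_add, mul_inv_cancel₀ htp.ne']
    have := ht.2
    gcongr
  have h2 : (L + t⁻¹) ^ (1 - s) ≤ t ^ (s - 1) := by
    calc _ ≤ (t⁻¹) ^ (1 - s) :=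
          Real.rpow_le_rpow_of_nonpos (by positivity) (by linarith) (by linarith)
      _ = _ := by rw [Real.inv_rpow htp.le, ← Real.rpow_neg htp.le]; ring_nf
  gcongr

/-- Injectivity of the inverse Laplace transform, from Fourier inversion. -/
theorem HalfPlaneDecay.eq_zero_of_lineIntegral_eq_zero {s L : ℝ} (hs : 1 < s) (hL : 0 < L)
    {f : ℂ → ℂ} (hf : HalfPlaneDecay s L f) {x : ℂ} (hx : L < x.re)
    (h : ∀ t : ℝ, lineIntegral x f t = 0) : f x = 0 := by
  have h1 : Integrable fun y : ℝ => f (x + y * I) := by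
    simpa using hf.integrable hs hL hx 0
  have h2 : FourierTransform.fourier (fun y : ℝ => f (x + y * I)) = 0 := by
    ext ξ
    rw [Real.fourier_real_eq_integral_exp_smul]
    have h3 : ∀ y : ℝ, exp (↑(-2 * Real.pi * y * ξ) * I) • f (x + y * I) =
        exp (-((-2 * Real.pi * ξ : ℝ) * x)) *
          (exp ((-2 * Real.pi * ξ : ℝ) * (x + y * I)) * f (x + y * I)) := by
      intro y
      rw [smul_eq_mul, ← mul_assoc, ← Complex.exp_add]
      congr 2
      push_cast; ring
    simp_rw [h3]
    rw [integral_const_mul]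
    have := h (-2 * Real.pi * ξ)
    unfold lineIntegral at this
    rw [this]; simp
  have h4 := h1.fourierInv_fourier_eq (v := 0) (by rw [h2]; exact integrable_zero _ _ _)
    (hf.continuous_line hx).continuousAt
  rw [h2] at h4
  have h5 : FourierTransformInv.fourierInv (0 : ℝ → ℂ) 0 = 0 := by
    simp [Real.fourierInv_eq]
  rw [h5] at h4
  simpa using h4.symm

/-! ### Uniqueness on a half-plane -/

theorem inv_mem_ball_of_lt_re {L : ℝ} (hL : 0 < L) {x : ℂ} (hx : L < x.re) :
    x⁻¹ ∈ Metric.ball (0 : ℂ) L⁻¹ := by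
  rw [mem_ball_zero_iff, norm_inv]
  exact inv_strictAnti₀ hL (hx.trans_le (re_le_norm x))

theorem HalfPlaneDecay.inv_pow_mul {s L : ℝ} (hL : 0 < L) {f : ℂ → ℂ} (hf : HalfPlaneDecay s L f)
    (m : ℕ) : HalfPlaneDecay s L fun x => x⁻¹ ^ m * f x := by
  induction m with
  | zero => simpa using hf
  | succ m ih =>
    have := ih.inv_mul hL
    simpa only [pow_succ', mul_assoc] using this

theorem HalfPlaneDecay.comp_inv_mul {s L : ℝ} (hL : 0 < L) {f : ℂ → ℂ} (hf : HalfPlaneDecay s L f)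
    {R : ℂ → ℂ} {r : ℕ → ℂ} (hR : DifferentiableOn ℂ R (Metric.ball 0 L⁻¹))
    (hsum : ∀ w ∈ Metric.ball (0 : ℂ) L⁻¹, HasSum (fun j => r j * w ^ j) (R w))
    (hr : Summable fun j => ‖r j‖ * L⁻¹ ^ j) : HalfPlaneDecay s L fun x => R x⁻¹ * f x := by
  refine hf.bounded_mul (h := fun x => R x⁻¹) (M := ∑' j, ‖r j‖ * L⁻¹ ^ j) ?_ fun x hx => ?_
  · refine hR.comp ?_ fun x hx => inv_mem_ball_of_lt_re hL hx
    refine DifferentiableOn.inv differentiableOn_id fun x hx h => ?_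
    have h1 : L < x.re := hx
    change x = 0 at h
    rw [h] at h1
    simp at h1
    linarith
  · have h1 := inv_mem_ball_of_lt_re hL hx
    rw [← (hsum _ h1).tsum_eq]
    refine tsum_of_norm_bounded hr.hasSum fun j => ?_
    rw [norm_mul, norm_pow]
    have := (mem_ball_zero_iff.1 h1).le
    gcongr

/-- A convergent power series in `1/x` may be integrated term by term along the line. -/
theorem HalfPlaneDecay.hasSum_lineIntegral {s L : ℝ} (hs : 1 < s) (hL : 0 < L) {f : ℂ → ℂ}
    (hf : HalfPlaneDecay s L f) {R : ℂ → ℂ} {r : ℕ → ℂ}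
    (hsum : ∀ w ∈ Metric.ball (0 : ℂ) L⁻¹, HasSum (fun j => r j * w ^ j) (R w))
    (hr : Summable fun j => ‖r j‖ * L⁻¹ ^ j) {c : ℂ} (hc : L < c.re) (t : ℝ) :
    HasSum (fun j => r j * lineIntegral c (fun x => x⁻¹ ^ j * f x) t)
      (lineIntegral c (fun x => R x⁻¹ * f x) t) := by
  have hI := hf.integrable hs hL hc t
  set G : ℝ → ℂ := fun y => exp (t * (c + y * I)) * f (c + y * I) with hG
  have hint : ∀ j, Integrable fun y : ℝ => r j * (exp (t * (c + y * I)) *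
      ((c + y * I)⁻¹ ^ j * f (c + y * I))) := fun j =>
    ((hf.inv_pow_mul hL j).integrable hs hL hc t).const_mul _
  have hball : ∀ y : ℝ, (c + y * I)⁻¹ ∈ Metric.ball (0 : ℂ) L⁻¹ := fun y =>
    inv_mem_ball_of_lt_re hL (by rw [line_re]; exact hc)
  have hn : ∀ j, ∫ y : ℝ, ‖r j * (exp (t * (c + y * I)) * ((c + y * I)⁻¹ ^ j * f (c + y * I)))‖ ≤
      ‖r j‖ * L⁻¹ ^ j * ∫ y, ‖G y‖ := by
    intro j
    rw [← integral_const_mul]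
    refine integral_mono (hint j).norm (hI.norm.const_mul _) fun y => ?_
    have h2 := (mem_ball_zero_iff.1 (hball y)).le
    simp only [hG, norm_mul, norm_pow]
    calc _ = ‖r j‖ * ‖(c + y * I)⁻¹‖ ^ j * (‖exp (t * (c + y * I))‖ * ‖f (c + y * I)‖) := by ring
      _ ≤ _ := by gcongr
  have h1 := hasSum_integral_of_summable_integral_norm hint
    (Summable.of_nonneg_of_le (fun j => integral_nonneg fun y => norm_nonneg _) hn (hr.mul_right _))
  have hA : (fun j => r j * lineIntegral c (fun x => x⁻¹ ^ j * f x) t) = fun j => ∫ y : ℝ, r j *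
      (exp (t * (c + y * I)) * ((c + y * I)⁻¹ ^ j * f (c + y * I))) := by
    ext j
    unfold lineIntegral
    rw [integral_const_mul]
  have hB : lineIntegral c (fun x => R x⁻¹ * f x) t = ∫ y : ℝ, ∑' j, r j *
      (exp (t * (c + y * I)) * ((c + y * I)⁻¹ ^ j * f (c + y * I))) := by
    unfold lineIntegral
    refine integral_congr_ae (Eventually.of_forall fun y => ?_)
    have h3 := (hsum _ (hball y)).mul_right (exp (t * (c + y * I)) * f (c + y * I))
    have h4 : ∀ j, r j * (c + y * I)⁻¹ ^ j * (exp (t * (c + y * I)) * f (c + y * I)) =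
      r j * (exp (t * (c + y * I)) * ((c + y * I)⁻¹ ^ j * f (c + y * I))) := fun j => by ring
    simp_rw [h4] at h3
    show _ = ∑' j, _
    rw [h3.tsum_eq]
    ring
  rw [hA, hB]
  exact h1

/-- A solution of the equation on a half-plane that decays like `|x| ^ (-Re τ - 1)` vanishes: its
inverse Laplace transform solves a Volterra equation whose only solution of that size is zero. -/
theorem exists_eq_zero_of_halfPlaneDecay {τ : ℂ} (hτ : 0 < τ.re) {p q : Polynomial ℂ}
    (hp0 : p.eval 0 = 0) (hp : ∀ t : ℝ, 0 < t → p.eval (-(t : ℂ)) ≠ 0)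
    (hp1 : p.derivative.eval 0 ≠ 0) (hq : q.eval 0 = τ * p.derivative.eval 0)
    {L : ℝ} (hL : 0 < L) {R : ℂ → ℂ} {r : ℕ → ℂ} (hR : DifferentiableOn ℂ R (Metric.ball 0 L⁻¹))
    (hsum : ∀ w ∈ Metric.ball (0 : ℂ) L⁻¹, HasSum (fun j => r j * w ^ j) (R w))
    (hr : Summable fun j => ‖r j‖ * L⁻¹ ^ j) {E : ℂ → ℂ} (hE : HalfPlaneDecay (τ.re + 1) L E)
    (hode : ∀ x : ℂ, L < x.re →
      polyDiff p E x + x⁻¹ * polyDiff q E x + x⁻¹ ^ 2 * R x⁻¹ * E x = 0) :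
    ∃ L' : ℝ, ∀ x : ℂ, L' < x.re → E x = 0 := by
  have hs : 1 < τ.re + 1 := by linarith
  obtain ⟨L₁, hL₁, hd₁, he₁⟩ := exists_lineIntegral_polyDiff hs hL hE p
  obtain ⟨L₂, hL₂, hd₂, he₂⟩ := exists_lineIntegral_polyDiff hs hL hE q
  set L' := max L₁ L₂ with hL'
  have hLL : L ≤ L' := hL₁.trans (le_max_left _ _)
  have hL0 : 0 < L' := hL.trans_le hLL
  refine ⟨L', fun c hc => ?_⟩
  have hcL : L < c.re := hLL.trans_lt hc
  have hc1 : L₁ < c.re := (le_max_left _ _).trans_lt hc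
  have hc2 : L₂ < c.re := (le_max_right _ _).trans_lt hc
  have hne : ∀ x : ℂ, L < x.re → x ≠ 0 := by
    intro x hx h
    rw [h] at hx
    simp at hx
    linarith
  have hd₁' := hd₁.mono (le_max_left L₁ L₂)
  have hd₂' := hd₂.mono (le_max_right L₁ L₂)
  -- `e m` is the inverse Laplace transform of `x ^ (-m) E`
  set e : ℕ → ℝ → ℂ := fun m => lineIntegral c (fun x => x⁻¹ ^ m * E x) with he
  have hed : ∀ m t, HasDerivAt (e (m + 1)) (e m t) t := fun m t =>
    (hE.inv_pow_mul hL (m + 1)).hasDerivAt_lineIntegral hs hL (hE.inv_pow_mul hL m)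
      (fun x hx => by rw [pow_succ']; field_simp [hne x hx]) hcL t
  have he0 : ∀ m t, t ≤ 0 → e m t = 0 := fun m t ht =>
    (hE.inv_pow_mul hL m).lineIntegral_eq_zero_of_nonpos hs hL hcL ht
  set W : ℝ → ℂ := lineIntegral c (fun x => x⁻¹ * polyDiff q E x) with hW
  set Z : ℝ → ℂ := lineIntegral c (fun x => R x⁻¹ * (x⁻¹ ^ 2 * E x)) with hZ
  have hZs : ∀ t, HasSum (fun j => r j * e (j + 2) t) (Z t) := by
    intro t
    have := (hE.inv_pow_mul hL 2).hasSum_lineIntegral hs hL hsum hr hcL t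
    convert this using 3 with j
    simp only [he, pow_add, mul_assoc]
  have hWd : ∀ t : ℝ, HasDerivAt W (q.eval (-(t : ℂ)) * e 0 t) t := by
    intro t
    have h1 := (hd₂'.inv_mul hL0).hasDerivAt_lineIntegral hs hL0 hd₂'
      (fun x hx => by field_simp [hne x (hLL.trans_lt hx)]) hc t
    refine h1.congr_deriv ?_
    rw [he₂ c hc2]
    simp [he]
  have heq : ∀ t : ℝ, p.eval (-(t : ℂ)) * e 0 t + W t + Z t = 0 := by
    intro t
    have h1 : p.eval (-(t : ℂ)) * e 0 t = lineIntegral c (polyDiff p E) t := by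
      rw [he₁ c hc1]; simp [he]
    have hi1 := hd₁'.integrable hs hL0 hc t
    have hi2 := (hd₂'.inv_mul hL0).integrable hs hL0 hc t
    have hi3 := ((hE.inv_pow_mul hL 2).comp_inv_mul hL hR hsum hr).integrable hs hL hcL t
    rw [h1, hW, hZ]
    unfold lineIntegral
    rw [← integral_add hi1 hi2]
    refine (integral_add (hi1.add hi2) hi3).symm.trans ?_
    refine integral_eq_zero_of_ae (Eventually.of_forall fun y => ?_)
    have h2 := hode (c + y * I) (by rw [line_re]; exact hcL)
    simp only [Pi.zero_apply, Pi.add_apply]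
    linear_combination exp (t * (c + y * I)) * h2
  -- the functions `e (j + 1)` inherit bounds from `e 1`
  have hebd : ∀ {T : ℝ} (n : ℕ) (κ : ℝ), 0 ≤ κ →
      (∀ t ∈ Icc 0 T, ‖e 1 t‖ ≤ κ * t ^ τ.re * t ^ n) → ∀ t ∈ Icc 0 T, ∀ j : ℕ, ∀ s ∈ Icc 0 t,
        ‖e (j + 1) s‖ ≤ κ * t ^ τ.re / j.factorial * s ^ (n + j) := by
    intro T n κ hκ0 hκ t ht j
    have ht0 := ht.1
    induction j with
    | zero =>
      intro s hs
      have hs0 := hs.1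
      refine (hκ s ⟨hs.1, hs.2.trans ht.2⟩).trans ?_
      simp only [Nat.factorial_zero, Nat.cast_one, div_one, add_zero]
      gcongr
      exact hs.2
    | succ j ih =>
      intro s hs
      have hs0 := hs.1
      refine (norm_le_of_norm_deriv_le_pow (he0 _ 0 le_rfl) (fun s _ => hed (j + 1) s) ih s hs).trans ?_
      rw [Nat.factorial_succ]
      push_cast
      calc κ * t ^ τ.re / j.factorial * (s ^ (n + j + 1) / (n + j + 1))
          ≤ κ * t ^ τ.re / j.factorial * (s ^ (n + j + 1) / (j + 1)) := by
            gcongr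
            linarith [(Nat.cast_nonneg n : (0 : ℝ) ≤ n)]
        _ = _ := by
          have : (j.factorial : ℝ) ≠ 0 := by positivity
          have h2 : (j : ℝ) + 1 ≠ 0 := by positivity
          field_simp
          rfl
  obtain ⟨S, hS0, hS⟩ : ∃ S : ℝ, 0 ≤ S ∧ ∀ j, ‖r j‖ ≤ S * L ^ j := by
    refine ⟨∑' j, ‖r j‖ * L⁻¹ ^ j, tsum_nonneg fun j => by positivity, fun j => ?_⟩
    have := hr.le_tsum j fun i _ => by positivity
    rw [inv_pow, ← div_eq_mul_inv, div_le_iff₀ (by positivity)] at this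
    exact this
  have hU : ∀ t, e 1 t = 0 := by
    intro T
    rcases le_or_gt T 0 with hT | hT
    · exact he0 1 T hT
    obtain ⟨C, hC0, hC⟩ := hE.exists_norm_lineIntegral_le_rpow hs hL hcL T
    have hE0 : ∀ t ∈ Icc 0 T, ‖e 0 t‖ ≤ C * t ^ τ.re := by
      intro t ht
      rcases ht.1.eq_or_lt with h | h
      · rw [he0 0 t h.symm.le, ← h, Real.zero_rpow hτ.ne']; simp
      · have := hC t ⟨h, ht.2⟩
        simpa [he] using this
    refine volterra_eq_zero (U := e 1) (U' := e 0) (W := W) (Z := Z) (C := C) hτ hp0 hp hp1 hq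
      (he0 1 0 le_rfl) ((hd₂'.inv_mul hL0).lineIntegral_eq_zero_of_nonpos hs hL0 hc le_rfl)
      (hed 0) hWd heq ?_ hC0 ⟨S * Real.exp (L * T), by positivity, fun n κ hκ0 hκ t ht => ?_⟩ T
      ⟨hT.le, le_rfl⟩
    · intro t ht
      have ht0 := ht.1
      have := norm_le_of_norm_deriv_le_pow (T := t) (m := 0) (K := C * t ^ τ.re)
        (he0 1 0 le_rfl) (fun s _ => hed 0 s) (fun s hs => ?_) t ⟨ht.1, le_rfl⟩
      · simpa using this
      · have hs0 := hs.1
        refine (hE0 s ⟨hs.1, hs.2.trans ht.2⟩).trans ?_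
        rw [pow_zero, mul_one]
        gcongr
        exact hs.2
    · have ht0 := ht.1
      have hexp : HasSum (fun j : ℕ => S * ((L * T) ^ j / j.factorial) * (κ * t ^ τ.re * t ^ (n + 1)))
          (S * Real.exp (L * T) * (κ * t ^ τ.re * t ^ (n + 1))) := by
        rw [Real.exp_eq_exp_ℝ]
        exact ((NormedSpace.expSeries_div_hasSum_exp (L * T)).mul_left S).mul_right _
      rw [← (hZs t).tsum_eq]
      refine (tsum_of_norm_bounded hexp fun j => ?_).trans_eq (by ring)
      rw [norm_mul]
      have h1 := hebd n κ hκ0 hκ t ht (j + 1) t ⟨ht.1, le_rfl⟩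
      calc _ ≤ S * L ^ j * (κ * t ^ τ.re / j.factorial * t ^ (n + (j + 1))) := by
            gcongr
            · exact hS j
            · refine h1.trans ?_
              gcongr
              omega
        _ = S * ((L * t) ^ j / j.factorial) * (κ * t ^ τ.re * t ^ (n + 1)) := by
            rw [mul_pow]; ring
        _ ≤ _ := by
            gcongr
            exact ht.2
  have := (hE.inv_pow_mul hL 1).eq_zero_of_lineIntegral_eq_zero hs hL hcL hU
  simpa [hne c hcL] using this

/-! ### Sectors, half-planes and the dual domain -/

/-- The half-plane `Re (e^{iθ} z) > Λ`. -/
def halfPlane (θ Λ : ℝ) : Set ℂ := {z | Λ < (exp (θ * I) * z).re}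

theorem isOpen_halfPlane (θ Λ : ℝ) : IsOpen (halfPlane θ Λ) :=
  isOpen_lt continuous_const (by fun_prop)

theorem convex_halfPlane (θ Λ : ℝ) : Convex ℝ (halfPlane θ Λ) :=
  convex_halfSpace_gt (f := fun z : ℂ => (exp (θ * I) * z).re)
    ⟨fun x y => by simp [mul_add], fun c x => by simp; ring⟩ Λ

theorem mem_dualDomain {θ₀ ω Λ : ℝ} {z : ℂ} :
    z ∈ dualDomain θ₀ ω Λ ↔ ∃ θ : ℝ, |θ - θ₀| < ω ∧ z ∈ halfPlane θ Λ := Iff.rfl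

theorem isOpen_dualDomain (θ₀ ω Λ : ℝ) : IsOpen (dualDomain θ₀ ω Λ) := by
  have : dualDomain θ₀ ω Λ = ⋃ θ : ℝ, ⋃ _ : |θ - θ₀| < ω, halfPlane θ Λ := by
    ext z; simp [mem_dualDomain]
  rw [this]
  exact isOpen_iUnion fun θ => isOpen_iUnion fun _ => isOpen_halfPlane θ Λ

theorem dualDomain_anti {θ₀ ω Λ Λ' : ℝ} (h : Λ ≤ Λ') : dualDomain θ₀ ω Λ' ⊆ dualDomain θ₀ ω Λ :=
  fun _ ⟨θ, hθ, hz⟩ => ⟨θ, hθ, h.trans_lt hz⟩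

theorem norm_exp_angle (θ : ℝ) : ‖exp (θ * I)‖ = 1 := norm_exp_ofReal_mul_I θ

theorem norm_gt_of_mem_dualDomain {θ₀ ω Λ : ℝ} {z : ℂ} (hz : z ∈ dualDomain θ₀ ω Λ) : Λ < ‖z‖ := by
  obtain ⟨θ, _, h⟩ := hz
  refine h.trans_le ((re_le_norm _).trans_eq ?_)
  rw [norm_mul, norm_exp_angle, one_mul]

theorem frontier_dualDomain_nonempty {θ₀ ω Λ : ℝ} (hω : 0 < ω) (hΛ : 0 < Λ) :
    (frontier (dualDomain θ₀ ω Λ)).Nonempty := by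
  rw [nonempty_frontier_iff]
  refine ⟨⟨exp (-(θ₀ * I)) * (Λ + 1 : ℝ), θ₀, by simpa using hω, ?_⟩, fun h => ?_⟩
  · rw [← mul_assoc, ← Complex.exp_add, add_neg_cancel, Complex.exp_zero, one_mul, ofReal_re]
    linarith
  · have : (0 : ℂ) ∈ dualDomain θ₀ ω Λ := by rw [h]; trivial
    have := norm_gt_of_mem_dualDomain this
    simp at this
    linarith

theorem re_exp_mul_rotate (θ₀ η : ℝ) (z : ℂ) :
    (exp ((θ₀ + η : ℝ) * I) * z).re =
      Real.cos η * (exp (θ₀ * I) * z).re - Real.sin η * (exp (θ₀ * I) * z).im := by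
  have : exp ((θ₀ + η : ℝ) * I) * z = exp (η * I) * (exp (θ₀ * I) * z) := by
    rw [← mul_assoc, ← Complex.exp_add]; push_cast; ring_nf
  rw [this, mul_re, exp_ofReal_mul_I_re, exp_ofReal_mul_I_im]

/-- Far out in the half-plane `Re (e^{iθ₀} z) > 0`, the distance to the boundary of the dual domain
is comparable to `|z|`, because the dual domain contains the half-planes of the directions
`θ₀ ± η`. -/
theorem exists_mul_norm_le_infDist {θ₀ ω Λ : ℝ} (hω : 0 < ω) (hω' : ω ≤ Real.pi / 2) (hΛ : 0 < Λ) :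
    ∃ κ > 0, ∃ L > 0, ∀ z : ℂ, L < (exp (θ₀ * I) * z).re →
      κ * ‖z‖ ≤ Metric.infDist z (frontier (dualDomain θ₀ ω Λ)) := by
  have hpi := Real.pi_pos
  set η := ω / 2 with hη
  have hη0 : 0 < η := by positivity
  have hs : 0 < Real.sin η := Real.sin_pos_of_pos_of_lt_pi hη0 (by linarith)
  have hc : 0 < Real.cos η := Real.cos_pos_of_mem_Ioo ⟨by linarith, by linarith⟩
  set μ := min (Real.sin η) (Real.cos η) with hμ
  have hμ0 : 0 < μ := lt_min hs hc
  refine ⟨μ / 2, by positivity, 2 * Λ / μ, by positivity, fun z hz => ?_⟩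
  rw [Metric.le_infDist (frontier_dualDomain_nonempty hω hΛ)]
  intro y hy
  by_contra hlt
  push Not at hlt
  rw [(isOpen_dualDomain θ₀ ω Λ).frontier_eq] at hy
  refine hy.2 ?_
  set x := exp (θ₀ * I) * z with hx
  have hxn : ‖x‖ = ‖z‖ := by rw [hx, norm_mul, norm_exp_angle, one_mul]
  have hx0 : 0 < x.re := lt_trans (by positivity) hz
  have hxl : 2 * Λ / μ < ‖z‖ := by rw [← hxn]; exact hz.trans_le (re_le_norm x)
  -- choose the sign of the rotation so that it increases the real part
  obtain ⟨δ, hδ, hre⟩ : ∃ δ : ℝ, |δ| < ω ∧ μ * ‖z‖ ≤ (exp ((θ₀ + δ : ℝ) * I) * z).re := by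
    have hnorm := norm_le_abs_re_add_abs_im x
    rw [abs_of_pos hx0, hxn] at hnorm
    have h1 : μ * x.re ≤ Real.cos η * x.re := by gcongr; exact min_le_right _ _
    have h2 : μ * |x.im| ≤ Real.sin η * |x.im| := by gcongr; exact min_le_left _ _
    have h3 : μ * ‖z‖ ≤ μ * (x.re + |x.im|) := by gcongr
    rcases le_total 0 x.im with him | him
    · refine ⟨-η, by rw [abs_neg, abs_of_pos hη0]; linarith, ?_⟩
      rw [re_exp_mul_rotate, Real.cos_neg, Real.sin_neg]
      rw [abs_of_nonneg him] at *
      linarith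
    · refine ⟨η, by rw [abs_of_pos hη0]; linarith, ?_⟩
      rw [re_exp_mul_rotate]
      rw [abs_of_nonpos him] at *
      linarith
  refine ⟨θ₀ + δ, by simpa using hδ, ?_⟩
  have h4 : (exp ((θ₀ + δ : ℝ) * I) * z).re - (exp ((θ₀ + δ : ℝ) * I) * y).re ≤ dist z y := by
    rw [← sub_re, ← mul_sub, dist_eq_norm]
    refine (re_le_norm _).trans_eq ?_
    rw [norm_mul, norm_exp_angle, one_mul]
  rw [div_lt_iff₀ hμ0] at hxl
  linarith

theorem mem_sector {α : ℂ} {θ₀ ω r θ : ℝ} (hr : 0 < r) (hθ : |θ - θ₀| < ω) :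
    α + r * exp (θ * I) ∈ sector α θ₀ ω := ⟨r, θ, hr, hθ, rfl⟩

/-! ### The data of the equation -/

theorem derivative_eval_ne_zero_of_simple {P : Polynomial ℂ} (hP : P.Monic)
    (hPsimple : ∀ r : ℂ, P.IsRoot r → P.rootMultiplicity r = 1) {r : ℂ} (hr : P.IsRoot r) :
    P.derivative.eval r ≠ 0 := by
  intro h
  have h1 := (Polynomial.one_lt_rootMultiplicity_iff_isRoot hP.ne_zero).2 ⟨hr, h⟩
  rw [hPsimple r hr] at h1
  exact lt_irrefl _ h1

theorem hasSum_taylorCoeff {R : ℂ → ℂ} {ρ : ℝ} (hR : DifferentiableOn ℂ R (Metric.ball 0 ρ)) {w : ℂ}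
    (hw : w ∈ Metric.ball (0 : ℂ) ρ) : HasSum (fun j => taylorCoeff R j * w ^ j) (R w) := by
  have := hasSum_taylorSeries_on_ball hR hw
  simp only [sub_zero, smul_eq_mul] at this
  have h2 : (fun j => taylorCoeff R j * w ^ j) =
      fun n : ℕ => ((n.factorial : ℂ))⁻¹ * (w ^ n * iteratedDeriv n R 0) := by
    ext j
    rw [taylorCoeff, div_eq_mul_inv]; ring
  rw [h2]; exact this

theorem summable_norm_taylorCoeff {R : ℂ → ℂ} {A L : ℝ} (hA : 0 < A)
    (hR : DifferentiableOn ℂ R (Metric.ball 0 A⁻¹)) (hL : A < L) :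
    Summable fun j => ‖taylorCoeff R j‖ * L⁻¹ ^ j := by
  have hL0 : 0 < L := hA.trans hL
  have hw : ((L⁻¹ : ℝ) : ℂ) ∈ Metric.ball (0 : ℂ) A⁻¹ := by
    rw [mem_ball_zero_iff, norm_real, Real.norm_of_nonneg (by positivity)]
    exact inv_strictAnti₀ hA hL
  have := (hasSum_taylorCoeff hR hw).summable.norm
  simpa [abs_of_pos hL0] using this

/-! ### Uniqueness of the special solution -/

/-- In the variable `x = e^{iθ₀} z`, the remainder of a special solution decays like
`|x| ^ (-Re τ - 1)` on a half-plane, because there the distance to the boundary is comparable to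
`|x|`. -/
theorem IsSpecialSolution.exists_decay {P Q : Polynomial ℂ} {R : ℂ → ℂ} {α : ℂ} {θ₀ ω Λ : ℝ}
    {Ψ : ℂ → ℂ} (hω : 0 < ω) (hω' : ω ≤ Real.pi / 2) (hΛ : 0 < Λ) (hτ : 0 < (tauOf P Q α).re)
    (h : IsSpecialSolution P Q R α θ₀ ω Λ Ψ) :
    ∃ L, ∃ E : ℂ → ℂ, HalfPlaneDecay ((tauOf P Q α).re + 1) L (fun x => E (exp (-(θ₀ * I)) * x)) ∧
      ∀ z : ℂ, L < (exp (θ₀ * I) * z).re →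
        Ψ z = exp (-α * z) * (branchPow (-θ₀) (-(tauOf P Q α)) z + E z) := by
  obtain ⟨E, ⟨hEd, C, hC⟩, hE⟩ := h.mem_affine
  obtain ⟨κ, hκ, L, hL, hb⟩ := exists_mul_norm_le_infDist (θ₀ := θ₀) hω hω' hΛ
  have hmem : ∀ z : ℂ, max L Λ < (exp (θ₀ * I) * z).re → z ∈ dualDomain θ₀ ω Λ := fun z hz =>
    ⟨θ₀, by simpa using hω, (le_max_right _ _).trans_lt hz⟩
  have hrot : ∀ x : ℂ, exp (θ₀ * I) * (exp (-(θ₀ * I)) * x) = x := by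
    intro x
    rw [← mul_assoc, ← Complex.exp_add, add_neg_cancel, Complex.exp_zero, one_mul]
  refine ⟨max L Λ, E, ⟨?_, |C| * κ ^ (-((tauOf P Q α).re + 1)), by positivity, fun x hx => ?_⟩,
    fun z hz => hE z (hmem z hz)⟩
  · refine hEd.comp (by fun_prop) fun x hx => hmem _ ?_
    rw [hrot]; exact hx
  · set z := exp (-(θ₀ * I)) * x with hz
    have hx' : max L Λ < (exp (θ₀ * I) * z).re := by rw [hz, hrot]; exact hx
    have hzn : ‖z‖ = ‖x‖ := by
      rw [hz, norm_mul, show -((θ₀ : ℂ) * I) = ((-θ₀ : ℝ) : ℂ) * I by push_cast; ring,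
        norm_exp_angle, one_mul]
    have h1 := hb z ((le_max_left _ _).trans_lt hx')
    have hzpos : 0 < ‖z‖ := hΛ.trans (norm_gt_of_mem_dualDomain (hmem z hx'))
    rw [← hzn, mul_assoc, ← Real.mul_rpow hκ.le hzpos.le]
    refine (hC z (hmem z hx')).trans ?_
    have h2 : -(tauOf P Q α).re - 1 = -((tauOf P Q α).re + 1) := by ring
    rw [h2]
    calc _ ≤ |C| * Metric.infDist z (frontier (dualDomain θ₀ ω Λ)) ^ (-((tauOf P Q α).re + 1)) := by
          gcongr
          · exact Real.rpow_nonneg Metric.infDist_nonneg _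
          · exact le_abs_self C
      _ ≤ _ := by
          gcongr 1
          exact Real.rpow_le_rpow_of_nonpos (by positivity) h1 (by linarith)

/-- An analytic function on the dual domain that vanishes far out in the direction `θ₀` vanishes:
each half-plane of the dual domain is convex and meets the set where it is known to vanish. -/
theorem eqOn_zero_dualDomain {θ₀ ω Λ L : ℝ} (hω' : ω ≤ Real.pi / 2) {Φ : ℂ → ℂ}
    (hΦ : DifferentiableOn ℂ Φ (dualDomain θ₀ ω Λ))
    (h0 : ∀ z : ℂ, L < (exp (θ₀ * I) * z).re → Φ z = 0) : EqOn Φ 0 (dualDomain θ₀ ω Λ) := by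
  intro z hz
  obtain ⟨θ, hθ, hz⟩ := hz
  have hsub : halfPlane θ Λ ⊆ dualDomain θ₀ ω Λ := fun y hy => ⟨θ, hθ, hy⟩
  have han : AnalyticOnNhd ℂ Φ (halfPlane θ Λ) := (hΦ.mono hsub).analyticOnNhd (isOpen_halfPlane θ Λ)
  have hcos : 0 < Real.cos (θ - θ₀) := by
    have := abs_lt.1 hθ
    exact Real.cos_pos_of_mem_Ioo ⟨by linarith, by linarith⟩
  set r : ℝ := |L| + 1 + (|Λ| + 1) / Real.cos (θ - θ₀) with hr
  set y : ℂ := exp (-(θ₀ * I)) * r with hy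
  have h1 : exp (θ₀ * I) * y = r := by
    rw [hy, ← mul_assoc, ← Complex.exp_add, add_neg_cancel, Complex.exp_zero, one_mul]
  have hc0 : 0 < (|Λ| + 1) / Real.cos (θ - θ₀) := by positivity
  have hyL : y ∈ {z : ℂ | L < (exp (θ₀ * I) * z).re} := by
    show L < (exp (θ₀ * I) * y).re
    rw [h1, ofReal_re, hr]
    linarith [le_abs_self L]
  have hyθ : y ∈ halfPlane θ Λ := by
    show Λ < (exp (θ * I) * y).re
    have h2 := re_exp_mul_rotate θ₀ (θ - θ₀) y
    rw [add_sub_cancel, h1, ofReal_re, ofReal_im, mul_zero, sub_zero] at h2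
    rw [h2, hr, mul_add, mul_div_cancel₀ _ hcos.ne']
    have : 0 ≤ Real.cos (θ - θ₀) * (|L| + 1) := by positivity
    linarith [le_abs_self Λ]
  refine han.eqOn_zero_of_preconnected_of_eventuallyEq_zero (convex_halfPlane θ Λ).isPreconnected
    hyθ ?_ hz
  filter_upwards [(isOpen_halfPlane θ₀ L).mem_nhds hyL] with x hx using h0 x hx

/-- The leading terms of two special solutions cancel in their difference, which is thus `e^{-αz}`
times a function to which `exists_eq_zero_of_halfPlaneDecay` applies, after the shift by `α` and the
rotation by `θ₀` that move the ray to the positive half-line. -/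
theorem IsSpecialSolution.eqOn {P Q : Polynomial ℂ} (hP : P.Monic)
    (hPsimple : ∀ r : ℂ, P.IsRoot r → P.rootMultiplicity r = 1)
    {R : ℂ → ℂ} {A : ℝ} (hA : 0 < A) (hR : DifferentiableOn ℂ R (Metric.ball 0 A⁻¹))
    {α : ℂ} (hα : P.IsRoot (-α)) (hτ : 0 < (tauOf P Q α).re)
    {θ₀ ω : ℝ} (hω : 0 < ω) (hω' : ω ≤ Real.pi / 2)
    (hsector : ∀ β : ℂ, β ≠ α → P.IsRoot (-β) → β ∉ closure (sector α θ₀ ω))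
    {Λ₁ Λ₂ : ℝ} (hΛ₁ : A ≤ Λ₁) (hΛ₂ : A ≤ Λ₂) {Ψ₁ Ψ₂ : ℂ → ℂ}
    (h₁ : IsSpecialSolution P Q R α θ₀ ω Λ₁ Ψ₁) (h₂ : IsSpecialSolution P Q R α θ₀ ω Λ₂ Ψ₂) :
    EqOn Ψ₁ Ψ₂ (dualDomain θ₀ ω (max Λ₁ Λ₂)) := by
  set τ := tauOf P Q α with hτdef
  have hP' := derivative_eval_ne_zero_of_simple hP hPsimple hα
  obtain ⟨L₁, E₁, hE₁, hΨ₁⟩ := h₁.exists_decay hω hω' (hA.trans_le hΛ₁) hτ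
  obtain ⟨L₂, E₂, hE₂, hΨ₂⟩ := h₂.exists_decay hω hω' (hA.trans_le hΛ₂) hτ
  set L := max (max L₁ L₂) (max Λ₁ Λ₂) + 1 with hLdef
  have hL₁ : L₁ ≤ L := by
    have := (le_max_left L₁ L₂).trans (le_max_left _ (max Λ₁ Λ₂)); linarith
  have hL₂ : L₂ ≤ L := by
    have := (le_max_right L₁ L₂).trans (le_max_left _ (max Λ₁ Λ₂)); linarith
  have hLΛ : max Λ₁ Λ₂ ≤ L := by
    have := le_max_right (max L₁ L₂) (max Λ₁ Λ₂); linarith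
  have hLA : A < L := by
    have := hΛ₁.trans ((le_max_left Λ₁ Λ₂).trans (le_max_right (max L₁ L₂) (max Λ₁ Λ₂))); linarith
  have hL0 : 0 < L := hA.trans hLA
  set l := exp (θ₀ * I) with hl
  have hlne : l ≠ 0 := Complex.exp_ne_zero _
  have hlinv : exp (-(θ₀ * I)) = l⁻¹ := by rw [Complex.exp_neg]
  have hln : ‖l‖ = 1 := norm_exp_angle θ₀
  rw [hlinv] at hE₁ hE₂
  set V : Set ℂ := {x : ℂ | L < x.re} with hV
  have hVo : IsOpen V := isOpen_re_gt L
  -- the difference of the two solutions, in normal form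
  set E : ℂ → ℂ := fun x => E₁ (l⁻¹ * x) + (fun _ => (-1 : ℂ)) x * E₂ (l⁻¹ * x) with hEdef
  have hE : HalfPlaneDecay (τ.re + 1) L E :=
    (hE₁.mono hL₁).add ((hE₂.mono hL₂).bounded_mul (h := fun _ => -1) (M := 1) (by fun_prop)
      (fun _ _ => by simp))
  set W : Set ℂ := halfPlane θ₀ L with hW
  have hWo : IsOpen W := isOpen_halfPlane θ₀ L
  have hWsub : ∀ {Λ : ℝ}, Λ ≤ max Λ₁ Λ₂ → W ⊆ dualDomain θ₀ ω Λ := fun hΛ z hz =>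
    ⟨θ₀, by simpa using hω, (hΛ.trans hLΛ).trans_lt hz⟩
  have hΦ : EqOn (Ψ₁ - Ψ₂) (fun z => exp (-α * z) * E (l * z)) W := by
    intro z hz
    have hz' : L < (l * z).re := hz
    simp only [Pi.sub_apply, hEdef, inv_mul_cancel_left₀ hlne]
    rw [hΨ₁ z (hL₁.trans_lt hz'), hΨ₂ z (hL₂.trans_lt hz')]
    ring
  set s : Polynomial ℂ := Polynomial.C l * Polynomial.X - Polynomial.C α with hsdef
  have hode : ∀ x : ℂ, L < x.re → polyDiff (P.comp s) E x +
      x⁻¹ * polyDiff (Polynomial.C l * Q.comp s) E x +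
      x⁻¹ ^ 2 * (fun w => l ^ 2 * R (l * w)) x⁻¹ * E x = 0 := by
    intro x hx
    set z := l⁻¹ * x with hz
    have hlz : l * z = x := by rw [hz, mul_inv_cancel_left₀ hlne]
    have hzW : z ∈ W := by show L < (l * z).re; rw [hlz]; exact hx
    have e₁ := h₁.solves z (hWsub (le_max_left _ _) hzW)
    have e₂ := h₂.solves z (hWsub (le_max_right _ _) hzW)
    have hd₁ := h₁.holo.mono (hWsub (le_max_left _ _))
    have hd₂ := h₂.holo.mono (hWsub (le_max_right _ _))
    have key : ∀ p : Polynomial ℂ, polyDiff p Ψ₁ z - polyDiff p Ψ₂ z =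
        exp (-α * z) * polyDiff (p.comp s) E x := by
      intro p
      rw [← polyDiff_sub hWo hd₁ hd₂ p hzW, polyDiff_congr hWo hΦ p hzW,
        polyDiff_exp_mul_comp hVo hE.1 α l p z (by rw [hlz]; exact hx), hlz]
    have hzi : z⁻¹ = l * x⁻¹ := by rw [hz, mul_inv, inv_inv]
    have hΦz : Ψ₁ z - Ψ₂ z = exp (-α * z) * E x := by
      have := hΦ hzW
      simp only [Pi.sub_apply, hlz] at this
      exact this
    have h3 : exp (-α * z) * (polyDiff (P.comp s) E x +
      x⁻¹ * polyDiff (Polynomial.C l * Q.comp s) E x +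
      x⁻¹ ^ 2 * (l ^ 2 * R (l * x⁻¹)) * E x) = 0 := by
      unfold levelOneOp at e₁ e₂
      rw [polyDiff_C_mul]
      rw [hzi] at e₁ e₂
      linear_combination e₁ - e₂ - key P - l * x⁻¹ * key Q - (l * x⁻¹) ^ 2 * R (l * x⁻¹) * hΦz
    exact (mul_eq_zero.1 h3).resolve_left (Complex.exp_ne_zero _)
  have hball : ∀ w ∈ Metric.ball (0 : ℂ) L⁻¹, l * w ∈ Metric.ball (0 : ℂ) A⁻¹ := by
    intro w hw
    rw [mem_ball_zero_iff] at hw ⊢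
    rw [norm_mul, hln, one_mul]
    exact hw.trans (inv_strictAnti₀ hA hLA)
  have hex : ∃ L' : ℝ, ∀ x : ℂ, L' < x.re → E x = 0 := by
    refine exists_eq_zero_of_halfPlaneDecay (p := P.comp s)
      (q := Polynomial.C l * Q.comp s) (R := fun w => l ^ 2 * R (l * w))
      (r := fun j => l ^ 2 * (taylorCoeff R j * l ^ j)) (τ := τ) hτ
      (by simpa [hsdef] using hα) ?_ ?_ ?_ hL0 ?_ ?_ ?_ hE hode
    -- the roots of the rotated polynomial avoid the half-line, which lies in the sector
    · intro t ht h
      have hne : l * (t : ℂ) ≠ 0 := mul_ne_zero hlne (ofReal_ne_zero.2 ht.ne')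
      refine hsector (α + t * l) ?_ ?_ (subset_closure (mem_sector ht (by simpa using hω)))
      · intro h'
        exact hne (by rw [mul_comm]; simpa using h')
      · rw [Polynomial.eval_comp] at h
        simp only [hsdef, Polynomial.eval_sub, Polynomial.eval_mul, Polynomial.eval_C,
          Polynomial.eval_X] at h
        rw [Polynomial.IsRoot, ← h]
        congr 1; ring
    · simpa [hsdef, Polynomial.derivative_comp, hlne] using hP'
    · have : τ * P.derivative.eval (-α) = Q.eval (-α) := by
        rw [hτdef, tauOf, div_mul_cancel₀ _ hP']
      simp [hsdef, Polynomial.derivative_comp, ← this]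
      ring
    · exact (hR.comp (by fun_prop) hball).const_mul _
    · intro w hw
      have := (hasSum_taylorCoeff hR (hball w hw)).mul_left (l ^ 2)
      simpa only [mul_pow, mul_assoc] using this
    · simpa [hln] using summable_norm_taylorCoeff hA hR hLA
  obtain ⟨L', hL'⟩ := hex
  have h0 : ∀ z : ℂ, max L L' < (exp (θ₀ * I) * z).re → (Ψ₁ - Ψ₂) z = 0 := by
    intro z hz
    rw [hΦ ((le_max_left _ _).trans_lt hz : L < _)]
    simp only
    rw [hL' _ ((le_max_right _ _).trans_lt hz), mul_zero]
  have := eqOn_zero_dualDomain (Λ := max Λ₁ Λ₂) hω' ((h₁.holo.mono (dualDomain_anti (le_max_left _ _))).sub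
    (h₂.holo.mono (dualDomain_anti (le_max_right _ _)))) h0
  intro z hz
  exact sub_eq_zero.1 (this hz)

/-! ### Integro-differential equations on star-shaped domains -/

/-- The primitive, vanishing at the origin, of a function on a domain that is star-shaped with
respect to the origin. -/
def radialPrimitive (h : ℂ → ℂ) (w : ℂ) : ℂ := ∫ x in (0 : ℝ)..1, w * h (x * w)

theorem norm_ofReal_mul_le {s : ℝ} (hs : s ∈ Icc (0 : ℝ) 1) (w : ℂ) : ‖(s : ℂ) * w‖ = s * ‖w‖ := by
  rw [norm_mul, norm_real, Real.norm_of_nonneg hs.1]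

theorem hasDerivAt_radialPrimitive {U : Set ℂ} (hU : IsOpen U)
    (hstar : ∀ w ∈ U, ∀ s ∈ Icc (0 : ℝ) 1, (s : ℂ) * w ∈ U) {h : ℂ → ℂ} (hh : DifferentiableOn ℂ h U)
    {K L : ℝ} (hK : 0 ≤ K) (hL : 0 ≤ L) (hb : ∀ w ∈ U, ‖h w‖ ≤ K * Real.exp (L * ‖w‖)) {w₀ : ℂ} (hw₀ : w₀ ∈ U) :
    HasDerivAt (radialPrimitive h) (h w₀) w₀ := by
  obtain ⟨r, hr, hball⟩ := Metric.isOpen_iff.1 hU w₀ hw₀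
  have hIoc : ∀ {s : ℝ}, s ∈ Ioc (0 : ℝ) 1 → s ∈ Icc (0 : ℝ) 1 := fun h => Ioc_subset_Icc_self h
  have hcont : ∀ w ∈ U, ContinuousOn (fun x : ℝ => h (x * w)) (Icc 0 1) := fun w hw =>
    hh.continuousOn.comp (by fun_prop) fun x hx => hstar w hw x hx
  have key := hasDerivAt_integral_of_holomorphic (μ := volume.restrict (Ioc (0 : ℝ) 1))
    (F := fun w x => w * h (x * w)) (w₀ := w₀) hr
    (bound := fun _ => (‖w₀‖ + r) * (K * Real.exp (L * (‖w₀‖ + r)))) (integrable_const _)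
    (fun w hw => ?_) ?_ ?_
  · have h1 : ∫ x in Ioc (0 : ℝ) 1, deriv (fun w => w * h (x * w)) w₀ = h w₀ := by
      have hd : ∀ x ∈ Icc (0 : ℝ) 1, deriv (fun w => w * h (x * w)) w₀ =
          h (x * w₀) + w₀ * (x * deriv h (x * w₀)) := by
        intro x hx
        have h2 := (hh.differentiableAt (hU.mem_nhds (hstar w₀ hw₀ x hx))).hasDerivAt
        have h3 : HasDerivAt (fun w : ℂ => (x : ℂ) * w) x w₀ := by
          simpa using (hasDerivAt_id w₀).const_mul (x : ℂ)
        have h4 := (hasDerivAt_id w₀).mul (h2.comp w₀ h3)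
        have h5 : (id * (h ∘ fun w : ℂ => (x : ℂ) * w)) = fun w => w * h (x * w) := rfl
        rw [h5] at h4
        rw [h4.deriv]
        simp only [Function.comp, id]; ring
      have hint := key.1
      have hint2 : IntervalIntegrable (fun x : ℝ => h (x * w₀) + w₀ * (x * deriv h (x * w₀)))
          volume 0 1 := by
        rw [intervalIntegrable_iff_integrableOn_Ioc_of_le zero_le_one]
        refine hint.congr ?_
        filter_upwards [ae_restrict_mem measurableSet_Ioc] with x hx
        exact hd x (hIoc hx)
      rw [setIntegral_congr_fun measurableSet_Ioc fun x hx => hd x (hIoc hx),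
        ← intervalIntegral.integral_of_le zero_le_one]
      have h6 := intervalIntegral.integral_eq_sub_of_hasDerivAt (a := 0) (b := 1)
        (f := fun x : ℝ => (x : ℂ) * h (x * w₀)) (fun x hx => ?_) hint2
      · simpa using h6
      · rw [uIcc_of_le zero_le_one] at hx
        have h2 := (hh.differentiableAt (hU.mem_nhds (hstar w₀ hw₀ x hx))).hasDerivAt
        have h3 : HasDerivAt (fun y : ℝ => (y : ℂ) * w₀) w₀ x := by
          simpa using ((hasDerivAt_id (x : ℂ)).mul_const w₀).comp_ofReal
        have h4 := ((hasDerivAt_id (x : ℂ)).comp_ofReal).mul (h2.comp x h3)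
        refine h4.congr_deriv ?_
        simp only [Function.comp, id]; ring
    have h7 := key.2
    rw [h1] at h7
    have h8 : radialPrimitive h = fun w => ∫ x in Ioc (0 : ℝ) 1, w * h (x * w) := by
      ext w; rw [radialPrimitive, intervalIntegral.integral_of_le zero_le_one]
    rw [h8]; exact h7
  · exact (((hcont w (hball hw)).mono Ioc_subset_Icc_self).aestronglyMeasurable
      measurableSet_Ioc).const_mul w
  · filter_upwards [ae_restrict_mem measurableSet_Ioc] with x hx
    exact differentiableOn_id.mul (hh.comp (by fun_prop) fun w hw => hstar w (hball hw) x (hIoc hx))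
  · filter_upwards [ae_restrict_mem measurableSet_Ioc] with x hx w hw
    have h1 : ‖w‖ ≤ ‖w₀‖ + r := by
      have := mem_ball_iff_norm.1 hw
      calc ‖w‖ = ‖w₀ + (w - w₀)‖ := by ring_nf
        _ ≤ ‖w₀‖ + ‖w - w₀‖ := norm_add_le _ _
        _ ≤ _ := by gcongr
    rw [norm_mul]
    have h2 := hb _ (hstar w (hball hw) x (hIoc hx))
    have h3 : ‖(x : ℂ) * w‖ ≤ ‖w₀‖ + r := by
      rw [norm_ofReal_mul_le (hIoc hx)]
      have := mul_le_mul_of_nonneg_right hx.2 (norm_nonneg w)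
      linarith
    gcongr
    refine h2.trans ?_
    gcongr

theorem norm_radialPrimitive_le {U : Set ℂ}
    (hstar : ∀ w ∈ U, ∀ s ∈ Icc (0 : ℝ) 1, (s : ℂ) * w ∈ U) {h : ℂ → ℂ} {K L : ℝ} (hK : 0 ≤ K)
    (hL : 0 < L) (hb : ∀ w ∈ U, ‖h w‖ ≤ K * Real.exp (L * ‖w‖)) {w : ℂ} (hw : w ∈ U) :
    ‖radialPrimitive h w‖ ≤ K / L * Real.exp (L * ‖w‖) := by
  have hd : ∀ x : ℝ, HasDerivAt (fun x : ℝ => K / L * Real.exp (x * (L * ‖w‖)))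
      (‖w‖ * (K * Real.exp (x * (L * ‖w‖)))) x := by
    intro x
    have := (((hasDerivAt_id x).mul_const (L * ‖w‖)).exp).const_mul (K / L)
    refine this.congr_deriv ?_
    simp only [id]
    field_simp
  have hint : IntervalIntegrable (fun x : ℝ => ‖w‖ * (K * Real.exp (x * (L * ‖w‖)))) volume 0 1 :=
    (by fun_prop : Continuous fun x : ℝ => ‖w‖ * (K * Real.exp (x * (L * ‖w‖)))).intervalIntegrable _ _
  have h1 := intervalIntegral.norm_integral_le_of_norm_le (μ := volume) (a := 0) (b := 1)
    (f := fun x : ℝ => w * h (x * w)) zero_le_one (Eventually.of_forall fun x hx => ?_) hint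
  · rw [intervalIntegral.integral_eq_sub_of_hasDerivAt (fun x _ => hd x) hint] at h1
    refine h1.trans ?_
    have : 0 ≤ K / L := by positivity
    simp [this]
  · have hx' := Ioc_subset_Icc_self hx
    rw [norm_mul]
    have := hb _ (hstar w hw x hx')
    rw [norm_ofReal_mul_le hx'] at this
    gcongr
    refine this.trans_eq ?_
    ring_nf

/-- The right-hand side `a G + ∫₀¹ κ(s, w) G(s w) ds` of the integro-differential equation. -/
def volterraOp (a : ℂ → ℂ) (κ : ℝ → ℂ → ℂ) (G : ℂ → ℂ) (w : ℂ) : ℂ :=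
  a w * G w + ∫ s in (0 : ℝ)..1, κ s w * G (s * w)

/-- On a star-shaped domain, the equation `G' = a G + ∫₀¹ κ(s, w) G(s w) ds` with bounded `a` and
`|κ(s, w)| ≤ M e^{B (1 - s) |w|}` has a solution of exponential type with any given value at the
origin: in the norm `sup |G(w)| e^{-L |w|}`, integration of the right-hand side is a contraction
when `L` is large, so the Neumann series converges. -/
theorem exists_volterraOp_solution {U : Set ℂ} (hU : IsOpen U)
    (hstar : ∀ w ∈ U, ∀ s ∈ Icc (0 : ℝ) 1, (s : ℂ) * w ∈ U) {a : ℂ → ℂ} {κ : ℝ → ℂ → ℂ} {M B : ℝ}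
    (hM : 0 ≤ M)
    (ha : DifferentiableOn ℂ a U) (hab : ∀ w ∈ U, ‖a w‖ ≤ M)
    (hκd : ∀ s ∈ Ioc (0 : ℝ) 1, DifferentiableOn ℂ (κ s) U)
    (hκc : ∀ w ∈ U, ContinuousOn (fun s => κ s w) (Ioc (0 : ℝ) 1))
    (hκb : ∀ s ∈ Ioc (0 : ℝ) 1, ∀ w ∈ U, ‖κ s w‖ ≤ M * Real.exp (B * (1 - s) * ‖w‖)) (g₀ : ℂ) :
    ∃ G : ℂ → ℂ, (∀ w ∈ U, HasDerivAt G (volterraOp a κ G w) w) ∧ G 0 = g₀ ∧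
      ∃ C L : ℝ, 0 ≤ C ∧ 0 ≤ L ∧ ∀ w ∈ U, ‖G w‖ ≤ C * Real.exp (L * ‖w‖) ∧
        ‖volterraOp a κ G w‖ ≤ C * Real.exp (L * ‖w‖) := by
  -- The right-hand side is bounded by `2 M` in the weighted norm and integration gains `1 / L`, so
  -- `4 M ≤ L` makes the iteration contract by `1 / 2`.
  set L : ℝ := max B (max (4 * M) 1) with hLdef
  have hLB : B ≤ L := le_max_left _ _
  have hLM : 4 * M ≤ L := (le_max_left _ _).trans (le_max_right _ _)
  have hL1 : 1 ≤ L := (le_max_right _ _).trans (le_max_right _ _)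
  have hL0 : 0 < L := by linarith
  -- bounds for the integrand
  have hker : ∀ {G : ℂ → ℂ} {K : ℝ}, (∀ w ∈ U, ‖G w‖ ≤ K * Real.exp (L * ‖w‖)) → ∀ w ∈ U,
      ∀ s ∈ Ioc (0 : ℝ) 1, ‖κ s w * G (s * w)‖ ≤ M * K * Real.exp (L * ‖w‖) := by
    intro G K hG w hw s hs
    have hs' := Ioc_subset_Icc_self hs
    rw [norm_mul]
    have h1 := hG _ (hstar w hw s hs')
    rw [norm_ofReal_mul_le hs'] at h1
    have h2 := hκb s hs w hw
    have hK : 0 ≤ K := by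
      by_contra hneg
      have := (norm_nonneg _).trans h1
      have h3 := Real.exp_pos (L * (s * ‖w‖))
      nlinarith
    calc _ ≤ M * Real.exp (B * (1 - s) * ‖w‖) * (K * Real.exp (L * (s * ‖w‖))) := by gcongr
      _ = M * K * Real.exp (B * (1 - s) * ‖w‖ + L * (s * ‖w‖)) := by rw [Real.exp_add]; ring
      _ ≤ _ := by
        have h4 : B * (1 - s) * ‖w‖ ≤ L * (1 - s) * ‖w‖ := by
          have := sub_nonneg.2 hs.2
          gcongr
        have h5 : B * (1 - s) * ‖w‖ + L * (s * ‖w‖) ≤ L * ‖w‖ := by linarith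
        gcongr
  have hmeas : ∀ {G : ℂ → ℂ}, DifferentiableOn ℂ G U → ∀ w ∈ U,
      AEStronglyMeasurable (fun s : ℝ => κ s w * G (s * w)) (volume.restrict (Ioc 0 1)) := by
    intro G hG w hw
    refine ContinuousOn.aestronglyMeasurable ?_ measurableSet_Ioc
    exact (hκc w hw).mul (hG.continuousOn.comp (by fun_prop)
      fun x hx => hstar w hw x (Ioc_subset_Icc_self hx))
  have hNd : ∀ {G : ℂ → ℂ} {K : ℝ}, 0 ≤ K → DifferentiableOn ℂ G U →
      (∀ w ∈ U, ‖G w‖ ≤ K * Real.exp (L * ‖w‖)) → DifferentiableOn ℂ (volterraOp a κ G) U := by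
    intro G K hK hGd hG
    refine (ha.mul hGd).add ?_
    have : (fun w => ∫ s in (0 : ℝ)..1, κ s w * G (s * w)) =
        fun w => ∫ s in Ioc (0 : ℝ) 1, κ s w * G (s * w) := by
      ext w; rw [intervalIntegral.integral_of_le zero_le_one]
    rw [this]
    refine differentiableOn_integral_of_holomorphic fun w₀ hw₀ => ?_
    obtain ⟨r, hr, hball⟩ := Metric.isOpen_iff.1 hU w₀ hw₀
    refine ⟨r, hr, fun _ => M * K * Real.exp (L * (‖w₀‖ + r)), integrable_const _,
      fun w hw => hmeas hGd w (hball hw), ?_, ?_⟩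
    · filter_upwards [ae_restrict_mem measurableSet_Ioc] with s hs
      exact ((hκd s hs).mono hball).mul (hGd.comp (by fun_prop)
        fun w hw => hstar w (hball hw) s (Ioc_subset_Icc_self hs))
    · filter_upwards [ae_restrict_mem measurableSet_Ioc] with s hs w hw
      refine (hker hG w (hball hw) s hs).trans ?_
      have h1 : ‖w‖ ≤ ‖w₀‖ + r := by
        have := mem_ball_iff_norm.1 hw
        calc ‖w‖ = ‖w₀ + (w - w₀)‖ := by ring_nf
          _ ≤ ‖w₀‖ + ‖w - w₀‖ := norm_add_le _ _
          _ ≤ _ := by gcongr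
      gcongr
  have hNb : ∀ {G : ℂ → ℂ} {K : ℝ}, (∀ w ∈ U, ‖G w‖ ≤ K * Real.exp (L * ‖w‖)) →
      ∀ w ∈ U, ‖volterraOp a κ G w‖ ≤ 2 * M * K * Real.exp (L * ‖w‖) := by
    intro G K hG w hw
    refine (norm_add_le _ _).trans ?_
    have h1 : ‖a w * G w‖ ≤ M * (K * Real.exp (L * ‖w‖)) := by
      rw [norm_mul]
      have := hab w hw
      have := hG w hw
      gcongr
    have h2 : ‖∫ s in (0 : ℝ)..1, κ s w * G (s * w)‖ ≤ M * K * Real.exp (L * ‖w‖) * |1 - 0| := by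
      refine intervalIntegral.norm_integral_le_of_norm_le_const fun s hs => ?_
      rw [uIoc_of_le zero_le_one] at hs
      exact hker hG w hw s hs
    rw [sub_zero, abs_one, mul_one] at h2
    linarith
  set f : ℕ → ℂ → ℂ := fun n =>
    Nat.rec (fun _ => g₀) (fun _ G => radialPrimitive (volterraOp a κ G)) n with hf
  have hf0 : f 0 = fun _ => g₀ := rfl
  have hfs : ∀ n, f (n + 1) = radialPrimitive (volterraOp a κ (f n)) := fun n => rfl
  set K : ℕ → ℝ := fun n => ‖g₀‖ * (1 / 2) ^ n with hK
  have hK0 : ∀ n, 0 ≤ K n := fun n => by positivity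
  have hfb : ∀ n, DifferentiableOn ℂ (f n) U ∧ ∀ w ∈ U, ‖f n w‖ ≤ K n * Real.exp (L * ‖w‖) := by
    intro n
    induction n with
    | zero =>
      refine ⟨by rw [hf0]; exact differentiableOn_const _, fun w _ => ?_⟩
      rw [hf0]
      simp only [hK, pow_zero, mul_one]
      exact le_mul_of_one_le_right (norm_nonneg _) (Real.one_le_exp (by positivity))
    | succ n ih =>
      have h1 := hNd (hK0 n) ih.1 ih.2
      have h2 := hNb ih.2
      have hpos : 0 ≤ 2 * M * K n := by have := hK0 n; positivity
      refine ⟨fun w hw => ?_, fun w hw => ?_⟩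
      · rw [hfs]
        exact (hasDerivAt_radialPrimitive hU hstar h1 hpos hL0.le h2
          hw).differentiableAt.differentiableWithinAt
      · rw [hfs]
        refine (norm_radialPrimitive_le hstar hpos hL0 h2 hw).trans ?_
        gcongr
        rw [div_le_iff₀ hL0]
        have := hK0 n
        simp only [hK, pow_succ] at this ⊢
        nlinarith
  have hKsum : Summable K := (summable_geometric_of_lt_one (by norm_num) (by norm_num)).mul_left _
  have hsum : ∀ w ∈ U, Summable fun n => f n w := fun w hw =>
    Summable.of_norm_bounded (hKsum.mul_right (Real.exp (L * ‖w‖))) fun n => (hfb n).2 w hw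
  set G : ℂ → ℂ := fun w => ∑' n, f n w with hG
  have hGb : ∀ w ∈ U, ‖G w‖ ≤ (∑' n, K n) * Real.exp (L * ‖w‖) := fun w hw =>
    tsum_of_norm_bounded (hKsum.hasSum.mul_right _) fun n => (hfb n).2 w hw
  have hGd : DifferentiableOn ℂ G U := by
    intro w hw
    have hopen : IsOpen (U ∩ Metric.ball 0 (‖w‖ + 1)) := hU.inter Metric.isOpen_ball
    have hmem : w ∈ U ∩ Metric.ball 0 (‖w‖ + 1) := ⟨hw, by simp⟩
    have := differentiableOn_tsum_of_summable_norm
      (hKsum.mul_right (Real.exp (L * (‖w‖ + 1)))) (fun n => (hfb n).1.mono inter_subset_left) hopen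
      (fun n v hv => ((hfb n).2 v hv.1).trans (by
        have := (mem_ball_zero_iff.1 hv.2).le
        have := hK0 n
        gcongr))
    exact (this.differentiableAt (hopen.mem_nhds hmem)).differentiableWithinAt
  have hGN : ∀ w ∈ U, HasSum (fun n => volterraOp a κ (f n) w) (volterraOp a κ G w) := by
    intro w hw
    refine ((hsum w hw).hasSum.mul_left (a w)).add ?_
    refine intervalIntegral.hasSum_integral_of_dominated_convergence
      (fun n _ => M * K n * Real.exp (L * ‖w‖)) (fun n => ?_) (fun n => ?_) ?_ ?_ ?_
    · rw [uIoc_of_le zero_le_one]; exact hmeas (hfb n).1 w hw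
    · refine Eventually.of_forall fun s hs => ?_
      rw [uIoc_of_le zero_le_one] at hs
      exact hker (hfb n).2 w hw s hs
    · exact Eventually.of_forall fun s hs => (hKsum.mul_left M).mul_right _
    · exact intervalIntegrable_const
    · refine Eventually.of_forall fun s hs => ?_
      rw [uIoc_of_le zero_le_one] at hs
      exact (hsum _ (hstar w hw s (Ioc_subset_Icc_self hs))).hasSum.mul_left _
  have hK1 : 0 ≤ ∑' n, K n := tsum_nonneg hK0
  have hNGd := hNd hK1 hGd hGb
  have hNGb := hNb hGb
  have hfix : ∀ w ∈ U, G w = g₀ + radialPrimitive (volterraOp a κ G) w := by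
    intro w hw
    have h1 : HasSum (fun n => f (n + 1) w) (radialPrimitive (volterraOp a κ G) w) := by
      refine intervalIntegral.hasSum_integral_of_dominated_convergence
        (F := fun n (x : ℝ) => w * volterraOp a κ (f n) (x * w))
        (fun n _ => ‖w‖ * (2 * M * K n * Real.exp (L * ‖w‖))) (fun n => ?_) (fun n => ?_) ?_ ?_ ?_
      · rw [uIoc_of_le zero_le_one]
        refine ContinuousOn.aestronglyMeasurable ?_ measurableSet_Ioc
        exact continuousOn_const.mul ((hNd (hK0 n) (hfb n).1 (hfb n).2).continuousOn.comp
          (by fun_prop) fun x hx => hstar w hw x (Ioc_subset_Icc_self hx))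
      · refine Eventually.of_forall fun s hs => ?_
        rw [uIoc_of_le zero_le_one] at hs
        have hs' := Ioc_subset_Icc_self hs
        rw [norm_mul]
        gcongr
        refine (hNb (hfb n).2 _ (hstar w hw s hs')).trans ?_
        have h2 := hK0 n
        have h3 : ‖(s : ℂ) * w‖ ≤ ‖w‖ := by
          rw [norm_ofReal_mul_le hs']
          exact mul_le_of_le_one_left (norm_nonneg _) hs.2
        gcongr
      · exact Eventually.of_forall fun s hs =>
          ((hKsum.mul_left (2 * M)).mul_right _).mul_left _
      · exact intervalIntegrable_const
      · refine Eventually.of_forall fun s hs => ?_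
        rw [uIoc_of_le zero_le_one] at hs
        exact (hGN _ (hstar w hw s (Ioc_subset_Icc_self hs))).mul_left _
    have h2 := (hsum w hw).tsum_eq_zero_add
    rw [h1.tsum_eq] at h2
    exact h2
  have hC : 0 ≤ 2 * M * ∑' n, K n := by positivity
  refine ⟨G, fun w hw => ?_, ?_, ∑' n, K n + 2 * M * ∑' n, K n, L, by positivity, hL0.le,
    fun w hw => ⟨(hGb w hw).trans ?_, (hNGb w hw).trans ?_⟩⟩
  · have h1 := (hasDerivAt_radialPrimitive hU hstar hNGd (by positivity) hL0.le hNGb hw).const_add g₀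
    refine h1.congr_of_eventuallyEq ?_
    filter_upwards [hU.mem_nhds hw] with v hv using hfix v hv
  · have h1 : ∀ n, f (n + 1) 0 = 0 := fun n => by simp [hfs, radialPrimitive]
    have h2 : HasSum (fun n => f n 0) (f 0 0) := hasSum_single 0 fun n hn => by
      obtain ⟨m, rfl⟩ := Nat.exists_eq_succ_of_ne_zero hn
      exact h1 m
    exact h2.tsum_eq
  · gcongr; linarith
  · gcongr; linarith

/-! ### Growth of polynomials away from their roots -/

theorem exists_norm_eval_le (p : Polynomial ℂ) {n : ℕ} (hn : p.natDegree ≤ n) :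
    ∃ C : ℝ, 0 ≤ C ∧ ∀ w : ℂ, ‖p.eval w‖ ≤ C * (1 + ‖w‖) ^ n := by
  refine ⟨∑ i ∈ Finset.range (n + 1), ‖p.coeff i‖, by positivity, fun w => ?_⟩
  rw [Polynomial.eval_eq_sum_range' (Nat.lt_succ_of_le hn), Finset.sum_mul]
  refine norm_sum_le_of_le _ fun i hi => ?_
  rw [norm_mul, norm_pow]
  have hi' : i ≤ n := Nat.lt_succ_iff.1 (Finset.mem_range.1 hi)
  gcongr
  calc ‖w‖ ^ i ≤ (1 + ‖w‖) ^ i := by gcongr; linarith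
    _ ≤ _ := pow_le_pow_right₀ (by linarith [norm_nonneg w]) hi'

theorem exists_le_norm_sub {F : Set ℂ} (hF : IsClosed F) {a : ℂ} (ha : a ∉ F) :
    ∃ c > 0, ∀ w ∈ F, c * (1 + ‖w‖) ≤ ‖w - a‖ := by
  obtain ⟨δ, hδ, hball⟩ := Metric.isOpen_iff.1 hF.isOpen_compl a ha
  refine ⟨((1 + ‖a‖) / δ + 1)⁻¹, by positivity, fun w hw => ?_⟩
  rw [inv_mul_le_iff₀ (by positivity)]
  have h1 : δ ≤ ‖w - a‖ := by
    by_contra h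
    exact hball (mem_ball_iff_norm.2 (not_le.1 h)) hw
  have h2 : 1 + ‖a‖ ≤ (1 + ‖a‖) / δ * ‖w - a‖ := by
    rw [div_mul_eq_mul_div, le_div_iff₀ hδ]
    gcongr
  have h3 : ‖w‖ ≤ ‖w - a‖ + ‖a‖ := by
    calc ‖w‖ = ‖(w - a) + a‖ := by ring_nf
      _ ≤ _ := norm_add_le _ _
  linarith

/-- A polynomial without roots on a closed set has full growth there. -/
theorem exists_le_norm_eval {F : Set ℂ} (hF : IsClosed F) {p : Polynomial ℂ}
    (hp : ∀ w ∈ F, p.eval w ≠ 0) (hp0 : p ≠ 0) :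
    ∃ c > 0, ∀ w ∈ F, c * (1 + ‖w‖) ^ p.natDegree ≤ ‖p.eval w‖ := by
  have hroots : ∀ m : Multiset ℂ, (∀ a ∈ m, a ∉ F) →
      ∃ c > 0, ∀ w ∈ F, c * (1 + ‖w‖) ^ Multiset.card m ≤ ‖(m.map fun a => w - a).prod‖ := by
    intro m
    induction m using Multiset.induction with
    | empty => intro _; exact ⟨1, one_pos, fun w _ => by simp⟩
    | cons a m ih =>
      intro h
      obtain ⟨c, hc, h1⟩ := ih fun b hb => h b (Multiset.mem_cons_of_mem hb)
      obtain ⟨c', hc', h2⟩ := exists_le_norm_sub hF (h a (Multiset.mem_cons_self a m))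
      refine ⟨c' * c, by positivity, fun w hw => ?_⟩
      rw [Multiset.card_cons, Multiset.map_cons, Multiset.prod_cons, norm_mul]
      calc _ = (c' * (1 + ‖w‖)) * (c * (1 + ‖w‖) ^ Multiset.card m) := by ring
        _ ≤ _ := mul_le_mul (h2 w hw) (h1 w hw) (by positivity) (norm_nonneg _)
  have hsp : p.Splits := IsAlgClosed.splits p
  obtain ⟨c, hc, h⟩ := hroots p.roots fun a ha haF => hp a haF (Polynomial.isRoot_of_mem_roots ha)
  refine ⟨‖p.leadingCoeff‖ * c, by
    have := norm_pos_iff.2 (Polynomial.leadingCoeff_ne_zero.2 hp0); positivity, fun w hw => ?_⟩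
  rw [hsp.natDegree_eq_card_roots]
  have h1 : p.eval w = p.leadingCoeff * (p.roots.map fun a => w - a).prod :=
    hsp.eval_eq_prod_roots w
  rw [h1, norm_mul, mul_assoc]
  gcongr
  exact h w hw

/-! ### The integral equation near and away from the tip -/

theorem continuous_ofReal_cpow {τ : ℂ} (hτ : 0 < τ.re) : Continuous fun s : ℝ => (s : ℂ) ^ τ :=
  continuous_iff_continuousAt.2 fun s => (continuousAt_ofReal_cpow_const s τ (Or.inl hτ))

/-- The equation `p(w) g(w) + ∫₀¹ [q(sw) + k((1 - s) w)] s ^ (τ - 1) g(sw) ds = 0` on a star-shaped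
domain. The substitution `g = w G' + τ G` turns `s ^ (τ - 1) g(sw)` into the derivative of
`s ^ τ G(sw)`; an integration by parts then removes the singular kernel and leaves an equation
that `exists_volterraOp_solution` solves, because `τ p + q` vanishes at the origin. -/
theorem exists_tip_solution {τ : ℂ} (hτ : 0 < τ.re) {U F : Set ℂ} (hU : IsOpen U)
    (hstar : ∀ w ∈ U, ∀ s ∈ Icc (0 : ℝ) 1, (s : ℂ) * w ∈ U) (hF : IsClosed F) (hUF : U ⊆ F)
    {p q : Polynomial ℂ} (hp0 : p ≠ 0) (hp : ∀ w ∈ F, p.eval w ≠ 0)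
    (hqp : q.natDegree ≤ p.natDegree)
    (hpq : q.eval 0 = -τ * p.eval 0) {k : ℂ → ℂ} (hk : Differentiable ℂ k) (hk0 : k 0 = 0)
    {M B : ℝ} (hM : 0 ≤ M) (hB : 0 ≤ B) (hkb : ∀ x, ‖deriv k x‖ ≤ M * Real.exp (B * ‖x‖)) (g₀ : ℂ) :
    ∃ g : ℂ → ℂ, DifferentiableOn ℂ g U ∧ g 0 = g₀ ∧
      (∃ C L : ℝ, 0 ≤ C ∧ 0 ≤ L ∧ ∀ w ∈ U, ‖g w‖ ≤ C * Real.exp (L * ‖w‖)) ∧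
      ∀ w ∈ U, p.eval w * g w + ∫ s in (0 : ℝ)..1,
        (q.eval (s * w) + k ((1 - s) * w)) * ((s : ℂ) ^ (τ - 1) * g (s * w)) = 0 := by
  have hτ0 : τ ≠ 0 := fun h => by simp [h] at hτ
  obtain ⟨c, hc, hlow⟩ := exists_le_norm_eval hF hp hp0
  set m := (q + Polynomial.C τ * p).divX with hm
  have hqm : q + Polynomial.C τ * p = Polynomial.X * m := by
    rw [hm]
    conv_lhs => rw [← Polynomial.X_mul_divX_add (q + Polynomial.C τ * p)]
    simp [Polynomial.coeff_zero_eq_eval_zero, hpq]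
  have hme : ∀ w : ℂ, w * m.eval w = q.eval w + τ * p.eval w := by
    intro w
    have := congrArg (Polynomial.eval w) hqm
    simpa using this.symm
  have hmdeg : m.natDegree ≤ p.natDegree := by
    rw [hm]
    refine (Polynomial.natDegree_divX_le).trans ?_
    exact (Polynomial.natDegree_add_le _ _).trans (max_le hqp (Polynomial.natDegree_C_mul_le _ _))
  have hq'deg : q.derivative.natDegree ≤ p.natDegree :=
    (Polynomial.natDegree_derivative_le q).trans (by omega)
  obtain ⟨Cm, hCm0, hCm⟩ := exists_norm_eval_le m hmdeg
  obtain ⟨Cq, hCq0, hCq⟩ := exists_norm_eval_le q.derivative hq'deg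
  set a : ℂ → ℂ := fun w => -(m.eval w / p.eval w) with ha
  set κ : ℝ → ℂ → ℂ := fun s w => (p.eval w)⁻¹ * ((s : ℂ) ^ τ *
    (q.derivative.eval (s * w) - deriv k ((1 - s) * w))) with hκ
  have hpU : ∀ w ∈ U, p.eval w ≠ 0 := fun w hw => hp w (hUF hw)
  have hdk : Differentiable ℂ (deriv k) := fun x =>
    (hk.differentiableOn.deriv isOpen_univ).differentiableAt univ_mem
  have hinv : ∀ w ∈ U, ‖(p.eval w)⁻¹‖ ≤ c⁻¹ * ((1 + ‖w‖) ^ p.natDegree)⁻¹ := by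
    intro w hw
    rw [norm_inv, ← mul_inv]
    exact inv_anti₀ (by positivity) (hlow w (hUF hw))
  have hbase : ∀ w : ℂ, 1 ≤ (1 + ‖w‖) ^ p.natDegree := fun w =>
    one_le_pow₀ (by linarith [norm_nonneg w])
  have hab : ∀ w ∈ U, ‖a w‖ ≤ c⁻¹ * (Cm + Cq + M) := by
    intro w hw
    rw [ha]
    simp only [norm_neg, div_eq_mul_inv, norm_mul]
    have h1 := hinv w hw
    have h2 := hCm w
    have h3 := hbase w
    calc _ ≤ Cm * (1 + ‖w‖) ^ p.natDegree * (c⁻¹ * ((1 + ‖w‖) ^ p.natDegree)⁻¹) := by gcongr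
      _ = c⁻¹ * Cm := by field_simp
      _ ≤ _ := by gcongr; linarith
  have hκb : ∀ s ∈ Ioc (0 : ℝ) 1, ∀ w ∈ U,
      ‖κ s w‖ ≤ c⁻¹ * (Cm + Cq + M) * Real.exp (B * (1 - s) * ‖w‖) := by
    intro s hs w hw
    have hs' := Ioc_subset_Icc_self hs
    have h1s := sub_nonneg.2 hs.2
    have hexp : 1 ≤ Real.exp (B * (1 - s) * ‖w‖) := Real.one_le_exp (by positivity)
    have h1 := hinv w hw
    have h3 := hbase w
    have h4 : ‖q.derivative.eval (s * w)‖ ≤ Cq * (1 + ‖w‖) ^ p.natDegree := by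
      refine (hCq _).trans ?_
      gcongr
      rw [norm_ofReal_mul_le hs']
      exact mul_le_of_le_one_left (norm_nonneg _) hs.2
    have h5 : ‖deriv k ((1 - s) * w)‖ ≤ M * Real.exp (B * (1 - s) * ‖w‖) := by
      refine (hkb _).trans_eq ?_
      have : (1 : ℂ) - s = ((1 - s : ℝ) : ℂ) := by push_cast; ring
      rw [this, norm_ofReal_mul_le ⟨h1s, by linarith [hs.1]⟩]
      ring_nf
    have h6 : ‖(s : ℂ) ^ τ‖ ≤ 1 := by
      rw [norm_cpow_eq_rpow_re_of_pos hs.1]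
      exact Real.rpow_le_one hs.1.le hs.2 hτ.le
    rw [hκ]
    simp only [norm_mul]
    have h7 : ‖q.derivative.eval (s * w) - deriv k ((1 - s) * w)‖ ≤
        (Cq + M) * (1 + ‖w‖) ^ p.natDegree * Real.exp (B * (1 - s) * ‖w‖) := by
      refine (norm_sub_le _ _).trans ((add_le_add h4 h5).trans ?_)
      calc _ ≤ Cq * (1 + ‖w‖) ^ p.natDegree * Real.exp (B * (1 - s) * ‖w‖) +
            M * Real.exp (B * (1 - s) * ‖w‖) * (1 + ‖w‖) ^ p.natDegree := by
            refine add_le_add (le_mul_of_one_le_right (by positivity) hexp)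
              (le_mul_of_one_le_right (by positivity) h3)
        _ = _ := by ring
    calc _ ≤ c⁻¹ * ((1 + ‖w‖) ^ p.natDegree)⁻¹ * (1 *
          ((Cq + M) * (1 + ‖w‖) ^ p.natDegree * Real.exp (B * (1 - s) * ‖w‖))) := by gcongr
      _ = c⁻¹ * (Cq + M) * Real.exp (B * (1 - s) * ‖w‖) := by field_simp
      _ ≤ _ := by gcongr; linarith
  obtain ⟨G, hG', hG0, C, L, hC0, hL0, hCL⟩ := exists_volterraOp_solution hU hstar (a := a) (κ := κ)
    (by positivity) ((m.differentiable.differentiableOn).div p.differentiable.differentiableOn hpU).neg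
    hab (fun s _ => (p.differentiable.differentiableOn.inv hpU).mul
      (((q.derivative.differentiable.comp (by fun_prop)).sub
        (hdk.comp (by fun_prop))).const_mul _).differentiableOn)
    (fun w _ => (continuous_const.mul ((continuous_ofReal_cpow hτ).mul
      ((q.derivative.continuous.comp (by fun_prop)).sub
        (hdk.continuous.comp (by fun_prop))))).continuousOn)
    hκb (g₀ / τ)
  have hGd : DifferentiableOn ℂ G U := fun w hw =>
    (hG' w hw).differentiableAt.differentiableWithinAt
  have hGdd : DifferentiableOn ℂ (deriv G) U := hGd.deriv hU
  set g : ℂ → ℂ := fun w => w * deriv G w + τ * G w with hg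
  have hgd : DifferentiableOn ℂ g U := (differentiableOn_id.mul hGdd).add (hGd.const_mul τ)
  refine ⟨g, hgd, ?_, ⟨(1 + ‖τ‖) * C, L + 1, by positivity, by positivity, fun w hw => ?_⟩,
    fun w hw => ?_⟩
  · simp only [hg, zero_mul, zero_add, hG0]; field_simp
  · obtain ⟨h1, h2⟩ := hCL w hw
    rw [← (hG' w hw).deriv] at h2
    have h3 : ‖w‖ ≤ Real.exp ‖w‖ := by linarith [Real.add_one_le_exp ‖w‖]
    have h4 : 1 ≤ Real.exp ‖w‖ := Real.one_le_exp (norm_nonneg _)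
    calc _ ≤ ‖w * deriv G w‖ + ‖τ * G w‖ := norm_add_le _ _
      _ = ‖w‖ * ‖deriv G w‖ + ‖τ‖ * ‖G w‖ := by rw [norm_mul, norm_mul]
      _ ≤ Real.exp ‖w‖ * (C * Real.exp (L * ‖w‖)) +
          ‖τ‖ * (C * Real.exp (L * ‖w‖) * Real.exp ‖w‖) := by
          gcongr
          exact h1.trans (le_mul_of_one_le_right (by positivity) h4)
      _ = (1 + ‖τ‖) * C * (Real.exp (L * ‖w‖) * Real.exp ‖w‖) := by ring
      _ = _ := by rw [← Real.exp_add]; ring_nf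
  · -- integration by parts
    have hseg : ∀ s ∈ Icc (0 : ℝ) 1, (s : ℂ) * w ∈ U := hstar w hw
    have hu : ∀ s : ℝ, HasDerivAt (fun s : ℝ => q.eval (s * w) + k ((1 - s) * w))
        (w * (q.derivative.eval (s * w) - deriv k ((1 - s) * w))) s := by
      intro s
      have h1 : HasDerivAt (fun y : ℝ => (y : ℂ) * w) w s := by
        simpa using ((hasDerivAt_id (s : ℂ)).mul_const w).comp_ofReal
      have h2 : HasDerivAt (fun y : ℝ => (1 - (y : ℂ)) * w) (-w) s := by
        simpa using (((hasDerivAt_id (s : ℂ)).const_sub 1).mul_const w).comp_ofReal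
      have h3 := (q.hasDerivAt (s * w)).comp s h1
      have h4 := (hk ((1 - s) * w)).hasDerivAt.comp s h2
      refine (h3.add h4).congr_deriv ?_
      ring
    have hGc : ContinuousOn (fun s : ℝ => G (s * w)) (Icc 0 1) :=
      hGd.continuousOn.comp (by fun_prop) hseg
    have hgc : ContinuousOn (fun s : ℝ => g (s * w)) (Icc 0 1) :=
      hgd.continuousOn.comp (by fun_prop) hseg
    have hv : ∀ s ∈ Ioo (0 : ℝ) 1, HasDerivAt (fun s : ℝ => (s : ℂ) ^ τ * G (s * w))
        ((s : ℂ) ^ (τ - 1) * g (s * w)) s := by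
      intro s hs
      have h1 : HasDerivAt (fun y : ℝ => (y : ℂ) * w) w s := by
        simpa using ((hasDerivAt_id (s : ℂ)).mul_const w).comp_ofReal
      have hmem := hseg s (Ioo_subset_Icc_self hs)
      have h2 := ((hGd.differentiableAt (hU.mem_nhds hmem)).hasDerivAt).comp s h1
      have h3 := hasDerivAt_ofReal_cpow_const (x := s) hs.1.ne' hτ0
      refine (h3.mul h2).congr_deriv ?_
      have h4 : (s : ℂ) ^ τ = (s : ℂ) ^ (τ - 1) * s := by
        have hs0 : (s : ℂ) ≠ 0 := ofReal_ne_zero.2 hs.1.ne'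
        rw [cpow_sub _ _ hs0, cpow_one, div_mul_cancel₀ _ hs0]
      simp only [Function.comp, hg, h4]
      ring
    have hvint : IntervalIntegrable (fun s : ℝ => (s : ℂ) ^ (τ - 1) * g (s * w)) volume 0 1 := by
      refine (intervalIntegral.intervalIntegrable_cpow' ?_).mul_continuousOn ?_
      · simp; linarith
      · rw [uIcc_of_le zero_le_one]; exact hgc
    have hparts := intervalIntegral.integral_mul_deriv_eq_deriv_mul_of_hasDerivAt (a := 0) (b := 1)
      (u := fun s : ℝ => q.eval (s * w) + k ((1 - s) * w))
      (v := fun s : ℝ => (s : ℂ) ^ τ * G (s * w))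
      (fun s _ => (hu s).continuousAt.continuousWithinAt)
      (by rw [uIcc_of_le zero_le_one]; exact (continuous_ofReal_cpow hτ).continuousOn.mul hGc)
      (fun s _ => hu s) (fun s hs => hv s (by simpa using hs))
      (Continuous.intervalIntegrable (continuous_const.mul
        ((q.derivative.continuous.comp (by fun_prop)).sub (hdk.continuous.comp (by fun_prop)))) _ _)
      hvint
    rw [hparts]
    have hGw := (hG' w hw).deriv
    have hint : p.eval w * (∫ s in (0 : ℝ)..1, κ s w * G (s * w)) * w =
        ∫ s in (0 : ℝ)..1, w * (q.derivative.eval (s * w) - deriv k ((1 - s) * w)) *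
          ((s : ℂ) ^ τ * G (s * w)) := by
      rw [← intervalIntegral.integral_const_mul, ← intervalIntegral.integral_mul_const]
      refine intervalIntegral.integral_congr fun s _ => ?_
      simp only [hκ]
      have := hpU w hw
      field_simp
    rw [← hint]
    simp only [hg, hGw, volterraOp, ofReal_one, one_mul, sub_self, zero_mul, hk0, add_zero,
      one_cpow, ofReal_zero, zero_cpow hτ0, sub_zero, ha]
    have h8 := hme w
    have h9 := hpU w hw
    field_simp
    linear_combination (-G w) * h8

/-! ### The convolution kernel -/

/-- The entire function `∑ r_j x ^ (j + 1) / (j + 1)!`: convolution with it is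
`∂⁻² ∘ (∑ r_j ∂^{-j})`. -/
def borelKernel (r : ℕ → ℂ) (x : ℂ) : ℂ := ∑' j : ℕ, r j * (x ^ (j + 1) / (j + 1).factorial)

theorem hasSum_exp_real (x : ℝ) : HasSum (fun j : ℕ => x ^ j / j.factorial) (Real.exp x) := by
  rw [Real.exp_eq_exp_ℝ]
  exact NormedSpace.expSeries_div_hasSum_exp x

section kernel

variable {r : ℕ → ℂ} {S L : ℝ}

theorem norm_borelKernel_term_le (hr : ∀ j, ‖r j‖ ≤ S * L ^ j) (j : ℕ) (x : ℂ) :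
    ‖r j * (x ^ (j + 1) / (j + 1).factorial)‖ ≤ S * ‖x‖ * ((L * ‖x‖) ^ j / j.factorial) := by
  have h0 := (norm_nonneg _).trans (hr j)
  rw [norm_mul, norm_div, norm_pow, Complex.norm_natCast]
  calc _ ≤ S * L ^ j * (‖x‖ ^ (j + 1) / j.factorial) := by
        gcongr
        · exact hr j
        · omega
    _ = _ := by rw [mul_pow]; ring

theorem hasSum_borelKernel (hr : ∀ j, ‖r j‖ ≤ S * L ^ j) (x : ℂ) :
    HasSum (fun j : ℕ => r j * (x ^ (j + 1) / (j + 1).factorial)) (borelKernel r x) :=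
  (Summable.of_norm_bounded ((hasSum_exp_real (L * ‖x‖)).summable.mul_left _)
    (norm_borelKernel_term_le hr · x)).hasSum

theorem norm_borelKernel_le (hr : ∀ j, ‖r j‖ ≤ S * L ^ j) (x : ℂ) :
    ‖borelKernel r x‖ ≤ S * ‖x‖ * Real.exp (L * ‖x‖) :=
  tsum_of_norm_bounded ((hasSum_exp_real (L * ‖x‖)).mul_left _) (norm_borelKernel_term_le hr · x)

theorem norm_borelKernel_deriv_term_le (hr : ∀ j, ‖r j‖ ≤ S * L ^ j) (j : ℕ) (x : ℂ) :
    ‖r j * (x ^ j / j.factorial)‖ ≤ S * ((L * ‖x‖) ^ j / j.factorial) := by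
  have h0 := (norm_nonneg _).trans (hr j)
  rw [norm_mul, norm_div, norm_pow, Complex.norm_natCast]
  calc _ ≤ S * L ^ j * (‖x‖ ^ j / j.factorial) := by
        gcongr
        exact hr j
    _ = _ := by rw [mul_pow]; ring

theorem hasDerivAt_borelKernel (hS : 0 ≤ S) (hL : 0 ≤ L) (hr : ∀ j, ‖r j‖ ≤ S * L ^ j) (x : ℂ) :
    HasDerivAt (borelKernel r) (∑' j : ℕ, r j * (x ^ j / j.factorial)) x := by
  refine hasDerivAt_tsum_of_isPreconnected
    (u := fun j : ℕ => S * ((L * (‖x‖ + 1)) ^ j / j.factorial)) (t := Metric.ball 0 (‖x‖ + 1))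
    ((hasSum_exp_real (L * (‖x‖ + 1))).summable.mul_left S) Metric.isOpen_ball
    (convex_ball _ _).isPreconnected (g := fun j (x : ℂ) => r j * (x ^ (j + 1) / (j + 1).factorial))
    (g' := fun j (x : ℂ) => r j * (x ^ j / j.factorial)) (y₀ := x) (fun j y _ => ?_)
    (fun j y hy => ?_) (by simp) (hasSum_borelKernel hr x).summable (by simp)
  · refine (((hasDerivAt_pow (j + 1) y).div_const _).const_mul (r j)).congr_deriv ?_
    rw [Nat.factorial_succ]
    have h1 : (j.factorial : ℂ) ≠ 0 := by exact_mod_cast j.factorial_ne_zero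
    have h2 : (j : ℂ) + 1 ≠ 0 := by exact_mod_cast j.succ_ne_zero
    push_cast
    field_simp
  · refine (norm_borelKernel_deriv_term_le hr j y).trans ?_
    have := (mem_ball_zero_iff.1 hy).le
    gcongr

theorem norm_deriv_borelKernel_le (hS : 0 ≤ S) (hL : 0 ≤ L) (hr : ∀ j, ‖r j‖ ≤ S * L ^ j) (x : ℂ) :
    ‖deriv (borelKernel r) x‖ ≤ S * Real.exp (L * ‖x‖) := by
  rw [(hasDerivAt_borelKernel hS hL hr x).deriv]
  exact tsum_of_norm_bounded ((hasSum_exp_real (L * ‖x‖)).mul_left _)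
    (norm_borelKernel_deriv_term_le hr · x)

theorem borelKernel_zero (r : ℕ → ℂ) : borelKernel r 0 = 0 := by simp [borelKernel]

end kernel

theorem exists_norm_taylorCoeff_le {R : ℂ → ℂ} {A L : ℝ} (hA : 0 < A)
    (hR : DifferentiableOn ℂ R (Metric.ball 0 A⁻¹)) (hL : A < L) :
    ∃ S : ℝ, 0 ≤ S ∧ ∀ j, ‖taylorCoeff R j‖ ≤ S * L ^ j := by
  have hL0 : 0 < L := hA.trans hL
  have hs := summable_norm_taylorCoeff hA hR hL
  refine ⟨∑' j, ‖taylorCoeff R j‖ * L⁻¹ ^ j, tsum_nonneg fun j => by positivity, fun j => ?_⟩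
  have := hs.le_tsum j fun i _ => by positivity
  rw [inv_pow, ← div_eq_mul_inv, div_le_iff₀ (by positivity)] at this
  exact this

/-! ### The domain of the Borel transform -/

theorem mem_sector_zero_iff {θ₀ ω : ℝ} (hω' : ω ≤ Real.pi / 2) {w : ℂ} :
    w ∈ sector 0 θ₀ ω ↔ exp (-(θ₀ * I)) * w ∈ slitPlane ∧ |arg (exp (-(θ₀ * I)) * w)| < ω := by
  have hpi := Real.pi_pos
  constructor
  · rintro ⟨r, θ, hr, hθ, rfl⟩
    have h1 : exp (-(θ₀ * I)) * (0 + r * exp (θ * I)) = r * exp ((θ - θ₀ : ℝ) * I) := by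
      rw [zero_add, mul_left_comm, ← Complex.exp_add]; push_cast; ring_nf
    have h2 := abs_lt.1 hθ
    have h3 : arg (r * exp ((θ - θ₀ : ℝ) * I)) = θ - θ₀ := by
      rw [exp_mul_I]
      exact arg_mul_cos_add_sin_mul_I hr ⟨by linarith, by linarith⟩
    rw [h1, mem_slitPlane_iff_arg, h3]
    exact ⟨⟨by linarith, mul_ne_zero (ofReal_ne_zero.2 hr.ne') (Complex.exp_ne_zero _)⟩, hθ⟩
  · rintro ⟨h1, h2⟩
    set v := exp (-(θ₀ * I)) * w with hv
    have hv0 : v ≠ 0 := slitPlane_ne_zero h1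
    refine ⟨‖v‖, θ₀ + arg v, norm_pos_iff.2 hv0, by simpa using h2, ?_⟩
    have : w = exp (θ₀ * I) * v := by
      rw [hv, ← mul_assoc, ← Complex.exp_add, add_neg_cancel, Complex.exp_zero, one_mul]
    rw [this, zero_add]
    conv_lhs => rw [← norm_mul_exp_arg_mul_I v]
    rw [mul_left_comm, ← Complex.exp_add]
    push_cast
    ring_nf

theorem isOpen_sector_zero {θ₀ ω : ℝ} (hω' : ω ≤ Real.pi / 2) : IsOpen (sector 0 θ₀ ω) := by
  have h1 : sector 0 θ₀ ω = (fun w => exp (-(θ₀ * I)) * w) ⁻¹'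
      (slitPlane ∩ (fun v => |arg v|) ⁻¹' Iio ω) := by
    ext w; exact mem_sector_zero_iff hω'
  rw [h1]
  refine IsOpen.preimage (by fun_prop) ?_
  refine ContinuousOn.isOpen_inter_preimage (fun v hv => ?_) isOpen_slitPlane isOpen_Iio
  exact (continuousAt_arg hv).abs.continuousWithinAt

theorem sub_mem_sector_zero {α ζ : ℂ} {θ₀ ω : ℝ} : ζ - α ∈ sector 0 θ₀ ω ↔ ζ ∈ sector α θ₀ ω := by
  constructor
  · rintro ⟨r, θ, hr, hθ, h⟩
    exact ⟨r, θ, hr, hθ, by rw [zero_add] at h; rw [← h]; ring⟩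
  · rintro ⟨r, θ, hr, hθ, rfl⟩
    exact ⟨r, θ, hr, hθ, by ring⟩

theorem ofReal_mul_mem_sector_zero {θ₀ ω : ℝ} {w : ℂ} (hw : w ∈ sector 0 θ₀ ω) {s : ℝ} (hs : 0 < s) :
    (s : ℂ) * w ∈ sector 0 θ₀ ω := by
  obtain ⟨r, θ, hr, hθ, rfl⟩ := hw
  exact ⟨s * r, θ, mul_pos hs hr, hθ, by push_cast; ring⟩

theorem ne_zero_of_mem_sector_zero {θ₀ ω : ℝ} {w : ℂ} (hw : w ∈ sector 0 θ₀ ω) : w ≠ 0 := by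
  obtain ⟨r, θ, hr, hθ, rfl⟩ := hw
  simp [hr.ne', Complex.exp_ne_zero]

/-- The union of the sector with a disc around its tip. -/
def tipDomain (θ₀ ω ρ : ℝ) : Set ℂ := Metric.ball 0 ρ ∪ sector 0 θ₀ ω

theorem isOpen_tipDomain {θ₀ ω ρ : ℝ} (hω' : ω ≤ Real.pi / 2) : IsOpen (tipDomain θ₀ ω ρ) :=
  Metric.isOpen_ball.union (isOpen_sector_zero hω')

theorem tipDomain_star {θ₀ ω ρ : ℝ} (hρ : 0 < ρ) :
    ∀ w ∈ tipDomain θ₀ ω ρ, ∀ s ∈ Icc (0 : ℝ) 1, (s : ℂ) * w ∈ tipDomain θ₀ ω ρ := by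
  rintro w hw s hs
  rcases hs.1.eq_or_lt with h | h
  · left; rw [← h]; simpa using hρ
  rcases hw with hw | hw
  · left
    rw [mem_ball_zero_iff] at hw ⊢
    rw [norm_ofReal_mul_le hs]
    exact (mul_le_of_le_one_left (norm_nonneg _) hs.2).trans_lt hw
  · exact Or.inr (ofReal_mul_mem_sector_zero hw h)

/-- The Borel transform of the formal solution, divided by `(ζ - α) ^ (τ - 1)`, as a function `g` of
`w = ζ - α`. It is holomorphic on the sector and in a disc around the tip, and the integral
equation on the segment from `0` to `w` is written in terms of `s ↦ s w`. -/
theorem exists_tip_function {P Q : Polynomial ℂ} (hP : P.Monic)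
    (hPsimple : ∀ r : ℂ, P.IsRoot r → P.rootMultiplicity r = 1)
    (hQdeg : Q.natDegree + 1 = P.natDegree)
    {R : ℂ → ℂ} {A : ℝ} (hA : 0 < A) (hR : DifferentiableOn ℂ R (Metric.ball 0 A⁻¹))
    {α : ℂ} (hα : P.IsRoot (-α)) (hτ : 0 < (tauOf P Q α).re)
    {θ₀ ω : ℝ} (hω' : ω ≤ Real.pi / 2)
    (hsector : ∀ β : ℂ, β ≠ α → P.IsRoot (-β) → β ∉ closure (sector α θ₀ ω)) :
    ∃ ρ > 0, ∃ g : ℂ → ℂ, DifferentiableOn ℂ g (tipDomain θ₀ ω ρ) ∧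
      g 0 = (Gamma (tauOf P Q α))⁻¹ ∧
      (∃ C L : ℝ, 0 ≤ C ∧ 0 ≤ L ∧ ∀ w ∈ tipDomain θ₀ ω ρ, ‖g w‖ ≤ C * Real.exp (L * ‖w‖)) ∧
      ∀ w ∈ tipDomain θ₀ ω ρ, P.eval (-(α + w)) * g w + w * ∫ s in (0 : ℝ)..1,
        (Q.eval (-(α + s * w)) + borelKernel (taylorCoeff R) ((1 - s) * w)) *
          ((s : ℂ) ^ (tauOf P Q α - 1) * g (s * w)) = 0 := by
  set τ := tauOf P Q α with hτdef
  set l : Polynomial ℂ := -(Polynomial.X + Polynomial.C α) with hl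
  have hldeg : l.natDegree = 1 := by rw [hl, Polynomial.natDegree_neg, Polynomial.natDegree_X_add_C]
  set p := (P.comp l).divX with hp
  have hle : ∀ w : ℂ, l.eval w = -(α + w) := fun w => by simp [hl, add_comm]
  have hPl : P.comp l = Polynomial.X * p := by
    rw [hp]
    conv_lhs => rw [← Polynomial.X_mul_divX_add (P.comp l)]
    rw [Polynomial.coeff_zero_eq_eval_zero, Polynomial.eval_comp, hle, add_zero,
      Polynomial.IsRoot.def.1 hα, map_zero, add_zero]
  have hPe : ∀ w : ℂ, P.eval (-(α + w)) = w * p.eval w := by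
    intro w
    have := congrArg (Polynomial.eval w) hPl
    simpa [Polynomial.eval_comp, hle] using this
  have hp0 : p.eval 0 = -P.derivative.eval (-α) := by
    have := congrArg (fun f => (Polynomial.derivative f).eval 0) hPl
    simp [Polynomial.derivative_comp, Polynomial.eval_comp, hl] at this
    exact this.symm
  have hP' := derivative_eval_ne_zero_of_simple hP hPsimple hα
  have hp0ne : p.eval 0 ≠ 0 := by rw [hp0]; exact neg_ne_zero.2 hP'
  have hpne : p ≠ 0 := fun h => hp0ne (by rw [h]; simp)
  have hqp : (Q.comp l).natDegree ≤ p.natDegree := by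
    rw [hp, Polynomial.natDegree_divX_eq_natDegree_tsub_one, Polynomial.natDegree_comp,
      Polynomial.natDegree_comp, hldeg]
    omega
  have hpq : (Q.comp l).eval 0 = -τ * p.eval 0 := by
    rw [hp0, Polynomial.eval_comp, hle, add_zero, hτdef, tauOf]
    field_simp
  -- `p` has no zeros near the tip
  obtain ⟨ρ, hρ, hball⟩ : ∃ ρ > 0, ∀ w ∈ Metric.closedBall (0 : ℂ) ρ, p.eval w ≠ 0 := by
    have := p.continuous.continuousAt.eventually_ne hp0ne
    exact Metric.nhds_basis_closedBall.eventually_iff.1 this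
  obtain ⟨S, hS0, hS⟩ := exists_norm_taylorCoeff_le hA hR (by linarith : A < A + 1)
  have hk : Differentiable ℂ (borelKernel (taylorCoeff R)) := fun x =>
    (hasDerivAt_borelKernel hS0 (by linarith) hS x).differentiableAt
  have hF : ∀ w ∈ Metric.closedBall (0 : ℂ) ρ ∪ closure (sector 0 θ₀ ω), p.eval w ≠ 0 := by
    rintro w (hw | hw) h
    · exact hball w hw h
    · have hw0 : w ≠ 0 := fun h0 => by rw [h0] at h; exact hp0ne h
      refine hsector (α + w) (by simpa using hw0) ?_ ?_
      · rw [Polynomial.IsRoot.def, hPe, h, mul_zero]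
      · have h1 : MapsTo (fun w => α + w) (sector 0 θ₀ ω) (sector α θ₀ ω) := fun v hv => by
          have : α + v - α ∈ sector 0 θ₀ ω := by simpa using hv
          exact sub_mem_sector_zero.1 this
        exact h1.closure (by fun_prop) hw
  obtain ⟨g, hgd, hg0, hgb, hg⟩ := exists_tip_solution (τ := τ) hτ (U := tipDomain θ₀ ω ρ)
    (isOpen_tipDomain hω') (tipDomain_star hρ) (Metric.isClosed_closedBall.union isClosed_closure)
    (union_subset_union Metric.ball_subset_closedBall subset_closure) hpne hF hqp hpq hk
    (borelKernel_zero _) hS0 (by linarith) (norm_deriv_borelKernel_le hS0 (by linarith) hS)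
    (Gamma τ)⁻¹
  refine ⟨ρ, hρ, g, hgd, hg0, hgb, fun w hw => ?_⟩
  have h1 := hg w hw
  simp only [Polynomial.eval_comp, hle] at h1
  rw [hPe, mul_assoc, ← mul_add, h1, mul_zero]

/-! ### Branches of powers -/

theorem exp_neg_angle_mul_ne_zero (θ : ℝ) {w : ℂ} (hw : w ≠ 0) : exp (-(θ * I)) * w ≠ 0 :=
  mul_ne_zero (Complex.exp_ne_zero _) hw

theorem norm_exp_neg_angle_mul (θ : ℝ) (w : ℂ) : ‖exp (-(θ * I)) * w‖ = ‖w‖ := by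
  rw [norm_mul, show -((θ : ℂ) * I) = ((-θ : ℝ) : ℂ) * I by push_cast; ring, norm_exp_angle, one_mul]

theorem branchPow_ofReal_mul (θ : ℝ) (s : ℂ) {x : ℝ} (hx : 0 < x) {w : ℂ} (hw : w ≠ 0) :
    branchPow θ s (x * w) = (x : ℂ) ^ s * branchPow θ s w := by
  unfold branchPow
  rw [mul_left_comm, log_ofReal_mul hx (exp_neg_angle_mul_ne_zero θ hw),
    cpow_def_of_ne_zero (ofReal_ne_zero.2 hx.ne'), ← Complex.exp_add, ofReal_log hx.le]
  ring_nf

theorem norm_branchPow_le (θ : ℝ) (s : ℂ) {w : ℂ} (hw : w ≠ 0) :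
    ‖branchPow θ s w‖ ≤ Real.exp (|s.im| * (|θ| + Real.pi)) * ‖w‖ ^ s.re := by
  unfold branchPow
  set v := exp (-(θ * I)) * w with hv
  have hvn : ‖v‖ = ‖w‖ := norm_exp_neg_angle_mul θ w
  rw [norm_exp]
  have h1 : (s * (log v + θ * I)).re = s.re * Real.log ‖w‖ - s.im * (arg v + θ) := by
    simp [mul_re, log_re, log_im, hvn]
  rw [h1, Real.rpow_def_of_pos (norm_pos_iff.2 hw), ← Real.exp_add]
  gcongr
  have h2 : |arg v + θ| ≤ |θ| + Real.pi := by
    have := abs_add_le (arg v) θ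
    have := abs_arg_le_pi v
    linarith
  have h3 : -(s.im * (arg v + θ)) ≤ |s.im| * (|θ| + Real.pi) := by
    calc _ ≤ |s.im * (arg v + θ)| := neg_le_abs _
      _ = |s.im| * |arg v + θ| := abs_mul _ _
      _ ≤ _ := by gcongr
  linarith

theorem differentiableAt_branchPow {θ : ℝ} (s : ℂ) {w : ℂ} (hw : exp (-(θ * I)) * w ∈ slitPlane) :
    DifferentiableAt ℂ (branchPow θ s) w := by
  unfold branchPow
  have h1 : DifferentiableAt ℂ (fun w => exp (-(θ * I)) * w) w := by fun_prop
  exact (((h1.clog hw).add_const _).const_mul s).cexp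

theorem branchPow_ray {θ₀ θ : ℝ} (h : |θ - θ₀| < Real.pi) (s : ℂ) :
    branchPow θ₀ s (exp (θ * I)) = exp (s * (θ * I)) := by
  unfold branchPow
  have h1 := abs_lt.1 h
  have h2 : exp (-(θ₀ * I)) * exp (θ * I) = exp ((θ - θ₀ : ℝ) * I) := by
    rw [← Complex.exp_add]; push_cast; ring_nf
  rw [h2, log_exp (by simp; linarith) (by simp; linarith)]
  push_cast
  ring_nf

/-! ### Laplace integrals along rays -/

theorem HasExpType.mono {α : ℂ} {s Λ Λ' : ℝ} {Ω : Set ℂ} {φ : ℂ → ℂ} (h : Λ ≤ Λ')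
    (hφ : HasExpType α s Λ Ω φ) : HasExpType α s Λ' Ω φ := by
  obtain ⟨hd, C, hC⟩ := hφ
  refine ⟨hd, |C|, fun ζ hζ => (hC ζ hζ).trans ?_⟩
  have := Real.rpow_nonneg (norm_nonneg (ζ - α)) s
  gcongr
  exact le_abs_self C

theorem integrableOn_rpow_mul_exp {s b : ℝ} (hs : -1 < s) (hb : 0 < b) :
    IntegrableOn (fun t : ℝ => t ^ s * Real.exp (-b * t)) (Ioi 0) := by
  simpa using integrableOn_rpow_mul_exp_neg_mul_rpow hs one_pos hb

/-- The Laplace integral along the half-line through `α` with direction vector `l`. -/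
def rayLaplace (α : ℂ) (φ : ℂ → ℂ) (z l : ℂ) : ℂ :=
  ∫ t in Ioi (0 : ℝ), exp (-z * (α + t * l)) * φ (α + t * l) * l

theorem laplace_eq_rayLaplace (α : ℂ) (θ : ℝ) (φ : ℂ → ℂ) (z : ℂ) :
    laplace α θ φ z = rayLaplace α φ z (exp (θ * I)) := rfl

theorem norm_ray_integrand_le {α : ℂ} {s Λ θ₀ ω C : ℝ} {φ : ℂ → ℂ}
    (hC : ∀ ζ ∈ sector α θ₀ ω, ‖φ ζ‖ ≤ C * ‖ζ - α‖ ^ s * Real.exp (Λ * ‖ζ - α‖)) (z : ℂ) {l : ℂ}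
    (hl : l ∈ sector 0 θ₀ ω) {t : ℝ} (ht : 0 < t) :
    ‖exp (-z * (α + t * l)) * φ (α + t * l) * l‖ ≤ Real.exp (-(z * α).re) * C * ‖l‖ ^ (s + 1) *
      (t ^ s * Real.exp (-((l * z).re - Λ * ‖l‖) * t)) := by
  have hl0 : 0 < ‖l‖ := norm_pos_iff.2 (ne_zero_of_mem_sector_zero hl)
  have hmem : α + t * l ∈ sector α θ₀ ω := by
    rw [← sub_mem_sector_zero, add_sub_cancel_left]; exact ofReal_mul_mem_sector_zero hl ht
  have h1 := hC _ hmem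
  rw [add_sub_cancel_left, norm_mul, norm_real, Real.norm_of_nonneg ht.le] at h1
  rw [norm_mul, norm_mul, norm_exp]
  have h2 : (-z * (α + t * l)).re = -(z * α).re + -(l * z).re * t := by
    simp [mul_re]; ring
  rw [h2, Real.exp_add]
  calc _ ≤ Real.exp (-(z * α).re) * Real.exp (-(l * z).re * t) *
        (C * (t * ‖l‖) ^ s * Real.exp (Λ * (t * ‖l‖))) * ‖l‖ := by gcongr
    _ = Real.exp (-(z * α).re) * C * (‖l‖ ^ s * ‖l‖) * (t ^ s *
        (Real.exp (-(l * z).re * t) * Real.exp (Λ * (t * ‖l‖)))) := by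
        rw [Real.mul_rpow ht.le hl0.le]; ring
    _ = _ := by
        rw [Real.rpow_add hl0, Real.rpow_one, ← Real.exp_add]; ring_nf

theorem continuousOn_ray_integrand {α : ℂ} {θ₀ ω : ℝ} {φ : ℂ → ℂ}
    (hφ : DifferentiableOn ℂ φ (sector α θ₀ ω)) (z : ℂ) {l : ℂ} (hl : l ∈ sector 0 θ₀ ω) :
    ContinuousOn (fun t : ℝ => exp (-z * (α + t * l)) * φ (α + t * l) * l) (Ioi 0) := by
  refine ((Continuous.continuousOn (by fun_prop)).mul (hφ.continuousOn.comp
    (Continuous.continuousOn (by fun_prop)) fun t ht => ?_)).mul continuousOn_const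
  rw [← sub_mem_sector_zero, add_sub_cancel_left]
  exact ofReal_mul_mem_sector_zero hl ht

theorem integrableOn_ray_integrand {α : ℂ} {s Λ θ₀ ω : ℝ} (hs : -1 < s) {φ : ℂ → ℂ}
    (hφ : HasExpType α s Λ (sector α θ₀ ω) φ) {z l : ℂ} (hl : l ∈ sector 0 θ₀ ω)
    (hz : Λ * ‖l‖ < (l * z).re) :
    IntegrableOn (fun t : ℝ => exp (-z * (α + t * l)) * φ (α + t * l) * l) (Ioi 0) := by
  obtain ⟨hd, C, hC⟩ := hφ
  refine ((integrableOn_rpow_mul_exp hs (sub_pos.2 hz)).const_mul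
    (Real.exp (-(z * α).re) * C * ‖l‖ ^ (s + 1))).mono'
    ((continuousOn_ray_integrand hd z hl).aestronglyMeasurable measurableSet_Ioi) ?_
  filter_upwards [ae_restrict_mem measurableSet_Ioi] with t ht
  exact norm_ray_integrand_le hC z hl ht

theorem exp_mem_sector_zero {θ₀ ω θ : ℝ} (hθ : |θ - θ₀| < ω) : exp (θ * I) ∈ sector 0 θ₀ ω :=
  ⟨1, θ, one_pos, hθ, by simp⟩

theorem HasExpType.integrableOn_laplaceIntegrand {α : ℂ} {s Λ θ₀ ω : ℝ} (hs : -1 < s) {φ : ℂ → ℂ}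
    (hφ : HasExpType α s Λ (sector α θ₀ ω) φ) {θ : ℝ} (hθ : |θ - θ₀| < ω) {z : ℂ}
    (hz : z ∈ halfPlane θ Λ) : IntegrableOn (laplaceIntegrand α θ φ z) (Ioi 0) :=
  integrableOn_ray_integrand hs hφ (exp_mem_sector_zero hθ) (by
    rw [norm_exp_angle, mul_one]; exact hz)

/-- Between two directions `θ₁ ≤ θ₂` that differ by less than `π`, the half-plane of an intermediate
direction contains the intersection of the two half-planes. -/
theorem mem_halfPlane_of_between {θ₁ θ₂ θ Λ : ℝ} (hΛ : 0 ≤ Λ) (h12 : θ₂ - θ₁ < Real.pi)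
    (h1 : θ₁ ≤ θ) (h2 : θ ≤ θ₂) {z : ℂ} (hz₁ : z ∈ halfPlane θ₁ Λ) (hz₂ : z ∈ halfPlane θ₂ Λ) :
    z ∈ halfPlane θ Λ := by
  rcases h1.eq_or_lt with rfl | h1
  · exact hz₁
  rcases h2.eq_or_lt with rfl | h2
  · exact hz₂
  change Λ < _ at hz₁ hz₂ ⊢
  have e1 := re_exp_mul_rotate θ (θ₁ - θ) z
  have e2 := re_exp_mul_rotate θ (θ₂ - θ) z
  rw [add_sub_cancel] at e1 e2
  rw [e1] at hz₁
  rw [e2] at hz₂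
  have hs1 : Real.sin (θ₁ - θ) = -Real.sin (θ - θ₁) := by rw [← Real.sin_neg, neg_sub]
  have hc1 : Real.cos (θ₁ - θ) = Real.cos (θ - θ₁) := by rw [← Real.cos_neg, neg_sub]
  rw [hs1, hc1] at hz₁
  set a := θ - θ₁ with ha
  set b := θ₂ - θ with hb
  have hsa : 0 < Real.sin a := Real.sin_pos_of_pos_of_lt_pi (by linarith) (by linarith)
  have hsb : 0 < Real.sin b := Real.sin_pos_of_pos_of_lt_pi (by linarith) (by linarith)
  have hsab : 0 < Real.sin (a + b) := Real.sin_pos_of_pos_of_lt_pi (by linarith) (by linarith)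
  set X := (exp (θ * I) * z).re
  set Y := (exp (θ * I) * z).im
  have h3 : Λ * (Real.sin a + Real.sin b) < X * Real.sin (a + b) := by
    rw [Real.sin_add]
    nlinarith
  have h4 : Real.sin (a + b) ≤ Real.sin a + Real.sin b := by
    rw [Real.sin_add]
    nlinarith [Real.cos_le_one a, Real.cos_le_one b]
  have h5 : Λ * Real.sin (a + b) < X * Real.sin (a + b) :=
    lt_of_le_of_lt (mul_le_mul_of_nonneg_left h4 hΛ) h3
  exact lt_of_mul_lt_mul_right h5 hsab.le

/-- Homogeneity of degree `0` in the direction vector: rescaling it reparametrizes the same ray. -/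
theorem rayLaplace_ofReal_mul (α : ℂ) (φ : ℂ → ℂ) (z l : ℂ) {x : ℝ} (hx : 0 < x) :
    rayLaplace α φ z (x * l) = rayLaplace α φ z l := by
  unfold rayLaplace
  have := integral_comp_mul_left_Ioi (fun t : ℝ => exp (-z * (α + t * l)) * φ (α + t * l) * l) 0 hx
  rw [mul_zero] at this
  have h2 : ∀ t : ℝ, exp (-z * (α + t * (x * l))) * φ (α + t * (x * l)) * (x * l) =
      (x : ℂ) * (exp (-z * (α + ((x * t : ℝ) : ℂ) * l)) * φ (α + ((x * t : ℝ) : ℂ) * l) * l) := by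
    intro t
    have : (t : ℂ) * (x * l) = ((x * t : ℝ) : ℂ) * l := by push_cast; ring
    rw [this]; ring
  simp_rw [h2]
  rw [integral_const_mul, this, ← real_smul, smul_smul, mul_inv_cancel₀ hx.ne', one_smul]

/-- The Laplace integral does not depend on the direction of the ray: as a function of the
direction vector it is holomorphic and homogeneous of degree `0`, so its derivative vanishes. -/
theorem laplace_eq_of_mem_halfPlane {α : ℂ} {s Λ θ₀ ω : ℝ} (hω' : ω ≤ Real.pi / 2) (hs : -1 < s)
    (hΛ : 0 ≤ Λ) {φ : ℂ → ℂ} (hφ : HasExpType α s Λ (sector α θ₀ ω) φ) {θ₁ θ₂ : ℝ}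
    (h₁ : |θ₁ - θ₀| < ω) (h₂ : |θ₂ - θ₀| < ω) {z : ℂ} (hz₁ : z ∈ halfPlane θ₁ Λ)
    (hz₂ : z ∈ halfPlane θ₂ Λ) : laplace α θ₁ φ z = laplace α θ₂ φ z := by
  wlog hle : θ₁ ≤ θ₂ generalizing θ₁ θ₂
  · exact (this h₂ h₁ hz₂ hz₁ (le_of_not_ge hle)).symm
  have hb₁ := abs_lt.1 h₁
  have hb₂ := abs_lt.1 h₂
  obtain ⟨hd, C, hC⟩ := id hφ
  set D : Set ℂ := sector 0 θ₀ ω ∩ {l : ℂ | Λ * ‖l‖ < (l * z).re} with hD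
  have hDo : IsOpen D := (isOpen_sector_zero hω').inter (isOpen_lt (by fun_prop) (by fun_prop))
  have hdiff : DifferentiableOn ℂ (rayLaplace α φ z) D := by
    refine differentiableOn_integral_of_holomorphic fun l₀ hl₀ => ?_
    obtain ⟨δ, hδ0, hδ⟩ := exists_between
      (sub_pos.2 (show Λ * ‖l₀‖ < (l₀ * z).re from hl₀.2))
    have hopen : IsOpen (sector 0 θ₀ ω ∩ {l : ℂ | δ < (l * z).re - Λ * ‖l‖}) :=
      (isOpen_sector_zero hω').inter (isOpen_lt (by fun_prop) (by fun_prop))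
    obtain ⟨r, hr, hball⟩ := Metric.isOpen_iff.1 hopen l₀ ⟨hl₀.1, hδ⟩
    refine ⟨r, hr, fun t => Real.exp (-(z * α).re) * |C| * (‖l₀‖ + r) ^ (s + 1) *
      (t ^ s * Real.exp (-δ * t)), (integrableOn_rpow_mul_exp hs hδ0).const_mul _,
      fun l hl => (continuousOn_ray_integrand hd z (hball hl).1).aestronglyMeasurable
        measurableSet_Ioi, ?_, ?_⟩
    · filter_upwards [ae_restrict_mem measurableSet_Ioi] with t ht
      refine (DifferentiableOn.mul (by fun_prop) (hd.comp (by fun_prop) fun l hl => ?_)).mul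
        differentiableOn_id
      rw [← sub_mem_sector_zero, add_sub_cancel_left]
      exact ofReal_mul_mem_sector_zero (hball hl).1 ht
    · filter_upwards [ae_restrict_mem measurableSet_Ioi] with t ht l hl
      have ht' : 0 < t := ht
      refine (norm_ray_integrand_le hC z (hball hl).1 ht).trans ?_
      have h1 : ‖l‖ ≤ ‖l₀‖ + r := by
        have := mem_ball_iff_norm.1 hl
        calc ‖l‖ = ‖l₀ + (l - l₀)‖ := by ring_nf
          _ ≤ ‖l₀‖ + ‖l - l₀‖ := norm_add_le _ _
          _ ≤ _ := by gcongr
      have h2 : δ < (l * z).re - Λ * ‖l‖ := (hball hl).2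
      have h3 : 0 ≤ s + 1 := by linarith
      have h4 : 0 ≤ t ^ s := Real.rpow_nonneg ht'.le s
      gcongr
      exact le_abs_self C
  -- the transform is constant on the real half-line through `l`, so its complex derivative is zero
  have hzero : ∀ l ∈ D, deriv (rayLaplace α φ z) l = 0 := by
    intro l hl
    have h1 := (hdiff.differentiableAt (hDo.mem_nhds hl)).hasDerivAt
    have h2 : HasDerivAt (fun x : ℝ => (x : ℂ) * l) l 1 := by
      simpa using ((hasDerivAt_id (1 : ℂ)).mul_const l).comp_ofReal (z := 1)
    have h3 := HasDerivAt.comp (1 : ℝ) (h₂ := rayLaplace α φ z) (h := fun x : ℝ => (x : ℂ) * l)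
      (by simpa only [ofReal_one, one_mul] using h1) h2
    have h4 : (rayLaplace α φ z ∘ fun x : ℝ => (x : ℂ) * l) =ᶠ[𝓝 1] fun _ => rayLaplace α φ z l := by
      filter_upwards [lt_mem_nhds one_pos] with x hx using rayLaplace_ofReal_mul α φ z l hx
    have h5 := h3.unique ((hasDerivAt_const (1 : ℝ) (rayLaplace α φ z l)).congr_of_eventuallyEq h4)
    exact (mul_eq_zero.1 h5).resolve_right (ne_zero_of_mem_sector_zero hl.1)
  have hmem : ∀ θ ∈ Icc θ₁ θ₂, exp (θ * I) ∈ D := by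
    intro θ hθ
    refine ⟨exp_mem_sector_zero (abs_lt.2 ⟨by linarith [hθ.1], by linarith [hθ.2]⟩), ?_⟩
    show Λ * ‖exp (θ * I)‖ < (exp (θ * I) * z).re
    rw [norm_exp_angle, mul_one]
    exact mem_halfPlane_of_between hΛ (by linarith) hθ.1 hθ.2 hz₁ hz₂
  have hpath : ∀ θ ∈ Icc θ₁ θ₂, HasDerivAt (fun θ : ℝ => rayLaplace α φ z (exp (θ * I))) 0 θ := by
    intro θ hθ
    have h1 := (hdiff.differentiableAt (hDo.mem_nhds (hmem θ hθ))).hasDerivAt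
    rw [hzero _ (hmem θ hθ)] at h1
    have h2 : HasDerivAt (fun θ : ℝ => exp (θ * I)) (exp (θ * I) * I) θ := by
      simpa using (((hasDerivAt_id (θ : ℂ)).mul_const I).cexp).comp_ofReal
    exact (h1.comp θ h2).congr_deriv (zero_mul _)
  have := constant_of_has_deriv_right_zero (f := fun θ : ℝ => rayLaplace α φ z (exp (θ * I)))
    (fun θ hθ => (hpath θ hθ).continuousAt.continuousWithinAt)
    (fun θ hθ => (hpath θ (Ico_subset_Icc_self hθ)).hasDerivWithinAt) θ₂ ⟨hle, le_rfl⟩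
  rw [laplace_eq_rayLaplace, laplace_eq_rayLaplace]
  exact this.symm

/-- The Gamma integral with a complex rate, obtained from the real one by rotating the ray. -/
theorem integral_cpow_mul_exp_neg_mul {s μ : ℂ} (hs : 0 < s.re) (hμ : 0 < μ.re) :
    ∫ t in Ioi (0 : ℝ), (t : ℂ) ^ (s - 1) * exp (-μ * t) = μ ^ (-s) * Gamma s := by
  have hpi := Real.pi_pos
  have hμ0 : μ ≠ 0 := fun h => by simp [h] at hμ
  have harg : |-arg μ - 0| < Real.pi / 2 := by
    rw [sub_zero, abs_neg]; exact abs_arg_lt_pi_div_two_iff.2 (Or.inl hμ)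
  have hφ : HasExpType 0 (s.re - 1) 0 (sector 0 0 (Real.pi / 2)) (branchPow 0 (s - 1)) := by
    refine ⟨fun w hw => ?_, Real.exp (|(s - 1).im| * (|0| + Real.pi)), fun w hw => ?_⟩
    · exact (differentiableAt_branchPow _
        ((mem_sector_zero_iff le_rfl).1 hw).1).differentiableWithinAt
    · simpa using norm_branchPow_le 0 (s - 1) (ne_zero_of_mem_sector_zero hw)
  have hz2 : exp ((-arg μ : ℝ) * I) * μ = (‖μ‖ : ℂ) := by
    calc exp ((-arg μ : ℝ) * I) * μ
        = exp ((-arg μ : ℝ) * I) * (‖μ‖ * exp (arg μ * I)) := by rw [norm_mul_exp_arg_mul_I μ]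
      _ = (‖μ‖ : ℂ) := by
        rw [mul_left_comm, ← Complex.exp_add]
        push_cast
        rw [neg_mul, neg_add_cancel, Complex.exp_zero, mul_one]
  have key := laplace_eq_of_mem_halfPlane (α := 0) (θ₀ := 0) (ω := Real.pi / 2) (s := s.re - 1)
    le_rfl (by linarith) le_rfl hφ (θ₁ := 0) (θ₂ := -arg μ) (by simpa using hpi) harg (z := μ)
    (show (0 : ℝ) < (exp ((0 : ℝ) * I) * μ).re by simpa using hμ)
    (show (0 : ℝ) < (exp ((-arg μ : ℝ) * I) * μ).re by rw [hz2]; simpa using hμ0)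
  have hb : ∀ θ : ℝ, |θ - 0| < Real.pi / 2 → laplace 0 θ (branchPow 0 (s - 1)) μ =
      exp (s * (θ * I)) * ∫ t in Ioi (0 : ℝ), (t : ℂ) ^ (s - 1) * exp (-(exp (θ * I) * μ) * t) := by
    intro θ hθ
    unfold laplace
    rw [← integral_const_mul]
    refine setIntegral_congr_fun measurableSet_Ioi fun t ht => ?_
    simp only [laplaceIntegrand, zero_add]
    rw [branchPow_ofReal_mul _ _ ht (Complex.exp_ne_zero _), branchPow_ray (by linarith)]
    rw [show exp (s * (θ * I)) = exp ((s - 1) * (θ * I)) * exp (θ * I) by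
      rw [← Complex.exp_add]; ring_nf]
    ring_nf
  rw [hb 0 (by simpa using hpi), hb _ harg, hz2] at key
  simp only [ofReal_zero, zero_mul, mul_zero, Complex.exp_zero, one_mul] at key
  rw [key]
  have h3 := integral_cpow_mul_exp_neg_mul_Ioi hs (norm_pos_iff.2 hμ0)
  have h4 : ∀ t : ℝ, -(‖μ‖ : ℂ) * t = -(‖μ‖ * t) := fun t => by ring
  simp_rw [h4]
  rw [h3, ← mul_assoc]
  congr 1
  have h5 : (‖μ‖ : ℂ) ≠ 0 := by simpa using hμ0
  rw [cpow_def_of_ne_zero (one_div_ne_zero h5), cpow_def_of_ne_zero hμ0, ← Complex.exp_add]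
  congr 1
  have h6 : log (1 / (‖μ‖ : ℂ)) = -Real.log ‖μ‖ := by
    rw [one_div, ← ofReal_inv, ← ofReal_log (by positivity), Real.log_inv]; push_cast; rfl
  rw [h6, log]
  push_cast
  ring

/-! ### The Laplace transform turns the integral equation into the differential equation -/

theorem exists_add_pow_le_exp {a ε : ℝ} (ha : 0 ≤ a) (hε : 0 < ε) (n : ℕ) :
    ∃ C : ℝ, 0 ≤ C ∧ ∀ x : ℝ, 0 ≤ x → (a + x) ^ n ≤ C * Real.exp (ε * x) := by
  set δ := ε / (n + 1) with hδ
  have hδ0 : 0 < δ := by positivity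
  refine ⟨(a + δ⁻¹) ^ n, by positivity, fun x hx => ?_⟩
  have h1 : a + x ≤ (a + δ⁻¹) * Real.exp (δ * x) := by
    have h2 : 1 ≤ Real.exp (δ * x) := Real.one_le_exp (by positivity)
    have h3 : δ * x ≤ Real.exp (δ * x) := by linarith [Real.add_one_le_exp (δ * x)]
    have h4 : x ≤ δ⁻¹ * Real.exp (δ * x) := by
      rw [inv_mul_eq_div, le_div_iff₀ hδ0]; linarith
    nlinarith
  calc (a + x) ^ n ≤ ((a + δ⁻¹) * Real.exp (δ * x)) ^ n := by gcongr
    _ = (a + δ⁻¹) ^ n * Real.exp (n * (δ * x)) := by rw [mul_pow, ← Real.exp_nat_mul]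
    _ ≤ _ := by
      have : n * δ ≤ ε := by
        rw [hδ, mul_div_assoc', div_le_iff₀ (by positivity)]
        nlinarith
      have h2 : n * (δ * x) ≤ ε * x := by rw [← mul_assoc]; gcongr
      gcongr

/-- Multiplication by a polynomial costs an arbitrarily small amount of exponential type. -/
theorem HasExpType.polynomial_mul {α : ℂ} {s Λ Λ' : ℝ} {Ω : Set ℂ} {φ : ℂ → ℂ} (h : Λ < Λ')
    (hφ : HasExpType α s Λ Ω φ) (p : Polynomial ℂ) :
    HasExpType α s Λ' Ω (fun ζ => p.eval (-ζ) * φ ζ) := by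
  obtain ⟨hd, C, hC⟩ := hφ
  obtain ⟨K, hK0, hK⟩ := exists_norm_eval_le p le_rfl
  obtain ⟨M, hM0, hM⟩ := exists_add_pow_le_exp (a := 1 + ‖α‖) (by positivity) (sub_pos.2 h)
    p.natDegree
  refine ⟨DifferentiableOn.mul ((p.differentiable.comp differentiable_neg).differentiableOn) hd,
    K * M * C, fun ζ hζ => ?_⟩
  have h1 : ‖p.eval (-ζ)‖ ≤ K * (M * Real.exp ((Λ' - Λ) * ‖ζ - α‖)) := by
    refine (hK _).trans (mul_le_mul_of_nonneg_left ((pow_le_pow_left₀ (by positivity) ?_ _).trans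
      (hM _ (norm_nonneg _))) hK0)
    rw [norm_neg]
    have : ‖ζ‖ ≤ ‖α‖ + ‖ζ - α‖ := by
      calc ‖ζ‖ = ‖α + (ζ - α)‖ := by ring_nf
        _ ≤ _ := norm_add_le _ _
    linarith
  rw [norm_mul]
  calc _ ≤ K * (M * Real.exp ((Λ' - Λ) * ‖ζ - α‖)) *
        (C * ‖ζ - α‖ ^ s * Real.exp (Λ * ‖ζ - α‖)) := by
        gcongr; exact hC ζ hζ
    _ = K * M * C * ‖ζ - α‖ ^ s *
        (Real.exp ((Λ' - Λ) * ‖ζ - α‖) * Real.exp (Λ * ‖ζ - α‖)) := by ring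
    _ = _ := by rw [← Real.exp_add]; ring_nf

theorem HasExpType.hasDerivAt_laplace {α : ℂ} {s Λ θ₀ ω : ℝ} (hs : -1 < s) {φ : ℂ → ℂ}
    (hφ : HasExpType α s Λ (sector α θ₀ ω) φ) {θ : ℝ} (hθ : |θ - θ₀| < ω) {z : ℂ}
    (hz : z ∈ halfPlane θ Λ) :
    HasDerivAt (laplace α θ φ) (laplace α θ (fun ζ => -ζ * φ ζ) z) z := by
  obtain ⟨hd, C, hC⟩ := hφ
  have hl := exp_mem_sector_zero hθ
  obtain ⟨δ, hδ0, hδ⟩ := exists_between (sub_pos.2 (show Λ < (exp (θ * I) * z).re from hz))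
  have hopen : IsOpen {z : ℂ | δ < (exp (θ * I) * z).re - Λ} :=
    isOpen_lt (by fun_prop) (by fun_prop)
  obtain ⟨r, hr, hball⟩ := Metric.isOpen_iff.1 hopen z hδ
  have key := hasDerivAt_integral_of_holomorphic (μ := volume.restrict (Ioi (0 : ℝ)))
    (F := fun z t => laplaceIntegrand α θ φ z t) (w₀ := z) hr
    (bound := fun t => Real.exp ((‖z‖ + r) * ‖α‖) * |C| *
      (t ^ s * Real.exp (-δ * t))) ((integrableOn_rpow_mul_exp hs hδ0).const_mul _)
    (fun w _ => (continuousOn_ray_integrand hd w hl).aestronglyMeasurable measurableSet_Ioi)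
    ?_ ?_
  · refine key.2.congr_deriv ?_
    refine setIntegral_congr_fun measurableSet_Ioi fun t _ => ?_
    have h1 : HasDerivAt (fun w : ℂ => laplaceIntegrand α θ φ w t)
        (laplaceIntegrand α θ (fun ζ => -ζ * φ ζ) z t) z := by
      have h2 : HasDerivAt (fun w : ℂ => -w * (α + t * exp (θ * I)))
          (-1 * (α + t * exp (θ * I))) z := (hasDerivAt_id z).neg.mul_const _
      refine ((h2.cexp.mul_const (φ (α + t * exp (θ * I)))).mul_const (exp (θ * I))).congr_deriv ?_
      simp only [laplaceIntegrand]
      ring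
    exact h1.deriv
  · exact Eventually.of_forall fun t => by
      unfold laplaceIntegrand
      fun_prop
  · filter_upwards [ae_restrict_mem measurableSet_Ioi] with t ht w hw
    have ht' : 0 < t := ht
    refine (norm_ray_integrand_le hC w hl ht).trans ?_
    rw [norm_exp_angle, Real.one_rpow, mul_one, mul_one]
    have h2 : δ < (exp (θ * I) * w).re - Λ := hball hw
    have h4 : 0 ≤ t ^ s := Real.rpow_nonneg ht'.le s
    have h5 : -(w * α).re ≤ (‖z‖ + r) * ‖α‖ := by
      have h6 : ‖w‖ ≤ ‖z‖ + r := by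
        have := mem_ball_iff_norm.1 hw
        calc ‖w‖ = ‖z + (w - z)‖ := by ring_nf
          _ ≤ ‖z‖ + ‖w - z‖ := norm_add_le _ _
          _ ≤ _ := by gcongr
      calc -(w * α).re ≤ |(w * α).re| := neg_le_abs _
        _ ≤ ‖w * α‖ := abs_re_le_norm _
        _ = ‖w‖ * ‖α‖ := norm_mul _ _
        _ ≤ _ := by gcongr
    calc _ ≤ Real.exp (-(w * α).re) * |C| * (t ^ s * Real.exp (-((exp (θ * I) * w).re - Λ) * t)) := by
          gcongr
          exact le_abs_self C
      _ ≤ _ := by gcongr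

/-- The Laplace transform turns multiplication by `-ζ` into `d/dz`. -/
theorem HasExpType.polyDiff_laplace {α : ℂ} {s Λ θ₀ ω : ℝ} (hs : -1 < s) {φ : ℂ → ℂ}
    (hφ : HasExpType α s Λ (sector α θ₀ ω) φ) {θ : ℝ} (hθ : |θ - θ₀| < ω) (p : Polynomial ℂ) :
    ∀ z ∈ halfPlane θ Λ, polyDiff p (laplace α θ φ) z =
      laplace α θ (fun ζ => p.eval (-ζ) * φ ζ) z := by
  have hU := isOpen_halfPlane θ Λ
  have hd : DifferentiableOn ℂ (laplace α θ φ) (halfPlane θ Λ) := fun z hz =>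
    (hφ.hasDerivAt_laplace hs hθ hz).differentiableAt.differentiableWithinAt
  -- room for a slightly larger exponential type, which absorbs the polynomial factors
  have hgap : ∀ z ∈ halfPlane θ Λ, ∃ Λ', Λ < Λ' ∧ z ∈ halfPlane θ Λ' := fun z hz => exists_between hz
  induction p using polynomial_induction_X_mul with
  | hC c =>
    intro z hz
    simp only [polyDiff_C, Polynomial.eval_C, laplace]
    rw [← integral_const_mul]
    congr 1
    ext t
    simp only [laplaceIntegrand]; ring
  | hadd p q hp hq =>
    intro z hz
    obtain ⟨Λ', hΛ', hz'⟩ := hgap z hz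
    rw [polyDiff_add_left, hp z hz, hq z hz, laplace, laplace, laplace, ← integral_add
      ((hφ.polynomial_mul hΛ' p).integrableOn_laplaceIntegrand hs hθ hz')
      ((hφ.polynomial_mul hΛ' q).integrableOn_laplaceIntegrand hs hθ hz')]
    congr 1
    ext t
    simp only [laplaceIntegrand, Polynomial.eval_add]; ring
  | hX p hp =>
    intro z hz
    obtain ⟨Λ', hΛ', hz'⟩ := hgap z hz
    have hev : polyDiff p (laplace α θ φ) =ᶠ[𝓝 z] laplace α θ (fun ζ => p.eval (-ζ) * φ ζ) := by
      filter_upwards [hU.mem_nhds hz] with y hy using hp y hy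
    rw [polyDiff_X_mul hU hd p hz, hev.deriv_eq,
      ((hφ.polynomial_mul hΛ' p).hasDerivAt_laplace hs hθ hz').deriv]
    simp only [Polynomial.eval_mul, Polynomial.eval_X, mul_assoc]

/-- The Laplace transform of the convolution kernel. -/
theorem integral_borelKernel {r : ℕ → ℂ} {S L : ℝ} (hL : 0 < L)
    (hr : ∀ j, ‖r j‖ ≤ S * L ^ j) {μ l : ℂ} (hl : ‖l‖ = 1) (hμ : L < μ.re) :
    HasSum (fun j : ℕ => r j * (l / μ) ^ (j + 2))
      (l * ∫ t in Ioi (0 : ℝ), exp (-μ * t) * borelKernel r (t * l)) := by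
  have hμ0 : 0 < μ.re := hL.trans hμ
  have hμne : μ ≠ 0 := fun h => by simp [h] at hμ0
  have hterm : ∀ j : ℕ, ∫ t in Ioi (0 : ℝ),
      exp (-μ * t) * (r j * ((t * l) ^ (j + 1) / (j + 1).factorial)) =
        r j * l ^ (j + 1) / μ ^ (j + 2) := by
    intro j
    have h1 := integral_cpow_mul_exp_neg_mul (s := (j + 1 : ℕ) + 1) (μ := μ)
      (by simp; positivity) hμ0
    rw [add_sub_cancel_right, Complex.Gamma_nat_eq_factorial] at h1
    simp_rw [cpow_natCast] at h1
    have h2 : ∀ t : ℝ, exp (-μ * t) * (r j * ((t * l) ^ (j + 1) / (j + 1).factorial)) =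
        r j * l ^ (j + 1) / (j + 1).factorial * ((t : ℂ) ^ (j + 1) * exp (-μ * t)) := by
      intro t; rw [mul_pow]; ring
    simp_rw [h2]
    rw [integral_const_mul, h1, cpow_neg,
      show (((j + 1 : ℕ) : ℂ) + 1) = ((j + 2 : ℕ) : ℂ) by push_cast; ring, cpow_natCast]
    have : ((j + 1).factorial : ℂ) ≠ 0 := by exact_mod_cast (j + 1).factorial_ne_zero
    field_simp
  have hsum : HasSum (fun j : ℕ => ∫ t in Ioi (0 : ℝ),
      exp (-μ * t) * (r j * ((t * l) ^ (j + 1) / (j + 1).factorial)))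
      (∫ t in Ioi (0 : ℝ), exp (-μ * t) * borelKernel r (t * l)) := by
    have hb : ∀ t : ℝ, HasSum (fun j : ℕ => Real.exp (-μ.re * t) * (S * t * ((L * t) ^ j / j.factorial)))
        (Real.exp (-μ.re * t) * (S * t * Real.exp (L * t))) := fun t =>
      ((hasSum_exp_real (L * t)).mul_left (S * t)).mul_left _
    refine hasSum_integral_of_dominated_convergence (bound := fun j t =>
      Real.exp (-μ.re * t) * (S * t * ((L * t) ^ j / j.factorial))) (fun j => ?_) (fun j => ?_)
      (Eventually.of_forall fun t => (hb t).summable) ?_ ?_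
    · exact (Continuous.aestronglyMeasurable (by fun_prop))
    · filter_upwards [ae_restrict_mem measurableSet_Ioi] with t ht
      have ht' : 0 < t := ht
      have h1 := norm_borelKernel_term_le hr j (t * l)
      rw [norm_mul (t : ℂ), hl, mul_one, norm_real, Real.norm_of_nonneg ht'.le] at h1
      rw [norm_mul, norm_exp]
      have h2 : (-μ * t).re = -μ.re * t := by simp
      rw [h2]
      gcongr
    · have h1 : (fun t : ℝ => ∑' j : ℕ, Real.exp (-μ.re * t) * (S * t * ((L * t) ^ j / j.factorial))) =
          fun t => S * (t ^ (1 : ℝ) * Real.exp (-(μ.re - L) * t)) := by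
        ext t
        rw [(hb t).tsum_eq, Real.rpow_one,
          show -(μ.re - L) * t = -μ.re * t + L * t by ring, Real.exp_add]
        ring
      rw [h1]
      exact (integrableOn_rpow_mul_exp (by norm_num) (sub_pos.2 hμ)).const_mul S
    · exact Eventually.of_forall fun t => (hasSum_borelKernel hr (t * l)).mul_left _
  simp_rw [hterm] at hsum
  have := hsum.mul_left l
  have h3 : (fun j : ℕ => l * (r j * l ^ (j + 1) / μ ^ (j + 2))) =
      fun j => r j * (l / μ) ^ (j + 2) := by
    ext j; rw [div_pow]; ring
  rwa [h3] at this

/-- The integral equation, written on the segment from the tip to `α + w`. -/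
def SegmentVolterra (P Q : Polynomial ℂ) (r : ℕ → ℂ) (α : ℂ) (Ω : Set ℂ) (φ : ℂ → ℂ) : Prop :=
  ∀ w ∈ Ω, P.eval (-(α + w)) * φ (α + w) + w * ∫ s in (0 : ℝ)..1,
    (Q.eval (-(α + s * w)) + borelKernel r ((1 - s) * w)) * φ (α + s * w) = 0

/-- Along the ray, the integral equation is a sum of two convolutions, with the constant `1` and
with `borelKernel`. The Laplace transforms of these kernels are `1/z` and `z⁻² R(1/z)`, so the
convolution theorem gives the differential equation. -/
theorem levelOneOp_laplace {P Q : Polynomial ℂ} {R : ℂ → ℂ} {A L S : ℝ} (hA : 0 < A) (hL : A < L)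
    (hR : DifferentiableOn ℂ R (Metric.ball 0 A⁻¹)) (hS0 : 0 ≤ S)
    (hS : ∀ j, ‖taylorCoeff R j‖ ≤ S * L ^ j) {α : ℂ} {s Λ θ₀ ω : ℝ} (hs : -1 < s) {φ : ℂ → ℂ}
    (hφ : HasExpType α s Λ (sector α θ₀ ω) φ)
    (heq : SegmentVolterra P Q (taylorCoeff R) α (sector 0 θ₀ ω) φ) (hΛ : L ≤ Λ)
    {θ : ℝ} (hθ : |θ - θ₀| < ω) {z : ℂ} (hz : z ∈ halfPlane θ Λ) :
    levelOneOp P Q R (laplace α θ φ) z = 0 := by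
  have hL0 : 0 < L := hA.trans hL
  obtain ⟨Λ', hΛ', hz'⟩ : ∃ Λ', Λ < Λ' ∧ z ∈ halfPlane θ Λ' := exists_between hz
  set l := exp (θ * I) with hldef
  have hl1 : ‖l‖ = 1 := norm_exp_angle θ
  have hl0 : l ≠ 0 := Complex.exp_ne_zero _
  have hlmem : l ∈ sector 0 θ₀ ω := exp_mem_sector_zero hθ
  have hmem : ∀ {t : ℝ}, 0 < t → α + t * l ∈ sector α θ₀ ω := fun ht => by
    rw [← sub_mem_sector_zero, add_sub_cancel_left]; exact ofReal_mul_mem_sector_zero hlmem ht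
  set μ := l * z with hμdef
  have hμ : L < μ.re := hΛ.trans_lt hz
  have hμ0 : 0 < μ.re := hL0.trans hμ
  have hμne : μ ≠ 0 := fun h => by simp [h] at hμ0
  have hz0 : z ≠ 0 := fun h => hμne (by rw [hμdef, h, mul_zero])
  -- the Laplace integral as an integral over the half-line
  have hlap : ∀ χ : ℂ → ℂ, ∀ t : ℝ, laplaceIntegrand α θ χ z t =
      exp (-z * α) * l * (exp (-μ * t) * χ (α + t * l)) := by
    intro χ t
    have : -z * (α + t * l) = -z * α + -μ * t := by rw [hμdef]; ring
    simp only [laplaceIntegrand, ← hldef]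
    rw [this, Complex.exp_add]; ring
  have hE : exp (-z * α) * l ≠ 0 := mul_ne_zero (Complex.exp_ne_zero _) hl0
  have hlap' : ∀ χ : ℂ → ℂ, laplace α θ χ z =
      exp (-z * α) * l * ∫ t in Ioi (0 : ℝ), exp (-μ * t) * χ (α + t * l) := by
    intro χ
    unfold laplace
    simp_rw [hlap χ]
    rw [integral_const_mul]
  have hint : ∀ {χ : ℂ → ℂ} {Λ₁ : ℝ}, HasExpType α s Λ₁ (sector α θ₀ ω) χ → z ∈ halfPlane θ Λ₁ →
      IntegrableOn (fun t : ℝ => exp (-μ * t) * χ (α + t * l)) (Ioi 0) := by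
    intro χ Λ₁ hχ hz₁
    have h1 := (hχ.integrableOn_laplaceIntegrand hs hθ hz₁).const_mul (exp (-z * α) * l)⁻¹
    refine h1.congr (Eventually.of_forall fun t => ?_)
    simp only [hlap]
    rw [← mul_assoc, inv_mul_cancel₀ hE, one_mul]
  set a : ℝ → ℂ := fun t => exp (-μ * t) * (Q.eval (-(α + t * l)) * φ (α + t * l)) with ha
  set b : ℝ → ℂ := fun t => exp (-μ * t) * φ (α + t * l) with hb
  set c : ℝ → ℂ := fun t => exp (-μ * t) * (P.eval (-(α + t * l)) * φ (α + t * l)) with hc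
  set k₁ : ℝ → ℂ := fun t => exp (-μ * t) with hk₁
  set k₂ : ℝ → ℂ := fun t => exp (-μ * t) * borelKernel (taylorCoeff R) (t * l) with hk₂
  have hai : IntegrableOn a (Ioi 0) := hint (hφ.polynomial_mul hΛ' Q) hz'
  have hbi : IntegrableOn b (Ioi 0) := hint hφ hz
  have hk₁i : IntegrableOn k₁ (Ioi 0) := integrableOn_exp_mul_complex_Ioi (by simpa using hμ0) 0
  have hkd : Differentiable ℂ (borelKernel (taylorCoeff R)) := fun x =>
    (hasDerivAt_borelKernel hS0 hL0.le hS x).differentiableAt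
  have hk₂c : Continuous k₂ := by
    have := hkd.continuous
    fun_prop
  have hk₂i : IntegrableOn k₂ (Ioi 0) := by
    refine ((integrableOn_rpow_mul_exp (s := 1) (by norm_num) (sub_pos.2 hμ)).const_mul S).mono'
      hk₂c.aestronglyMeasurable ?_
    filter_upwards [ae_restrict_mem measurableSet_Ioi] with t ht
    have ht' : 0 < t := ht
    have h1 := norm_borelKernel_le hS (t * l)
    rw [norm_mul (t : ℂ), hl1, mul_one, norm_real, Real.norm_of_nonneg ht'.le] at h1
    have h2 : (-μ * t).re = -μ.re * t := by simp
    rw [hk₂, norm_mul, norm_exp, h2, Real.rpow_one]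
    calc _ ≤ Real.exp (-μ.re * t) * (S * t * Real.exp (L * t)) := by gcongr
      _ = S * (t * (Real.exp (-μ.re * t) * Real.exp (L * t))) := by ring
      _ = _ := by rw [← Real.exp_add]; ring_nf
  have hk₁v : ∫ t in Ioi (0 : ℝ), k₁ t = 1 / μ := by
    have := integral_exp_mul_complex_Ioi (a := -μ) (by simpa using hμ0) 0
    rw [hk₁, this]; simp [neg_div_neg_eq]
  have hk₂v : l * ∫ t in Ioi (0 : ℝ), k₂ t = (z⁻¹) ^ 2 * R z⁻¹ := by
    have h1 := integral_borelKernel hL0 hS hl1 hμ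
    have hzn : L < ‖z‖ := by
      have := (le_abs_self _).trans (abs_re_le_norm μ)
      rw [hμdef, norm_mul, hl1, one_mul] at this
      exact hμ.trans_le this
    have hzb : z⁻¹ ∈ Metric.ball (0 : ℂ) A⁻¹ := by
      rw [mem_ball_zero_iff, norm_inv]
      exact inv_strictAnti₀ hA (hL.trans hzn)
    have h2 := (hasSum_taylorCoeff hR hzb).mul_left ((z⁻¹) ^ 2)
    have h3 : l / μ = z⁻¹ := by rw [hμdef]; field_simp
    rw [h3] at h1
    refine h1.unique ?_
    have h4 : (fun j : ℕ => taylorCoeff R j * z⁻¹ ^ (j + 2)) =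
        fun j => z⁻¹ ^ 2 * (taylorCoeff R j * z⁻¹ ^ j) := by ext j; ring
    rw [h4]; exact h2
  -- the integral equation on the ray, as a sum of two convolutions
  let m := ContinuousLinearMap.mul ℝ ℂ
  have hconv : ∀ t ∈ Ioi (0 : ℝ), c t + l * ((∫ x in (0 : ℝ)..t, m (a x) (k₁ (t - x))) +
      ∫ x in (0 : ℝ)..t, m (b x) (k₂ (t - x))) = 0 := by
    intro t ht
    have ht' : 0 < t := ht
    have h1 := heq _ (ofReal_mul_mem_sector_zero hlmem ht')
    have h2 : (t : ℂ) * (∫ s in (0 : ℝ)..1, (Q.eval (-(α + s * (t * l))) +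
        borelKernel (taylorCoeff R) ((1 - s) * (t * l))) * φ (α + s * (t * l))) =
        ∫ x in (0 : ℝ)..t, (Q.eval (-(α + x * l)) +
          borelKernel (taylorCoeff R) ((t - x : ℝ) * l)) * φ (α + x * l) := by
      have h3 := intervalIntegral.smul_integral_comp_mul_left (a := 0) (b := 1) (fun x : ℝ =>
        (Q.eval (-(α + x * l)) + borelKernel (taylorCoeff R) ((t - x : ℝ) * l)) * φ (α + x * l)) t
      rw [mul_zero, mul_one, real_smul] at h3
      rw [← h3]
      congr 2
      ext x
      push_cast
      ring_nf
    have hsub : Ioc 0 t ⊆ Ioi (0 : ℝ) := Ioc_subset_Ioi_self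
    have hcont : ∀ {u : ℝ → ℂ}, IntegrableOn u (Ioi 0) → ∀ {v : ℝ → ℂ}, Continuous v →
        IntervalIntegrable (fun x => u x * v (t - x)) volume 0 t := by
      intro u hu v hv
      refine IntervalIntegrable.mul_continuousOn ?_ (by fun_prop)
      rw [intervalIntegrable_iff_integrableOn_Ioc_of_le ht'.le]
      exact hu.mono_set hsub
    rw [show (t : ℂ) * l * (∫ s in (0 : ℝ)..1, (Q.eval (-(α + s * (t * l))) +
        borelKernel (taylorCoeff R) ((1 - s) * (t * l))) * φ (α + s * (t * l))) =
        l * ((t : ℂ) * (∫ s in (0 : ℝ)..1, (Q.eval (-(α + s * (t * l))) +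
        borelKernel (taylorCoeff R) ((1 - s) * (t * l))) * φ (α + s * (t * l)))) by ring, h2] at h1
    simp only [m, ContinuousLinearMap.mul_apply']
    rw [← intervalIntegral.integral_add (hcont hai (by fun_prop)) (hcont hbi hk₂c)]
    have h4 : ∫ x in (0 : ℝ)..t, (a x * k₁ (t - x) + b x * k₂ (t - x)) = exp (-μ * t) *
        ∫ x in (0 : ℝ)..t, (Q.eval (-(α + x * l)) +
          borelKernel (taylorCoeff R) ((t - x : ℝ) * l)) * φ (α + x * l) := by
      rw [← intervalIntegral.integral_const_mul]
      refine intervalIntegral.integral_congr fun x _ => ?_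
      have h5 : exp (-μ * t) = exp (-μ * x) * exp (-μ * ((t - x : ℝ) : ℂ)) := by
        rw [← Complex.exp_add]; push_cast; ring_nf
      simp only [ha, hb, hk₁, hk₂]
      rw [h5]
      ring
    rw [h4, hc]
    linear_combination exp (-μ * t) * h1
  have hI₁ := integral_posConvolution hai hk₁i m
  have hI₂ := integral_posConvolution hbi hk₂i m
  have hi₁ := integrable_posConvolution hai hk₁i m
  have hi₂ := integrable_posConvolution hbi hk₂i m
  rw [posConvolution, integrable_indicator_iff measurableSet_Ioi] at hi₁ hi₂
  have hcv : ∫ t in Ioi (0 : ℝ), c t = -(l * (m (∫ t in Ioi (0 : ℝ), a t) (∫ t in Ioi (0 : ℝ), k₁ t)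
      + m (∫ t in Ioi (0 : ℝ), b t) (∫ t in Ioi (0 : ℝ), k₂ t))) := by
    rw [← hI₁, ← hI₂, ← integral_add hi₁ hi₂, ← integral_const_mul, ← integral_neg]
    refine setIntegral_congr_fun measurableSet_Ioi fun t ht => ?_
    exact eq_neg_of_add_eq_zero_left (hconv t ht)
  simp only [m, ContinuousLinearMap.mul_apply'] at hcv
  rw [hk₁v] at hcv
  rw [levelOneOp, hφ.polyDiff_laplace hs hθ P z hz, hφ.polyDiff_laplace hs hθ Q z hz, hlap', hlap',
    hlap']
  change exp (-z * α) * l * (∫ t in Ioi (0 : ℝ), c t) + z⁻¹ * (exp (-z * α) * l *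
    ∫ t in Ioi (0 : ℝ), a t) + z⁻¹ ^ 2 * R z⁻¹ * (exp (-z * α) * l * ∫ t in Ioi (0 : ℝ), b t) = 0
  have h6 : z⁻¹ = l * (1 / μ) := by rw [hμdef]; field_simp
  rw [hcv, ← hk₂v, h6]
  ring

/-! ### The position-domain function and its Laplace transform -/

theorem HasExpType.intervalIntegrable_segment {α : ℂ} {s Λ θ₀ ω : ℝ} (hs : -1 < s) {φ : ℂ → ℂ}
    (hφ : HasExpType α s Λ (sector α θ₀ ω) φ) {w : ℂ} (hw : w ∈ sector 0 θ₀ ω) :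
    IntervalIntegrable (fun x : ℝ => φ (α + x * w)) volume 0 1 := by
  obtain ⟨hd, C, hC⟩ := hφ
  have hmem : ∀ {t : ℝ}, 0 < t → α + t * w ∈ sector α θ₀ ω := fun ht => by
    rw [← sub_mem_sector_zero, add_sub_cancel_left]; exact ofReal_mul_mem_sector_zero hw ht
  rw [intervalIntegrable_iff_integrableOn_Ioc_of_le zero_le_one]
  have h1 : IntegrableOn (fun x : ℝ => x ^ s) (Ioc 0 1) := by
    rw [← intervalIntegrable_iff_integrableOn_Ioc_of_le zero_le_one]
    exact intervalIntegral.intervalIntegrable_rpow' hs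
  refine (h1.const_mul (|C| * ‖w‖ ^ s * Real.exp (|Λ| * ‖w‖))).mono' ?_ ?_
  · refine ContinuousOn.aestronglyMeasurable (hd.continuousOn.comp
      (Continuous.continuousOn (by fun_prop)) fun t ht => hmem ht.1) measurableSet_Ioc
  · filter_upwards [ae_restrict_mem measurableSet_Ioc] with t ht
    have h2 := hC _ (hmem ht.1)
    rw [add_sub_cancel_left, norm_mul, norm_real, Real.norm_of_nonneg ht.1.le] at h2
    have h3 : 0 ≤ (t * ‖w‖) ^ s := Real.rpow_nonneg (mul_nonneg ht.1.le (norm_nonneg _)) s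
    have h4 : Λ * (t * ‖w‖) ≤ |Λ| * ‖w‖ := by
      calc Λ * (t * ‖w‖) ≤ |Λ| * (t * ‖w‖) :=
            mul_le_mul_of_nonneg_right (le_abs_self _) (mul_nonneg ht.1.le (norm_nonneg _))
        _ ≤ |Λ| * (1 * ‖w‖) := by have := ht.2; gcongr
        _ = _ := by rw [one_mul]
    calc _ ≤ _ := h2
      _ ≤ |C| * (t * ‖w‖) ^ s * Real.exp (Λ * (t * ‖w‖)) := by gcongr; exact le_abs_self C
      _ ≤ |C| * (t * ‖w‖) ^ s * Real.exp (|Λ| * ‖w‖) := by gcongr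
      _ = _ := by rw [Real.mul_rpow ht.1.le (norm_nonneg _)]; ring

/-- The two forms of the integral equation agree: the kernel is expanded into its power series. -/
theorem SegmentVolterra.solvesVolterra {P Q : Polynomial ℂ} {R : ℂ → ℂ} {L S : ℝ} (hS0 : 0 ≤ S)
    (hL : 0 ≤ L) (hS : ∀ j, ‖taylorCoeff R j‖ ≤ S * L ^ j) {α : ℂ} {s Λ θ₀ ω : ℝ} (hs : -1 < s)
    {φ : ℂ → ℂ} (hφ : HasExpType α s Λ (sector α θ₀ ω) φ)
    (heq : SegmentVolterra P Q (taylorCoeff R) α (sector 0 θ₀ ω) φ) :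
    SolvesVolterra P Q R α (sector α θ₀ ω) φ := by
  intro ζ hζ
  set w := ζ - α with hw
  have hwm : w ∈ sector 0 θ₀ ω := sub_mem_sector_zero.2 hζ
  have hζw : ζ = α + w := by rw [hw]; ring
  have hi := hφ.intervalIntegrable_segment hs hwm
  have hkc : Continuous (borelKernel (taylorCoeff R)) := Differentiable.continuous (𝕜 := ℂ) fun x =>
    (hasDerivAt_borelKernel hS0 hL hS x).differentiableAt
  have hrep : ∀ j, taylorCoeff R j * repeatedIntegral α (j + 1) φ ζ = ∫ x in (0 : ℝ)..1,
      taylorCoeff R j * (((1 - x) * w) ^ (j + 1) / (j + 1).factorial) * (w * φ (α + x * w)) := by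
    intro j
    rw [repeatedIntegral, ← mul_assoc, ← intervalIntegral.integral_const_mul]
    refine intervalIntegral.integral_congr fun x _ => ?_
    simp only [← hw]
    rw [show ζ - (α + x * w) = (1 - x) * w by rw [hζw]; ring]
    ring
  simp_rw [hrep]
  have hsum : HasSum (fun j => ∫ x in (0 : ℝ)..1,
      taylorCoeff R j * (((1 - x) * w) ^ (j + 1) / (j + 1).factorial) * (w * φ (α + x * w)))
      (∫ x in (0 : ℝ)..1, borelKernel (taylorCoeff R) ((1 - x) * w) * (w * φ (α + x * w))) := by
    have hb : ∀ x : ℝ, HasSum (fun j : ℕ => S * ‖w‖ * ((L * ‖w‖) ^ j / j.factorial) *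
        (‖w‖ * ‖φ (α + x * w)‖)) (S * ‖w‖ * Real.exp (L * ‖w‖) * (‖w‖ * ‖φ (α + x * w)‖)) :=
      fun x => ((hasSum_exp_real (L * ‖w‖)).mul_left _).mul_right _
    refine intervalIntegral.hasSum_integral_of_dominated_convergence (bound := fun j x =>
      S * ‖w‖ * ((L * ‖w‖) ^ j / j.factorial) * (‖w‖ * ‖φ (α + x * w)‖)) (fun j => ?_) (fun j => ?_)
      (Eventually.of_forall fun x _ => (hb x).summable) ?_
      (Eventually.of_forall fun x _ => (hasSum_borelKernel hS _).mul_right _)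
    · rw [uIoc_of_le zero_le_one]
      exact (Continuous.aestronglyMeasurable (by fun_prop)).mul
        (aestronglyMeasurable_const.mul hi.1.aestronglyMeasurable)
    · refine Eventually.of_forall fun x hx => ?_
      rw [uIoc_of_le zero_le_one] at hx
      have h1 : ‖(1 - (x : ℂ)) * w‖ ≤ ‖w‖ := by
        rw [show 1 - (x : ℂ) = ((1 - x : ℝ) : ℂ) by push_cast; rfl, norm_ofReal_mul_le
          ⟨by linarith [hx.2], by linarith [hx.1]⟩]
        exact mul_le_of_le_one_left (norm_nonneg _) (by linarith [hx.1])
      rw [norm_mul, norm_mul w]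
      refine mul_le_mul_of_nonneg_right ((norm_borelKernel_term_le hS j _).trans ?_) (by positivity)
      gcongr
    · simp_rw [(hb _).tsum_eq]
      exact (hi.norm.const_mul _).const_mul _
  have hQ : repeatedIntegral α 0 (fun x => Q.eval (-x) * φ x) ζ =
      ∫ x in (0 : ℝ)..1, Q.eval (-(α + x * w)) * (w * φ (α + x * w)) := by
    rw [repeatedIntegral, Nat.factorial_zero, Nat.cast_one, div_one, one_mul]
    refine intervalIntegral.integral_congr fun x _ => ?_
    simp only [← hw]
    ring
  have h1 := heq w hwm
  have hwi := hi.const_mul w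
  have h2 : w * ∫ x in (0 : ℝ)..1, (Q.eval (-(α + x * w)) +
      borelKernel (taylorCoeff R) ((1 - x) * w)) * φ (α + x * w) =
      (∫ x in (0 : ℝ)..1, Q.eval (-(α + x * w)) * (w * φ (α + x * w))) +
      ∫ x in (0 : ℝ)..1, borelKernel (taylorCoeff R) ((1 - x) * w) * (w * φ (α + x * w)) := by
    rw [← intervalIntegral.integral_add (hwi.continuousOn_mul ?_) (hwi.continuousOn_mul ?_),
      ← intervalIntegral.integral_const_mul]
    · refine intervalIntegral.integral_congr fun x _ => ?_
      ring
    · exact (Q.continuous.comp (by fun_prop)).continuousOn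
    · exact (hkc.comp (by fun_prop)).continuousOn
  rw [h2] at h1
  rw [hQ, hζw, show -(P.eval (-(α + w)) * φ (α + w) +
      ∫ x in (0 : ℝ)..1, Q.eval (-(α + x * w)) * (w * φ (α + x * w))) =
      ∫ x in (0 : ℝ)..1, borelKernel (taylorCoeff R) ((1 - x) * w) * (w * φ (α + x * w)) by
    linear_combination -h1]
  exact hsum

/-- The function `(ζ - α) ^ s * g (ζ - α)`, with the power on the branch near the direction `θ₀`. -/
def tipPow (α : ℂ) (θ₀ : ℝ) (s : ℂ) (g : ℂ → ℂ) (ζ : ℂ) : ℂ := branchPow θ₀ s (ζ - α) * g (ζ - α)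

theorem tipPow_segment (α : ℂ) (θ₀ : ℝ) (s : ℂ) (g : ℂ → ℂ) {x : ℝ} (hx : 0 < x) {w : ℂ}
    (hw : w ≠ 0) : tipPow α θ₀ s g (α + x * w) = branchPow θ₀ s w * ((x : ℂ) ^ s * g (x * w)) := by
  rw [tipPow, add_sub_cancel_left, branchPow_ofReal_mul θ₀ s hx hw]
  ring

theorem hasExpType_tipPow {α : ℂ} {θ₀ ω : ℝ} (hω' : ω ≤ Real.pi / 2) (s : ℂ) {k : ℝ} {g : ℂ → ℂ}
    {C L : ℝ} (hg : DifferentiableOn ℂ g (sector 0 θ₀ ω))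
    (hC : ∀ w ∈ sector 0 θ₀ ω, ‖g w‖ ≤ C * ‖w‖ ^ k * Real.exp (L * ‖w‖)) :
    HasExpType α (s.re + k) L (sector α θ₀ ω) (tipPow α θ₀ s g) := by
  have hm : MapsTo (fun ζ => ζ - α) (sector α θ₀ ω) (sector 0 θ₀ ω) := fun ζ hζ =>
    sub_mem_sector_zero.2 hζ
  refine ⟨DifferentiableOn.mul (fun ζ hζ => ?_) (hg.comp (by fun_prop) hm),
    Real.exp (|s.im| * (|θ₀| + Real.pi)) * C, fun ζ hζ => ?_⟩
  · exact (DifferentiableAt.comp ζ (differentiableAt_branchPow s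
      ((mem_sector_zero_iff hω').1 (hm hζ)).1) (by fun_prop)).differentiableWithinAt
  · have h0 := ne_zero_of_mem_sector_zero (hm hζ)
    rw [tipPow, norm_mul, Real.rpow_add (norm_pos_iff.2 h0)]
    calc _ ≤ (Real.exp (|s.im| * (|θ₀| + Real.pi)) * ‖ζ - α‖ ^ s.re) *
          (C * ‖ζ - α‖ ^ k * Real.exp (L * ‖ζ - α‖)) := by
          gcongr
          · exact norm_branchPow_le _ _ h0
          · exact hC _ (hm hζ)
      _ = _ := by ring

/-- On the segment, `(s w) ^ (τ - 1) = s ^ (τ - 1) w ^ (τ - 1)`, and the last factor comes out of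
the integral. -/
theorem segmentVolterra_tipPow {P Q : Polynomial ℂ} {r : ℕ → ℂ} {α τ : ℂ} {θ₀ ω : ℝ} {g : ℂ → ℂ}
    (hg : ∀ w ∈ sector 0 θ₀ ω, P.eval (-(α + w)) * g w + w * ∫ s in (0 : ℝ)..1,
      (Q.eval (-(α + s * w)) + borelKernel r ((1 - s) * w)) *
        ((s : ℂ) ^ (τ - 1) * g (s * w)) = 0) :
    SegmentVolterra P Q r α (sector 0 θ₀ ω) (tipPow α θ₀ (τ - 1) g) := by
  intro w hw
  have hw0 := ne_zero_of_mem_sector_zero hw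
  have h1 : (∫ s in (0 : ℝ)..1, (Q.eval (-(α + s * w)) + borelKernel r ((1 - s) * w)) *
      tipPow α θ₀ (τ - 1) g (α + s * w)) = branchPow θ₀ (τ - 1) w * ∫ s in (0 : ℝ)..1,
      (Q.eval (-(α + s * w)) + borelKernel r ((1 - s) * w)) *
        ((s : ℂ) ^ (τ - 1) * g (s * w)) := by
    rw [← intervalIntegral.integral_const_mul]
    refine intervalIntegral.integral_congr_ae (Eventually.of_forall fun x hx => ?_)
    rw [uIoc_of_le zero_le_one] at hx
    rw [tipPow_segment α θ₀ (τ - 1) g hx.1 hw0]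
    ring
  rw [h1, tipPow, add_sub_cancel_left]
  linear_combination branchPow θ₀ (τ - 1) w * hg w hw

/-- The Laplace transform of `(ζ - α) ^ (τ - 1)`. -/
theorem laplace_tipPow_const {α τ : ℂ} (hτ : 0 < τ.re) {θ₀ ω : ℝ} (hω' : ω ≤ Real.pi / 2) {θ : ℝ}
    (hθ : |θ - θ₀| < ω) {z : ℂ} (hz : z ∈ halfPlane θ 0) :
    laplace α θ (tipPow α θ₀ (τ - 1) fun _ => (Gamma τ)⁻¹) z =
      exp (-α * z) * branchPow (-θ₀) (-τ) z := by
  have hpi := Real.pi_pos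
  set l := exp (θ * I) with hl
  have hl0 : l ≠ 0 := Complex.exp_ne_zero _
  set μ := l * z with hμ
  have hμ0 : 0 < μ.re := hz
  have hμne : μ ≠ 0 := fun h => by simp [h] at hμ0
  have hG : Gamma τ ≠ 0 := Gamma_ne_zero_of_re_pos hτ
  have h1 : laplace α θ (tipPow α θ₀ (τ - 1) fun _ => (Gamma τ)⁻¹) z =
      exp (-α * z) * exp (τ * (θ * I)) * (Gamma τ)⁻¹ *
        ∫ t in Ioi (0 : ℝ), (t : ℂ) ^ (τ - 1) * exp (-μ * t) := by
    unfold laplace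
    rw [← integral_const_mul]
    refine setIntegral_congr_fun measurableSet_Ioi fun t ht => ?_
    simp only [laplaceIntegrand]
    rw [tipPow_segment α θ₀ (τ - 1) _ ht (Complex.exp_ne_zero _), branchPow_ray (by linarith),
      show exp (τ * (θ * I)) = exp ((τ - 1) * (θ * I)) * exp (θ * I) by
        rw [← Complex.exp_add]; ring_nf,
      show -z * (α + t * exp (θ * I)) = -α * z + -μ * t by rw [hμ, hl]; ring, Complex.exp_add]
    ring
  rw [h1, integral_cpow_mul_exp_neg_mul hτ hμ0, cpow_def_of_ne_zero hμne, branchPow]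
  have h2 := abs_lt.1 hθ
  have h3 := abs_lt.1 (abs_arg_lt_pi_div_two_iff.2 (Or.inl hμ0))
  have h4 : exp (-(((-θ₀ : ℝ) : ℂ) * I)) * z = exp (((θ₀ - θ : ℝ) : ℂ) * I) * μ := by
    rw [hμ, hl, ← mul_assoc, ← Complex.exp_add]; push_cast; ring_nf
  have h5 : log (exp (((θ₀ - θ : ℝ) : ℂ) * I) * μ) = ((θ₀ - θ : ℝ) : ℂ) * I + log μ := by
    have h6 : arg (exp (((θ₀ - θ : ℝ) : ℂ) * I)) = θ₀ - θ := by
      rw [arg_exp_mul_I, toIocMod_eq_self]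
      constructor <;> linarith
    rw [Complex.log_mul (Complex.exp_ne_zero _) hμne, log_exp]
    · simp; linarith
    · simp; linarith
    · rw [h6]; constructor <;> linarith
  rw [h4, h5, show exp (-α * z) * exp (τ * (θ * I)) * (Gamma τ)⁻¹ * (exp (log μ * -τ) * Gamma τ) =
    exp (-α * z) * (exp (τ * (θ * I)) * exp (log μ * -τ)) by field_simp, ← Complex.exp_add]
  congr 2
  push_cast
  ring

/-- The Laplace integral of a function of size `|ζ - α| ^ s` decays like the power `-(s + 1)` of the
depth of `z` in the half-plane, with a constant that does not depend on the direction. -/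
theorem HasExpType.exists_norm_laplace_le {α : ℂ} {s Λ θ₀ ω : ℝ} (hs : -1 < s) {φ : ℂ → ℂ}
    (hφ : HasExpType α s Λ (sector α θ₀ ω) φ) :
    ∃ C : ℝ, ∀ θ : ℝ, |θ - θ₀| < ω → ∀ z ∈ halfPlane θ Λ,
      ‖laplace α θ φ z‖ ≤ Real.exp (-(z * α).re) * (C * ((exp (θ * I) * z).re - Λ) ^ (-(s + 1))) := by
  obtain ⟨hd, C, hC⟩ := hφ
  refine ⟨C * Real.Gamma (s + 1), fun θ hθ z hz => ?_⟩
  have hb : 0 < (exp (θ * I) * z).re - Λ := sub_pos.2 hz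
  have h1 : ∫ t in Ioi (0 : ℝ), t ^ s * Real.exp (-((exp (θ * I) * z).re - Λ) * t) =
      ((exp (θ * I) * z).re - Λ) ^ (-(s + 1)) * Real.Gamma (s + 1) := by
    have := Real.integral_rpow_mul_exp_neg_mul_Ioi (a := s + 1) (by linarith) hb
    simp only [add_sub_cancel_right] at this
    simp_rw [neg_mul]
    rw [this, one_div, Real.inv_rpow hb.le, Real.rpow_neg hb.le]
  refine (norm_integral_le_of_norm_le ((integrableOn_rpow_mul_exp hs hb).const_mul
    (Real.exp (-(z * α).re) * C)) ?_).trans_eq ?_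
  · filter_upwards [ae_restrict_mem measurableSet_Ioi] with t ht
    have := norm_ray_integrand_le hC z (exp_mem_sector_zero hθ) ht
    rwa [norm_exp_angle, Real.one_rpow, mul_one, mul_one] at this
  · rw [integral_const_mul, h1]; ring

theorem exists_mem_frontier_of_isPreconnected {X : Type*} [TopologicalSpace X] {D T : Set X}
    (hD : IsOpen D) (hT : IsPreconnected T) {x y : X} (hx : x ∈ T) (hxD : x ∈ D) (hy : y ∈ T)
    (hyD : y ∉ D) : ∃ v ∈ T, v ∈ frontier D := by
  by_contra! h
  rw [hD.frontier_eq] at h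
  obtain ⟨v, -, hv, hv'⟩ := hT D (closure D)ᶜ hD isClosed_closure.isOpen_compl
    (fun v hv => or_iff_not_imp_left.2 fun hvD hvc => h v hv ⟨hvc, hvD⟩) ⟨x, hx, hxD⟩
    ⟨y, hy, fun hyc => h y hy ⟨hyc, hyD⟩⟩
  exact hv' (subset_closure hv)

/-- Among the half-planes that make up the dual domain, one is almost as deep around `z` as the
domain itself: in the direction `θ` of the deepest one in the closed opening, the step from `z`
orthogonally to the boundary of the half-plane leaves the domain. -/
theorem exists_infDist_le {θ₀ ω Λ : ℝ} (hω : 0 < ω) (hω' : ω ≤ Real.pi / 2) (hΛ : 0 ≤ Λ) {z : ℂ}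
    (hz : z ∈ dualDomain θ₀ ω Λ) : ∃ θ : ℝ, |θ - θ₀| < ω ∧ z ∈ halfPlane θ Λ ∧
      Metric.infDist z (frontier (dualDomain θ₀ ω Λ)) / 2 ≤ (exp (θ * I) * z).re - Λ := by
  have hpi := Real.pi_pos
  set f : ℝ → ℝ := fun θ => (exp (θ * I) * z).re with hf
  have hfd : ∀ θ : ℝ, HasDerivAt f (-(exp (θ * I) * z).im) θ := by
    intro θ
    have h2 : HasDerivAt (fun θ : ℝ => exp (θ * I)) (exp (θ * I) * I) θ := by
      simpa using (((hasDerivAt_id (θ : ℂ)).mul_const I).cexp).comp_ofReal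
    have h3 := (h2.mul_const z)
    have h4 := (reCLM.hasFDerivAt.comp_hasDerivAt θ h3)
    refine h4.congr_deriv ?_
    rw [mul_right_comm]
    simp [mul_re]
  have hfc : Continuous f := continuous_iff_continuousAt.2 fun θ => (hfd θ).continuousAt
  obtain ⟨θm, hθm, hmax⟩ := (isCompact_Icc (a := θ₀ - ω) (b := θ₀ + ω)).exists_isMaxOn
    ⟨θ₀, by constructor <;> linarith⟩ hfc.continuousOn
  obtain ⟨θ₁, hθ₁, hz₁⟩ := hz
  have hb₁ := abs_lt.1 hθ₁
  set M := f θm - Λ with hM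
  have hM0 : 0 < M := by
    have : f θ₁ ≤ f θm := hmax (show θ₁ ∈ Icc _ _ from ⟨by linarith, by linarith⟩)
    have hz₁' : Λ < f θ₁ := hz₁
    linarith
  -- the first-order condition at the maximum, which may be an endpoint of the interval
  have hslope : ∀ θ ∈ Icc (θ₀ - ω) (θ₀ + ω), (θ - θm) * -(exp (θm * I) * z).im ≤ 0 := by
    intro θ hθ
    have h1 := hmax.localize.hasFDerivWithinAt_nonpos (hfd θm).hasFDerivAt.hasFDerivWithinAt
      (y := θ - θm) (mem_posTangentConeAt_of_segment_subset (by
        rw [add_sub_cancel]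
        exact (convex_Icc _ _).segment_subset hθm hθ))
    simpa using h1
  set y := z - M * exp (-(θm * I)) with hy
  -- `y` is the foot of the perpendicular from `z` to the boundary line of the deepest half-plane
  have hyD : y ∉ dualDomain θ₀ ω Λ := by
    rintro ⟨θ, hθ, hlt⟩
    have hb := abs_lt.1 hθ
    have hs := hslope θ ⟨by linarith, by linarith⟩
    have e1 := re_exp_mul_rotate θm (θ - θm) z
    rw [add_sub_cancel] at e1
    have e2 : (exp (θ * I) * y).re = (exp (θ * I) * z).re - M * Real.cos (θ - θm) := by
      have : exp (θ * I) * y = exp (θ * I) * z - M * exp ((θ - θm : ℝ) * I) := by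
        rw [hy, mul_sub, mul_left_comm, ← Complex.exp_add]; push_cast; ring_nf
      rw [this, sub_re, re_ofReal_mul, exp_ofReal_mul_I_re]
    rw [e2, e1] at hlt
    have h3 : -(exp (θm * I) * z).im * Real.sin (θ - θm) ≤ 0 := by
      rcases le_total 0 (θ - θm) with h | h
      · have h4 := Real.sin_nonneg_of_nonneg_of_le_pi h (by linarith [hθm.1])
        rcases h.eq_or_lt with h0 | h0
        · rw [← h0, Real.sin_zero, mul_zero]
        · have : -(exp (θm * I) * z).im ≤ 0 := by
            by_contra hc; push Not at hc; linarith [mul_pos h0 hc]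
          exact mul_nonpos_of_nonpos_of_nonneg this h4
      · have h4 := Real.sin_nonpos_of_nonpos_of_neg_pi_le h (by linarith [hθm.2])
        rcases h.eq_or_lt with h0 | h0
        · rw [h0, Real.sin_zero, mul_zero]
        · have : 0 ≤ -(exp (θm * I) * z).im := by
            by_contra hc; push Not at hc; linarith [mul_pos_of_neg_of_neg h0 hc]
          exact mul_nonpos_of_nonneg_of_nonpos this h4
    have h5 : Λ * Real.cos (θ - θm) ≤ Λ := mul_le_of_le_one_right hΛ (Real.cos_le_one _)
    have h6 : (exp (θm * I) * z).re = M + Λ := by rw [hM]; ring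
    rw [h6] at hlt
    linarith
  have hdist : Metric.infDist z (frontier (dualDomain θ₀ ω Λ)) ≤ M := by
    obtain ⟨v, hv, hvf⟩ := exists_mem_frontier_of_isPreconnected (isOpen_dualDomain θ₀ ω Λ)
      (convex_segment z y).isPreconnected (left_mem_segment ℝ z y) ⟨θ₁, hθ₁, hz₁⟩
      (right_mem_segment ℝ z y) hyD
    refine (Metric.infDist_le_dist_of_mem hvf).trans ?_
    have h1 : dist z v ≤ dist z y := by
      obtain ⟨a, ha, rfl⟩ := segment_eq_image_lineMap ℝ z y ▸ hv
      rw [dist_left_lineMap, Real.norm_of_nonneg ha.1]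
      exact mul_le_of_le_one_left dist_nonneg ha.2
    refine h1.trans_eq ?_
    rw [hy, dist_eq_norm, sub_sub_cancel, norm_mul, norm_real, Real.norm_of_nonneg hM0.le,
      show -((θm : ℂ) * I) = ((-θm : ℝ) : ℂ) * I by push_cast; ring, norm_exp_angle, mul_one]
  -- The maximum may be attained at an endpoint, which is not an admissible direction; a nearby
  -- direction loses at most half of the depth.
  have hcl : θm ∈ closure (Ioo (θ₀ - ω) (θ₀ + ω)) := by
    rw [closure_Ioo (by linarith)]; exact hθm
  obtain ⟨θ, hθf, hθ⟩ := mem_closure_iff.1 hcl {θ | Λ + M / 2 < f θ}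
    (isOpen_lt continuous_const hfc) (by
      show Λ + M / 2 < f θm
      linarith)
  have hθf' : Λ + M / 2 < f θ := hθf
  refine ⟨θ, abs_lt.2 ⟨by linarith [hθ.1], by linarith [hθ.2]⟩, ?_, ?_⟩
  · show Λ < f θ
    linarith
  · show _ ≤ f θ - Λ
    linarith

/-! ### Existence of the special solution -/

/-- The factor `|w|` comes from the difference quotient near the tip, and costs nothing away from
it. -/
theorem exists_norm_sub_tip_le {U : Set ℂ} {ρ : ℝ} (hρ : 0 < ρ) (hU : Metric.ball 0 ρ ⊆ U)
    {g : ℂ → ℂ} (hg : DifferentiableOn ℂ g (Metric.ball 0 ρ)) {C L : ℝ} (hL : 0 ≤ L)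
    (hC : ∀ w ∈ U, ‖g w‖ ≤ C * Real.exp (L * ‖w‖)) :
    ∃ K : ℝ, ∀ w ∈ U, ‖g w - g 0‖ ≤ K * ‖w‖ * Real.exp (L * ‖w‖) := by
  have h0 : (0 : ℂ) ∈ Metric.ball (0 : ℂ) ρ := Metric.mem_ball_self hρ
  have hC0 : 0 ≤ C := by
    have := (norm_nonneg _).trans (hC 0 (hU h0))
    simpa using this
  have hds : ContinuousOn (dslope g 0) (Metric.closedBall 0 (ρ / 2)) := by
    refine ContinuousOn.mono ?_ (Metric.closedBall_subset_ball (half_lt_self hρ))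
    exact ((differentiableOn_dslope (Metric.ball_mem_nhds _ hρ)).2 hg).continuousOn
  obtain ⟨M, hM⟩ := (isCompact_closedBall (0 : ℂ) (ρ / 2)).exists_bound_of_continuousOn hds
  refine ⟨max M ((C + C) / (ρ / 2)), fun w hw => ?_⟩
  have hexp : 1 ≤ Real.exp (L * ‖w‖) := Real.one_le_exp (by positivity)
  rcases le_or_gt ‖w‖ (ρ / 2) with h | h
  · have h1 := hM w (mem_closedBall_zero_iff.2 h)
    have h2 : g w - g 0 = w * dslope g 0 w := by
      have := sub_smul_dslope g 0 w
      rw [sub_zero, smul_eq_mul] at this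
      exact this.symm
    rw [h2, norm_mul]
    have hM0 : 0 ≤ max M ((C + C) / (ρ / 2)) := le_max_of_le_right (by positivity)
    calc ‖w‖ * ‖dslope g 0 w‖ ≤ ‖w‖ * max M ((C + C) / (ρ / 2)) := by
          gcongr; exact h1.trans (le_max_left _ _)
      _ = max M ((C + C) / (ρ / 2)) * ‖w‖ * 1 := by ring
      _ ≤ _ := by gcongr
  · have h1 : ‖g 0‖ ≤ C := by simpa using hC 0 (hU h0)
    calc ‖g w - g 0‖ ≤ ‖g w‖ + ‖g 0‖ := norm_sub_le _ _
      _ ≤ C * Real.exp (L * ‖w‖) + C * 1 := by rw [mul_one]; exact add_le_add (hC w hw) h1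
      _ ≤ C * Real.exp (L * ‖w‖) + C * Real.exp (L * ‖w‖) := by gcongr
      _ = (C + C) / (ρ / 2) * (ρ / 2) * Real.exp (L * ‖w‖) := by field_simp
      _ ≤ max M ((C + C) / (ρ / 2)) * ‖w‖ * Real.exp (L * ‖w‖) := by
        gcongr
        exact le_max_right _ _

/-- Gluing the Laplace integrals along all rays of the sector: as the integrals along two rays agree
on the common part of their half-planes, any admissible direction may be chosen at each point. -/
theorem exists_eq_laplace {α : ℂ} {s Λ θ₀ ω : ℝ} (hω' : ω ≤ Real.pi / 2) (hs : -1 < s)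
    (hΛ : 0 ≤ Λ) {φ : ℂ → ℂ} (hφ : HasExpType α s Λ (sector α θ₀ ω) φ) :
    ∃ Ψ : ℂ → ℂ, ∀ θ : ℝ, |θ - θ₀| < ω → EqOn Ψ (laplace α θ φ) (halfPlane θ Λ) := by
  classical
  refine ⟨fun z => if h : z ∈ dualDomain θ₀ ω Λ then laplace α h.choose φ z else 0,
    fun θ hθ z hz => ?_⟩
  have h : z ∈ dualDomain θ₀ ω Λ := ⟨θ, hθ, hz⟩
  simp only [dif_pos h]
  exact laplace_eq_of_mem_halfPlane hω' hs hΛ hφ h.choose_spec.1 hθ h.choose_spec.2 hz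

/-- The Laplace transform of the Borel transform is a special solution. The value of `g` at the tip
yields the leading term, and `g - g 0` gains one power of `|ζ - α|`, hence one power of the distance
to the boundary. -/
theorem exists_isSpecialSolution {P Q : Polynomial ℂ} {R : ℂ → ℂ} {A : ℝ} (hA : 0 < A)
    (hR : DifferentiableOn ℂ R (Metric.ball 0 A⁻¹)) {α : ℂ} (hτ : 0 < (tauOf P Q α).re)
    {θ₀ ω : ℝ} (hω : 0 < ω) (hω' : ω ≤ Real.pi / 2) {ρ : ℝ} (hρ : 0 < ρ) {g : ℂ → ℂ}
    (hg : DifferentiableOn ℂ g (tipDomain θ₀ ω ρ)) (hg0 : g 0 = (Gamma (tauOf P Q α))⁻¹)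
    {C L : ℝ} (hL : 0 ≤ L) (hC : ∀ w ∈ tipDomain θ₀ ω ρ, ‖g w‖ ≤ C * Real.exp (L * ‖w‖))
    (heq : ∀ w ∈ tipDomain θ₀ ω ρ, P.eval (-(α + w)) * g w + w * ∫ s in (0 : ℝ)..1,
        (Q.eval (-(α + s * w)) + borelKernel (taylorCoeff R) ((1 - s) * w)) *
          ((s : ℂ) ^ (tauOf P Q α - 1) * g (s * w)) = 0) :
    ∃ Λ : ℝ, A ≤ Λ ∧
      SolvesVolterra P Q R α (sector α θ₀ ω) (tipPow α θ₀ (tauOf P Q α - 1) g) ∧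
      HasExpType α ((tauOf P Q α).re - 1) Λ (sector α θ₀ ω) (tipPow α θ₀ (tauOf P Q α - 1) g) ∧
      ∃ Ψ : ℂ → ℂ, IsSpecialSolution P Q R α θ₀ ω Λ Ψ ∧ ∀ θ : ℝ, |θ - θ₀| < ω →
        EqOn Ψ (laplace α θ (tipPow α θ₀ (tauOf P Q α - 1) g)) (halfPlane θ Λ) := by
  set τ := tauOf P Q α with hτdef
  obtain ⟨S, hS0, hS⟩ := exists_norm_taylorCoeff_le hA hR (by linarith : A < A + 1)
  have hsub : sector 0 θ₀ ω ⊆ tipDomain θ₀ ω ρ := subset_union_right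
  have hball : Metric.ball 0 ρ ⊆ tipDomain θ₀ ω ρ := subset_union_left
  obtain ⟨K, hK⟩ := exists_norm_sub_tip_le hρ hball (hg.mono hball) hL hC
  set Λ := max (A + 1) L with hΛ
  have hΛA : A + 1 ≤ Λ := le_max_left _ _
  have hΛ0 : 0 < Λ := by linarith
  set φ := tipPow α θ₀ (τ - 1) g with hφdef
  have hs : -1 < τ.re - 1 := by linarith
  have hφ : HasExpType α (τ.re - 1) Λ (sector α θ₀ ω) φ := by
    have := (hasExpType_tipPow (α := α) hω' (τ - 1) (k := 0) (hg.mono hsub)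
      (fun w hw => by simpa using hC w (hsub hw))).mono (le_max_right (A + 1) L)
    simpa using this
  -- the Borel transform of the leading term, and the remainder
  set φ₀ := tipPow α θ₀ (τ - 1) fun _ => (Gamma τ)⁻¹ with hφ₀def
  have hφ₀ : HasExpType α (τ.re - 1) Λ (sector α θ₀ ω) φ₀ := by
    have := (hasExpType_tipPow (α := α) hω' (τ - 1) (k := 0) (L := 0) (C := ‖(Gamma τ)⁻¹‖)
      (g := fun _ => (Gamma τ)⁻¹) (θ₀ := θ₀) (ω := ω) (differentiableOn_const _)
      (fun w hw => by simp)).mono hΛ0.le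
    simpa using this
  set χ := tipPow α θ₀ (τ - 1) fun w => g w - (Gamma τ)⁻¹ with hχdef
  have hχ : HasExpType α τ.re Λ (sector α θ₀ ω) χ := by
    have := (hasExpType_tipPow (α := α) hω' (τ - 1) (k := 1) ((hg.mono hsub).sub_const (Gamma τ)⁻¹)
      (fun w hw => by simpa [hg0] using hK w (hsub hw))).mono (le_max_right (A + 1) L)
    simpa using this
  obtain ⟨Ψ, hΨ⟩ := exists_eq_laplace hω' hs hΛ0.le hφ
  have hseg : SegmentVolterra P Q (taylorCoeff R) α (sector 0 θ₀ ω) φ :=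
    segmentVolterra_tipPow fun w hw => heq w (hsub hw)
  refine ⟨Λ, by linarith, hseg.solvesVolterra hS0 (by linarith) hS hs hφ, hφ, Ψ, ?_, hΨ⟩
  have hsplit : ∀ θ : ℝ, |θ - θ₀| < ω → ∀ z ∈ halfPlane θ Λ,
      Ψ z = exp (-α * z) * branchPow (-θ₀) (-τ) z + laplace α θ χ z := by
    intro θ hθ z hz
    have hz0 : z ∈ halfPlane θ 0 := hΛ0.trans hz
    rw [hΨ θ hθ hz, ← laplace_tipPow_const hτ hω' hθ hz0, laplace, laplace, laplace, ← integral_add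
      (hφ₀.integrableOn_laplaceIntegrand hs hθ hz)
      (hχ.integrableOn_laplaceIntegrand (by linarith) hθ hz)]
    congr 1
    ext t
    simp only [laplaceIntegrand, hφdef, hφ₀def, hχdef, tipPow]
    ring
  have hexp : ∀ z, exp (α * z) * exp (-α * z) = 1 := fun z => by
    rw [← Complex.exp_add]; simp
  obtain ⟨C', hC'⟩ := hχ.exists_norm_laplace_le (by linarith)
  refine ⟨?_, ?_, fun z => exp (α * z) * Ψ z - branchPow (-θ₀) (-τ) z, ⟨?_, |C'| * 2 ^ (τ.re + 1), ?_⟩,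
    ?_⟩
  · rintro z ⟨θ, hθ, hz⟩
    exact ((hφ.hasDerivAt_laplace hs hθ hz).differentiableAt.congr_of_eventuallyEq
      ((hΨ θ hθ).eventuallyEq_of_mem
        ((isOpen_halfPlane θ Λ).mem_nhds hz))).differentiableWithinAt
  · rintro z ⟨θ, hθ, hz⟩
    have h1 := levelOneOp_laplace hA (by linarith : A < A + 1) hR hS0 hS hs hφ hseg hΛA hθ hz
    rw [levelOneOp] at h1 ⊢
    rw [polyDiff_congr (isOpen_halfPlane θ Λ) (hΨ θ hθ) P hz,
      polyDiff_congr (isOpen_halfPlane θ Λ) (hΨ θ hθ) Q hz, hΨ θ hθ hz]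
    exact h1
  · rintro z ⟨θ, hθ, hz⟩
    have h1 : (fun z => exp (α * z) * Ψ z - branchPow (-θ₀) (-τ) z) =ᶠ[𝓝 z]
        fun z => exp (α * z) * laplace α θ χ z := by
      filter_upwards [(isOpen_halfPlane θ Λ).mem_nhds hz] with y hy
      rw [hsplit θ hθ y hy]
      linear_combination branchPow (-θ₀) (-τ) y * hexp y
    refine (DifferentiableAt.congr_of_eventuallyEq ?_ h1).differentiableWithinAt
    exact (by fun_prop : DifferentiableAt ℂ (fun z => exp (α * z)) z).mul
      (hχ.hasDerivAt_laplace (by linarith) hθ hz).differentiableAt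
  · intro z hz
    obtain ⟨θ, hθ, hzθ, hle⟩ := exists_infDist_le hω hω' hΛ0.le hz
    have hpos : 0 < Metric.infDist z (frontier (dualDomain θ₀ ω Λ)) := by
      rw [← isClosed_frontier.notMem_iff_infDist_pos (frontier_dualDomain_nonempty hω hΛ0),
        (isOpen_dualDomain θ₀ ω Λ).frontier_eq]
      exact fun h => h.2 hz
    set Δ := Metric.infDist z (frontier (dualDomain θ₀ ω Λ))
    have h1 : exp (α * z) * Ψ z - branchPow (-θ₀) (-τ) z = exp (α * z) * laplace α θ χ z := by
      rw [hsplit θ hθ z hzθ]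
      linear_combination branchPow (-θ₀) (-τ) z * hexp z
    have h2 := hC' θ hθ z hzθ
    have h3 : ((exp (θ * I) * z).re - Λ) ^ (-(τ.re + 1)) ≤ (Δ / 2) ^ (-(τ.re + 1)) :=
      Real.rpow_le_rpow_of_nonpos (by positivity) hle (by linarith)
    have h4 : (Δ / 2) ^ (-(τ.re + 1)) = 2 ^ (τ.re + 1) * Δ ^ (-τ.re - 1) := by
      rw [div_eq_mul_inv, Real.mul_rpow hpos.le (by positivity), Real.inv_rpow (by norm_num),
        Real.rpow_neg zero_le_two, inv_inv, mul_comm]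
      congr 2
      ring
    have h5 : 0 ≤ ((exp (θ * I) * z).re - Λ) ^ (-(τ.re + 1)) :=
      Real.rpow_nonneg (sub_nonneg.2 (le_of_lt hzθ)) _
    simp only
    rw [h1, norm_mul, norm_exp]
    calc _ ≤ Real.exp (α * z).re * (Real.exp (-(z * α).re) *
          (C' * ((exp (θ * I) * z).re - Λ) ^ (-(τ.re + 1)))) := by gcongr
      _ = C' * ((exp (θ * I) * z).re - Λ) ^ (-(τ.re + 1)) := by
        rw [← mul_assoc, ← Real.exp_add, mul_comm z α, add_neg_cancel, Real.exp_zero, one_mul]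
      _ ≤ |C'| * (2 ^ (τ.re + 1) * Δ ^ (-τ.re - 1)) := by
        rw [← h4]
        exact mul_le_mul (le_abs_self _) h3 h5 (abs_nonneg _)
      _ = _ := by ring
  · intro z _
    linear_combination -Ψ z * hexp z

/-! ### The formal Borel transform -/

theorem Gamma_add_natCast_ne_zero {τ : ℂ} (hτ : 0 < τ.re) (n : ℕ) : Gamma (τ + n) ≠ 0 :=
  Gamma_ne_zero_of_re_pos (by simp; positivity)

theorem borelCoeff_add (τ : ℂ) (F G : PowerSeries ℂ) (n : ℕ) :
    borelCoeff τ (F + G) n = borelCoeff τ F n + borelCoeff τ G n := by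
  simp [borelCoeff, add_div]

/-- A power series in `w` without constant term, given by the remaining coefficients. -/
theorem hasSum_shift {b b' : ℕ → ℂ} {w h : ℂ} (h0 : b' 0 = 0) (hs : ∀ n, b' (n + 1) = b n)
    (hb : HasSum (fun n => b n * w ^ n) h) : HasSum (fun n => b' n * w ^ n) (w * h) := by
  rw [← hasSum_nat_add_iff' 1]
  simp only [hs, Finset.sum_range_one, h0, zero_mul, sub_zero]
  have h1 : (fun n => b n * w ^ (n + 1)) = fun n => w * (b n * w ^ n) := by ext n; ring
  rw [h1]
  exact hb.mul_left w

/-- The Borel transform turns `d/dz` into multiplication by `-(α + w)`. -/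
theorem hasSum_borelCoeff_formalDeriv {α τ : ℂ} (hτ : 0 < τ.re) {G : PowerSeries ℂ} {w h : ℂ}
    (hG : HasSum (fun n => borelCoeff τ G n * w ^ n) h) :
    HasSum (fun n => borelCoeff τ (formalDeriv α τ G) n * w ^ n) (-(α + w) * h) := by
  have h1 : HasSum (fun n => (borelCoeff τ (formalDeriv α τ G) n + α * borelCoeff τ G n) * w ^ n)
      (w * -h) := by
    refine hasSum_shift (b := fun n => -borelCoeff τ G n) ?_ (fun n => ?_) ?_
    · simp [borelCoeff, formalDeriv, PowerSeries.coeff_zero_eq_constantCoeff]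
      ring
    · have h2 : PowerSeries.coeff (n + 1) (formalDeriv α τ G) =
          -(α * PowerSeries.coeff (n + 1) G) - (τ + n) * PowerSeries.coeff n G := by
        simp only [formalDeriv, LinearMap.sub_apply, LinearMap.neg_apply, LinearMap.smul_apply,
          LinearMap.id_apply, LinearMap.mulLeft_apply, LinearMap.comp_apply, map_sub, map_neg,
          map_smul, smul_eq_mul, PowerSeries.coeff_succ_X_mul, pow_two, mul_assoc]
        rcases n with _ | n
        · simp [PowerSeries.coeff_zero_eq_constantCoeff]
        · rw [PowerSeries.coeff_succ_X_mul]
          have h3 : PowerSeries.coeff n ((PowerSeries.derivative ℂ).toLinearMap G) =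
              PowerSeries.coeff (n + 1) G * (n + 1) := PowerSeries.coeff_derivative G n
          rw [h3]
          push_cast
          ring
      have h3 := Gamma_add_natCast_ne_zero hτ n
      have h4 : τ + n ≠ 0 := fun h => by
        have : 0 < (τ + n).re := by simp; positivity
        rw [h] at this; simp at this
      have h5 : Gamma (τ + (n + 1 : ℕ)) = (τ + n) * Gamma (τ + n) := by
        rw [← Complex.Gamma_add_one _ h4]; push_cast; ring_nf
      simp only [borelCoeff]
      rw [h2, h5]
      field_simp
      ring
    · simpa using hG.neg
  have h6 := h1.sub (hG.mul_left α)
  have h7 : (fun n => (borelCoeff τ (formalDeriv α τ G) n + α * borelCoeff τ G n) * w ^ n -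
      α * (borelCoeff τ G n * w ^ n)) = fun n => borelCoeff τ (formalDeriv α τ G) n * w ^ n := by
    ext n; ring
  rw [h7, show w * -h - α * h = -(α + w) * h by ring] at h6
  exact h6

theorem hasSum_borelCoeff_aeval {α τ : ℂ} (hτ : 0 < τ.re) {F : PowerSeries ℂ} {w h : ℂ}
    (hF : HasSum (fun n => borelCoeff τ F n * w ^ n) h) (p : Polynomial ℂ) :
    HasSum (fun n => borelCoeff τ (Polynomial.aeval (formalDeriv α τ) p F) n * w ^ n)
      (p.eval (-(α + w)) * h) := by
  induction p using polynomial_induction_X_mul with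
  | hC c =>
    have h1 : (fun n => borelCoeff τ (Polynomial.aeval (formalDeriv α τ) (Polynomial.C c) F) n * w ^ n) =
        fun n => c * (borelCoeff τ F n * w ^ n) := by
      ext n
      simp [borelCoeff, Module.algebraMap_end_apply]
      ring
    rw [h1, Polynomial.eval_C]
    exact hF.mul_left c
  | hadd p q hp hq =>
    have h1 : (fun n => borelCoeff τ (Polynomial.aeval (formalDeriv α τ) (p + q) F) n * w ^ n) =
        fun n => borelCoeff τ (Polynomial.aeval (formalDeriv α τ) p F) n * w ^ n +
          borelCoeff τ (Polynomial.aeval (formalDeriv α τ) q F) n * w ^ n := by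
      ext n
      rw [map_add, LinearMap.add_apply, borelCoeff_add, add_mul]
    rw [h1, Polynomial.eval_add, add_mul]
    exact hp.add hq
  | hX p hp =>
    rw [map_mul, Polynomial.aeval_X, Module.End.mul_apply, Polynomial.eval_mul, Polynomial.eval_X,
      mul_assoc]
    exact hasSum_borelCoeff_formalDeriv hτ hp

theorem hasSum_antidiagonal {f : ℕ × ℕ → ℂ} {a : ℂ} (h : HasSum f a) :
    HasSum (fun N => ∑ p ∈ Finset.HasAntidiagonal.antidiagonal N, f p) a := by
  have h1 := (Finset.HasAntidiagonal.sigmaAntidiagonalEquivProd (A := ℕ)).hasSum_iff.2 h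
  refine h1.sigma fun N => ?_
  have h2 := hasSum_fintype (fun p : Finset.HasAntidiagonal.antidiagonal N => f p)
  rwa [Finset.sum_coe_sort _ f] at h2

/-- The convolution of two monomials, from the Beta integral. -/
theorem integral_beta_term {τ : ℂ} (hτ : 0 < τ.re) (j n : ℕ) :
    (∫ s in (0 : ℝ)..1, (1 - (s : ℂ)) ^ j / j.factorial * ((s : ℂ) ^ (τ - 1) * (s : ℂ) ^ n)) =
      Gamma (τ + n) / Gamma (τ + (n + j + 1 : ℕ)) := by
  have h1 := betaIntegral_eq_Gamma_mul_div (τ + n) (j + 1) (by simp; positivity) (by simp; positivity)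
  rw [Complex.Gamma_nat_eq_factorial, betaIntegral] at h1
  have h2 : (∫ s in (0 : ℝ)..1, (1 - (s : ℂ)) ^ j / j.factorial * ((s : ℂ) ^ (τ - 1) * (s : ℂ) ^ n)) =
      (j.factorial : ℂ)⁻¹ * ∫ s in (0 : ℝ)..1, (s : ℂ) ^ (τ + n - 1) * (1 - (s : ℂ)) ^ ((j : ℂ) + 1 - 1) := by
    rw [← intervalIntegral.integral_const_mul]
    refine intervalIntegral.integral_congr_ae (Eventually.of_forall fun s hs => ?_)
    rw [uIoc_of_le zero_le_one] at hs
    have hs0 : (s : ℂ) ≠ 0 := ofReal_ne_zero.2 hs.1.ne'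
    rw [add_sub_cancel_right, cpow_natCast, show τ + n - 1 = τ - 1 + n by ring, cpow_add _ _ hs0,
      cpow_natCast]
    ring
  have h3 : (j.factorial : ℂ) ≠ 0 := by exact_mod_cast j.factorial_ne_zero
  rw [h2, h1, show τ + n + (j + 1) = τ + (n + j + 1 : ℕ) by push_cast; ring]
  field_simp

/-- The Borel transform turns multiplication by `X * ∑ e_j X ^ j` into the convolution with
`∑ e_j x ^ j / j!`; here the factor `w ^ (τ - 1)` is divided out. -/
theorem hasSum_borelCoeff_X_mul {τ : ℂ} (hτ : 0 < τ.re) {e : ℕ → ℂ} {K : ℂ → ℂ}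
    (hK : ∀ x, HasSum (fun j => e j * (x ^ j / j.factorial)) (K x)) {G : PowerSeries ℂ} {h : ℂ → ℂ}
    {ρ : ℝ} (hG : ∀ w : ℂ, ‖w‖ < ρ → HasSum (fun n => borelCoeff τ G n * w ^ n) (h w)) {w : ℂ}
    (hw : ‖w‖ < ρ) :
    HasSum (fun N => borelCoeff τ (PowerSeries.X * (PowerSeries.mk e * G)) N * w ^ N)
      (w * ∫ s in (0 : ℝ)..1, K ((1 - s) * w) * ((s : ℂ) ^ (τ - 1) * h (s * w))) := by
  set b := borelCoeff τ G with hb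
  have hsK : Summable fun j => ‖e j * (w ^ j / j.factorial)‖ := (hK w).summable.norm
  have hsb : Summable fun n => ‖b n * w ^ n‖ := (hG w hw).summable.norm
  set F : ℕ × ℕ → ℝ → ℂ := fun p s => e p.1 * (((1 - s) * w) ^ p.1 / p.1.factorial) *
    ((s : ℂ) ^ (τ - 1) * (b p.2 * (s * w) ^ p.2)) with hF
  have hFint : ∀ p, ∫ s in (0 : ℝ)..1, F p s = e p.1 * b p.2 * w ^ (p.1 + p.2) *
      (Gamma (τ + p.2) / Gamma (τ + (p.2 + p.1 + 1 : ℕ))) := by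
    intro p
    rw [← integral_beta_term hτ, ← intervalIntegral.integral_const_mul]
    refine intervalIntegral.integral_congr fun s _ => ?_
    simp only [hF]
    rw [mul_pow, mul_pow, pow_add]
    ring
  have hsum : HasSum (fun p => ∫ s in (0 : ℝ)..1, F p s)
      (∫ s in (0 : ℝ)..1, K ((1 - s) * w) * ((s : ℂ) ^ (τ - 1) * h (s * w))) := by
    have hprod := hsK.mul_of_nonneg hsb (fun _ => norm_nonneg _) (fun _ => norm_nonneg _)
    refine intervalIntegral.hasSum_integral_of_dominated_convergence (bound := fun p s =>
      ‖e p.1 * (w ^ p.1 / p.1.factorial)‖ * ‖b p.2 * w ^ p.2‖ * s ^ (τ.re - 1)) (fun p => ?_)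
      (fun p => ?_) (Eventually.of_forall fun s _ => hprod.mul_right _) ?_ ?_
    · refine ContinuousOn.aestronglyMeasurable ?_ measurableSet_uIoc
      rw [uIoc_of_le zero_le_one]
      have h1 : ContinuousOn (fun s : ℝ => (s : ℂ) ^ (τ - 1)) (Ioc 0 1) := fun s hs =>
        (continuousAt_ofReal_cpow_const s (τ - 1) (Or.inr hs.1.ne')).continuousWithinAt
      exact (Continuous.continuousOn (by fun_prop)).mul (h1.mul (Continuous.continuousOn (by fun_prop)))
    · refine Eventually.of_forall fun s hs => ?_
      rw [uIoc_of_le zero_le_one] at hs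
      have h1 : ‖(1 - (s : ℂ)) * w‖ ≤ ‖w‖ := by
        rw [show 1 - (s : ℂ) = ((1 - s : ℝ) : ℂ) by push_cast; rfl, norm_ofReal_mul_le
          ⟨by linarith [hs.2], by linarith [hs.1]⟩]
        exact mul_le_of_le_one_left (norm_nonneg _) (by linarith [hs.1])
      have h2 : ‖(s : ℂ) * w‖ ≤ ‖w‖ := by
        rw [norm_ofReal_mul_le ⟨hs.1.le, hs.2⟩]
        exact mul_le_of_le_one_left (norm_nonneg _) hs.2
      have h3 : ‖(s : ℂ) ^ (τ - 1)‖ = s ^ (τ.re - 1) := by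
        rw [norm_cpow_eq_rpow_re_of_pos hs.1]; simp
      have h4 : 0 ≤ s ^ (τ.re - 1) := Real.rpow_nonneg hs.1.le _
      simp only [hF, norm_mul, norm_div, norm_pow (_ : ℂ), h3] at h1 h2 ⊢
      calc _ ≤ ‖e p.1‖ * (‖w‖ ^ p.1 / ‖(p.1.factorial : ℂ)‖) *
            (s ^ (τ.re - 1) * (‖b p.2‖ * ‖w‖ ^ p.2)) := by gcongr
        _ = _ := by ring
    · rw [intervalIntegrable_congr (g := fun s => (∑' p : ℕ × ℕ,
        ‖e p.1 * (w ^ p.1 / p.1.factorial)‖ * ‖b p.2 * w ^ p.2‖) * s ^ (τ.re - 1))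
        (fun s _ => tsum_mul_right)]
      exact (intervalIntegral.intervalIntegrable_rpow' (by linarith)).const_mul _
    · refine Eventually.of_forall fun s hs => ?_
      rw [uIoc_of_le zero_le_one] at hs
      have h2 : ‖(s : ℂ) * w‖ < ρ := by
        rw [norm_ofReal_mul_le ⟨hs.1.le, hs.2⟩]
        exact (mul_le_of_le_one_left (norm_nonneg _) hs.2).trans_lt hw
      have h3 := hK ((1 - s) * w)
      have h4 := (hG _ h2).mul_left ((s : ℂ) ^ (τ - 1))
      have h5 := summable_mul_of_summable_norm h3.summable.norm h4.summable.norm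
      have h6 := h3.mul h4 h5
      exact h6
  simp_rw [hFint] at hsum
  have h1 := hasSum_antidiagonal hsum
  refine hasSum_shift (b := fun N => borelCoeff τ (PowerSeries.X * (PowerSeries.mk e * G)) (N + 1))
    (by simp [borelCoeff]) (fun N => rfl) ?_
  have h2 : (fun N => borelCoeff τ (PowerSeries.X * (PowerSeries.mk e * G)) (N + 1) * w ^ N) =
      fun N => ∑ p ∈ Finset.HasAntidiagonal.antidiagonal N, e p.1 * b p.2 * w ^ (p.1 + p.2) *
        (Gamma (τ + p.2) / Gamma (τ + (p.2 + p.1 + 1 : ℕ))) := by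
    ext N
    rw [borelCoeff, PowerSeries.coeff_succ_X_mul, PowerSeries.coeff_mul, Finset.sum_div,
      Finset.sum_mul]
    refine Finset.sum_congr rfl fun p hp => ?_
    have hp : p.1 + p.2 = N := Finset.HasAntidiagonal.mem_antidiagonal.1 hp
    have h3 := Gamma_add_natCast_ne_zero hτ p.2
    rw [show p.2 + p.1 + 1 = N + 1 by omega, hp, PowerSeries.coeff_mk]
    simp only [hb, borelCoeff]
    field_simp
  rw [h2]
  exact h1

theorem eq_zero_of_hasSum_zero {e : ℕ → ℂ} {ρ : ℝ} (hρ : 0 < ρ)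
    (h : ∀ w : ℂ, ‖w‖ < ρ → HasSum (fun n => e n * w ^ n) 0) (n : ℕ) : e n = 0 := by
  have h1 : HasFPowerSeriesAt (0 : ℂ → ℂ) (FormalMultilinearSeries.ofScalars ℂ e) 0 := by
    rw [hasFPowerSeriesAt_iff]
    filter_upwards [Metric.ball_mem_nhds (0 : ℂ) hρ] with w hw
    have := h w (mem_ball_zero_iff.1 hw)
    simpa [FormalMultilinearSeries.coeff_ofScalars, mul_comm] using this
  have h2 := h1.eq_zero
  have h3 : (FormalMultilinearSeries.ofScalars ℂ e).coeff n = 0 := by rw [h2]; rfl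
  rwa [FormalMultilinearSeries.coeff_ofScalars] at h3

/-- If the Borel transform of `F` sums to a solution `g` of the integral equation near the tip, then
`F` solves the differential equation formally. -/
theorem formalOp_eq_zero {P Q : Polynomial ℂ} {R : ℂ → ℂ} {α τ : ℂ} (hτ : 0 < τ.re) {S L : ℝ}
    (hS0 : 0 ≤ S) (hL : 0 ≤ L) (hS : ∀ j, ‖taylorCoeff R j‖ ≤ S * L ^ j) {F : PowerSeries ℂ}
    {g : ℂ → ℂ} {ρ : ℝ} (hρ : 0 < ρ) (hgc : ContinuousOn g (Metric.ball 0 ρ))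
    (hF : ∀ w : ℂ, ‖w‖ < ρ → HasSum (fun n => borelCoeff τ F n * w ^ n) (g w))
    (heq : ∀ w : ℂ, ‖w‖ < ρ → P.eval (-(α + w)) * g w + w * ∫ s in (0 : ℝ)..1,
        (Q.eval (-(α + s * w)) + borelKernel (taylorCoeff R) ((1 - s) * w)) *
          ((s : ℂ) ^ (τ - 1) * g (s * w)) = 0) :
    formalOp P Q R α τ F = 0 := by
  set r := taylorCoeff R
  have hone : ∀ x : ℂ, HasSum (fun j : ℕ => (if j = 0 then (1 : ℂ) else 0) * (x ^ j / j.factorial)) 1 := by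
    intro x
    have := hasSum_single (f := fun j : ℕ => (if j = 0 then (1 : ℂ) else 0) * (x ^ j / j.factorial)) 0
      (fun j hj => by simp [hj])
    simpa using this
  have hker : ∀ x : ℂ, HasSum (fun j : ℕ => (PowerSeries.coeff j (PowerSeries.X * PowerSeries.mk r)) *
      (x ^ j / j.factorial)) (borelKernel r x) := by
    intro x
    rw [← hasSum_nat_add_iff' 1]
    simpa [PowerSeries.coeff_succ_X_mul] using hasSum_borelKernel hS x
  have hmk1 : PowerSeries.mk (fun j : ℕ => if j = 0 then (1 : ℂ) else 0) = 1 := by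
    ext j; simp [PowerSeries.coeff_one]
  have hmk2 : PowerSeries.mk (fun j => PowerSeries.coeff j (PowerSeries.X * PowerSeries.mk r)) =
      PowerSeries.X * PowerSeries.mk r := by
    ext j; simp
  have hsum : ∀ w : ℂ, ‖w‖ < ρ → HasSum (fun n => borelCoeff τ (formalOp P Q R α τ F) n * w ^ n) 0 := by
    intro w hw
    have h1 := hasSum_borelCoeff_aeval (α := α) hτ (hF w hw) P
    have h2 := hasSum_borelCoeff_X_mul hτ hone (fun w hw => hasSum_borelCoeff_aeval (α := α) hτ (hF w hw) Q) hw
    have h3 := hasSum_borelCoeff_X_mul hτ hker hF hw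
    rw [hmk1, one_mul] at h2
    rw [hmk2, ← mul_assoc, ← mul_assoc, ← pow_two] at h3
    have h4 := (h1.add h2).add h3
    have hkc : Continuous (borelKernel r) := Differentiable.continuous (𝕜 := ℂ) fun x =>
      (hasDerivAt_borelKernel hS0 hL hS x).differentiableAt
    have hgw : ContinuousOn (fun s : ℝ => g (s * w)) (uIcc 0 1) := by
      refine hgc.comp (Continuous.continuousOn (by fun_prop)) fun s hs => ?_
      rw [uIcc_of_le zero_le_one] at hs
      rw [mem_ball_zero_iff, norm_ofReal_mul_le hs]
      exact (mul_le_of_le_one_left (norm_nonneg _) hs.2).trans_lt hw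
    have hpow : IntervalIntegrable (fun s : ℝ => (s : ℂ) ^ (τ - 1)) volume 0 1 :=
      intervalIntegral.intervalIntegrable_cpow' (by simp; linarith)
    have hint : ∀ {u : ℝ → ℂ}, Continuous u →
        IntervalIntegrable (fun s : ℝ => u s * ((s : ℂ) ^ (τ - 1) * g (s * w))) volume 0 1 :=
      fun hu => (hpow.mul_continuousOn hgw).continuousOn_mul hu.continuousOn
    have h5 : (∫ s in (0 : ℝ)..1, (Q.eval (-(α + s * w)) + borelKernel r ((1 - s) * w)) *
          ((s : ℂ) ^ (τ - 1) * g (s * w))) =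
        (∫ s in (0 : ℝ)..1, (1 : ℂ) * ((s : ℂ) ^ (τ - 1) * (Q.eval (-(α + s * w)) * g (s * w)))) +
        ∫ s in (0 : ℝ)..1, borelKernel r ((1 - s) * w) * ((s : ℂ) ^ (τ - 1) * g (s * w)) := by
      have h6 : ∀ s : ℝ, (1 : ℂ) * ((s : ℂ) ^ (τ - 1) * (Q.eval (-(α + s * w)) * g (s * w))) =
          Q.eval (-(α + s * w)) * ((s : ℂ) ^ (τ - 1) * g (s * w)) := fun s => by ring
      simp_rw [h6]
      rw [← intervalIntegral.integral_add (hint (u := fun s => Q.eval (-(α + s * w)))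
        (Q.continuous.comp (by fun_prop))) (hint (u := fun s => borelKernel r ((1 - s) * w))
        (hkc.comp (by fun_prop)))]
      simp_rw [add_mul]
    have h7 := heq w hw
    rw [h5, mul_add, ← add_assoc] at h7
    rw [h7] at h4
    have h8 : (fun n => borelCoeff τ (formalOp P Q R α τ F) n * w ^ n) = fun n =>
        borelCoeff τ (Polynomial.aeval (formalDeriv α τ) P F) n * w ^ n +
        borelCoeff τ (PowerSeries.X * Polynomial.aeval (formalDeriv α τ) Q F) n * w ^ n +
        borelCoeff τ (PowerSeries.X ^ 2 * PowerSeries.mk r * F) n * w ^ n := by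
      ext n
      rw [formalOp, borelCoeff_add, borelCoeff_add]
      ring
    rw [h8]
    exact h4
  ext n
  have := eq_zero_of_hasSum_zero hρ hsum n
  rw [borelCoeff, div_eq_zero_iff] at this
  simpa using this.resolve_right (Gamma_add_natCast_ne_zero hτ n)

end LevelOneODE

end

open LevelOneODE

theorem theorem1p6
    (P Q : Polynomial ℂ) (hP : P.Monic)
    (hPsimple : ∀ r : ℂ, P.IsRoot r → P.rootMultiplicity r = 1)
    (hQdeg : Q.natDegree + 1 = P.natDegree)
    (hQ : ∀ r : ℂ, P.IsRoot r → Q.eval r ≠ 0)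
    (R : ℂ → ℂ) (A : ℝ) (hA : 0 < A) (hR : DifferentiableOn ℂ R (Metric.ball 0 A⁻¹))
    (α : ℂ) (hα : P.IsRoot (-α))
    (hτ : 0 < (LevelOneODE.tauOf P Q α).re)
    (θ₀ ω : ℝ) (hω : 0 < ω) (hω' : ω ≤ Real.pi / 2)
    (hsector : ∀ β : ℂ, β ≠ α → P.IsRoot (-β) → β ∉ closure (LevelOneODE.sector α θ₀ ω)) :
    -- the analytic solution exists and is unique
    (∃ Λ : ℝ, A ≤ Λ ∧ ∃ Ψ : ℂ → ℂ, LevelOneODE.IsSpecialSolution P Q R α θ₀ ω Λ Ψ) ∧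
    (∀ Λ₁ Λ₂ : ℝ, A ≤ Λ₁ → A ≤ Λ₂ → ∀ Ψ₁ Ψ₂ : ℂ → ℂ,
      LevelOneODE.IsSpecialSolution P Q R α θ₀ ω Λ₁ Ψ₁ →
      LevelOneODE.IsSpecialSolution P Q R α θ₀ ω Λ₂ Ψ₂ →
      Set.EqOn Ψ₁ Ψ₂ (LevelOneODE.dualDomain θ₀ ω (max Λ₁ Λ₂))) ∧
    -- it is the Borel sum of a formal solution
    (∀ Λ : ℝ, A ≤ Λ → ∀ Ψ : ℂ → ℂ, LevelOneODE.IsSpecialSolution P Q R α θ₀ ω Λ Ψ →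
      ∃ F : PowerSeries ℂ,
        LevelOneODE.formalOp P Q R α (LevelOneODE.tauOf P Q α) F = 0 ∧
        ∃ Λ' : ℝ, Λ ≤ Λ' ∧ ∃ ψ : ℂ → ℂ,
          LevelOneODE.SolvesVolterra P Q R α (LevelOneODE.sector α θ₀ ω) ψ ∧
          LevelOneODE.IsBorelSum α (LevelOneODE.tauOf P Q α) θ₀ ω Λ' F ψ Ψ) := by
  obtain ⟨ρ, hρ, g, hg, hg0, ⟨C, L, -, hL, hC⟩, heq⟩ :=
    exists_tip_function hP hPsimple hQdeg hA hR hα hτ hω' hsector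
  obtain ⟨Λ₀, hΛ₀, hvolt, hexp, Ψ₀, hΨ₀, hlap⟩ :=
    exists_isSpecialSolution hA hR hτ hω hω' hρ hg hg0 hL hC heq
  have huniq : ∀ Λ₁ Λ₂ : ℝ, A ≤ Λ₁ → A ≤ Λ₂ → ∀ Ψ₁ Ψ₂ : ℂ → ℂ,
      IsSpecialSolution P Q R α θ₀ ω Λ₁ Ψ₁ → IsSpecialSolution P Q R α θ₀ ω Λ₂ Ψ₂ →
      Set.EqOn Ψ₁ Ψ₂ (dualDomain θ₀ ω (max Λ₁ Λ₂)) := fun Λ₁ Λ₂ hΛ₁ hΛ₂ Ψ₁ Ψ₂ h₁ h₂ =>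
    IsSpecialSolution.eqOn hP hPsimple hA hR hα hτ hω hω' hsector hΛ₁ hΛ₂ h₁ h₂
  refine ⟨⟨Λ₀, hΛ₀, Ψ₀, hΨ₀⟩, huniq, fun Λ hΛ Ψ hΨ => ?_⟩
  set τ := tauOf P Q α
  have hball : Metric.ball 0 ρ ⊆ tipDomain θ₀ ω ρ := Set.subset_union_left
  obtain ⟨S, hS0, hS⟩ := exists_norm_taylorCoeff_le hA hR (by linarith : A < A + 1)
  -- the inverse Borel transform of the Taylor series of `g` at the tip
  set F : PowerSeries ℂ := PowerSeries.mk fun n => Complex.Gamma (τ + n) * taylorCoeff g n with hF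
  have hcoeff : ∀ n, borelCoeff τ F n = taylorCoeff g n := fun n => by
    rw [borelCoeff, hF, PowerSeries.coeff_mk,
      mul_div_cancel_left₀ _ (Gamma_add_natCast_ne_zero hτ n)]
  have hsum : ∀ w : ℂ, ‖w‖ < ρ → HasSum (fun n => borelCoeff τ F n * w ^ n) (g w) := by
    intro w hw
    simp_rw [hcoeff]
    exact hasSum_taylorCoeff (hg.mono hball) (mem_ball_zero_iff.2 hw)
  refine ⟨F, formalOp_eq_zero hτ hS0 (by linarith) hS hρ (hg.mono hball).continuousOn hsum
    fun w hw => heq w (hball (mem_ball_zero_iff.2 hw)), max Λ Λ₀, le_max_left _ _,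
    tipPow α θ₀ (τ - 1) g, hvolt, ⟨⟨ρ, hρ, fun w hw => (hsum w hw).summable, fun ζ _ hζ => ?_⟩,
    hexp.mono (le_max_right _ _), fun θ hθ z hz => ⟨?_, ?_⟩⟩⟩
  · rw [tipPow, (hsum _ hζ).tsum_eq]
  · exact (hexp.mono (le_max_right Λ Λ₀)).integrableOn_laplaceIntegrand (by linarith) hθ hz
  -- uniqueness identifies the given solution with the Laplace transform on the smaller domain
  · rw [huniq Λ Λ₀ hΛ hΛ₀ Ψ Ψ₀ hΨ hΨ₀ ⟨θ, hθ, hz⟩]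
    exact hlap θ hθ ((le_max_right Λ Λ₀).trans_lt hz)
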